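/- For $d\ge 1$ let $\{|\omega\rangle\}_{\omega=1}^{d}$ be an orthonormal basis of $\mathbb{C}^d$, and let $|m\rangle=\frac{1}{\sqrt d}\sum_{\omega=1}^d e^{2\pi i m\omega/d}|\omega\rangle$, $m=1,\dots,d$, be the Fourier-transformed basis. For $K\ge 1$ let $\theta_k(\omega)$ ($1\le k\le K$, $1\le\omega\le d$) be i.i.d. real random variables with $\mathbb{E}[e^{i\theta_k(\omega)}]=0$, and put $U_k=\sum_\omega e^{i\theta_k(\omega)}|\omega\rangle\langle\omega|$ and $|\psi_{mk}\rangle=U_k|m\rangle$. Let $$\rho_{AE}=\frac1d\sum_{m=1}^d|m\rangle\langle m|_A\otimes\frac1K\sum_{k=1}^K|\psi_{mk}\rangle\langle\psi_{mk}|_E ,$$ where in the first factor $\{|m\rangle_A\}_{m=1}^d$ denotes a fixed orthonormal basis of Alice's $d$-dimensional system, and let Eve's accessible information $I_{\mathrm{acc}}$ be the supremum, over all local measurements (POVMs with finitely many outcomes) on $A$ and on $E$ with outcomes $X$ and $Y$, of the mutual information $H(X)+H(Y)-H(X,Y)$, with Shannon entropies $H$ in bits. Then: (i) For each $d$, the unitaries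 of the form $\sum_\omega e^{i t(\omega)}|\omega\rangle\langle\omega|$, $t(\omega)\in\mathbb{R}$, form an abelian group. (ii) Bob, who knows the key $k$ and the unitaries, decodes perfectly: for every realization of the unitaries and every $k$ there is a POVM $\{\Lambda_m\}_{m=1}^d$ with $\frac1d\sum_{m=1}^d \mathrm{Tr}(\Lambda_m|\psi_{mk}\rangle\langle\psi_{mk}|)=1$. (iii) $I_{\mathrm{acc}}=O(\delta\log d)$ except with probability exponentially small in $d$: there is a universal constant $C>0$ such that for every $\delta>0$ there are constants $A,c>0$, depending only on $\delta$, such that for all $d\ge1$, all $K\ge1$ with $$K>\frac{4}{\delta^2}\left(\ln d+\frac{2}{\delta}\ln\frac{5}{\delta}\right),$$ and all $\theta_k(\omega)$ as above, $$\Pr\left\{I_{\mathrm{acc}}>C\,\delta\log_2 d\right\}\le A\,e^{-c\,d}.$$ -/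

import Mathlib

open MeasureTheory ProbabilityTheory
open scoped ComplexOrder Kronecker Matrix

namespace DataLocking

noncomputable section

/-- A positive operator-valued measurement with outcomes in `ι`, on the finite-dimensional Hilbert
space with orthonormal basis indexed by `n`. -/
structure POVM (n ι : Type*) [Fintype n] [DecidableEq n] [Fintype ι] where
  /-- The measurement operators. -/
  effect : ι → Matrix n n ℂ
  posSemidef : ∀ i, (effect i).PosSemidef
  sum_effect : ∑ i, effect i = 1

/-- The rank-one operator `|v⟩⟨v|`. -/
def ketbra {n : Type*} (v : n → ℂ) : Matrix n n ℂ := Matrix.vecMulVec v (star v)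

/-- Shannon entropy, in bits. -/
def shannonEntropy {X : Type*} [Fintype X] (p : X → ℝ) : ℝ :=
  ∑ x, -(p x * Real.logb 2 (p x))

/-- Mutual information `H(X) + H(Y) - H(X,Y)`, in bits, of a joint distribution. -/
def mutualInfo {X Y : Type*} [Fintype X] [Fintype Y] (p : X × Y → ℝ) : ℝ :=
  shannonEntropy (fun x => ∑ y, p (x, y)) + shannonEntropy (fun y => ∑ x, p (x, y))
    - shannonEntropy p

/-- Joint distribution of the outcomes of the local measurements `M` and `N` on the bipartite
state `ρ` (Born rule). -/
def jointProb {a b X Y : Type*} [Fintype a] [DecidableEq a] [Fintype b] [DecidableEq b]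
    [Fintype X] [Fintype Y] (ρ : Matrix (a × b) (a × b) ℂ) (M : POVM a X) (N : POVM b Y) :
    X × Y → ℝ :=
  fun z => (Matrix.trace (ρ * (M.effect z.1 ⊗ₖ N.effect z.2))).re

/-- Accessible information of a bipartite state: the supremum, over all pairs of local
measurements, of the mutual information of the outcomes. The supremum is taken in the extended
reals, so that no boundedness is presupposed. -/
def accessibleInfo {a b : Type*} [Fintype a] [DecidableEq a] [Fintype b] [DecidableEq b]
    (ρ : Matrix (a × b) (a × b) ℂ) : EReal :=
  ⨆ (r : ℕ) (s : ℕ) (M : POVM a (Fin r)) (N : POVM b (Fin s)),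
    ((mutualInfo (jointProb ρ M N) : ℝ) : EReal)

/-- The diagonal unitary `∑_ω e^{i t(ω)} |ω⟩⟨ω|`. -/
def phaseUnitary {d : ℕ} (t : Fin d → ℝ) : Matrix (Fin d) (Fin d) ℂ :=
  Matrix.diagonal fun w => Complex.exp (Complex.I * (t w : ℂ))

/-- The Fourier-transformed basis vector
`|m⟩ = d^{-1/2} ∑_ω e^{2π i m ω / d} |ω⟩`. The labels `m, ω = 1, …, d` are represented by
`Fin d`, shifted by one. -/
def fourierVec (d : ℕ) (m : Fin d) : Fin d → ℂ := fun w =>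
  Complex.exp (2 * Real.pi * Complex.I * (((m : ℕ) : ℂ) + 1) * (((w : ℕ) : ℂ) + 1) / (d : ℂ))
    / (Real.sqrt d : ℂ)

/-- The codeword `U |m⟩`, for `U` the diagonal unitary with phases `t`. -/
def codeword {d : ℕ} (t : Fin d → ℝ) (m : Fin d) : Fin d → ℂ :=
  phaseUnitary t *ᵥ fourierVec d m

/-- The average success probability `(1/d) ∑_m Tr(Λ_m |ψ_m⟩⟨ψ_m|)` of the decoding measurement `Λ`
applied to the codewords `ψ_m = U |m⟩`, for `U` the diagonal unitary with phases `t`. -/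
def successProb {d : ℕ} (t : Fin d → ℝ) (Λ : POVM (Fin d) (Fin d)) : ℝ :=
  (1 / (d : ℝ)) * ∑ m, (Matrix.trace (Λ.effect m * ketbra (codeword t m))).re

/-- The classical-quantum state
`(1/d) ∑_m |m⟩⟨m|_A ⊗ (1/K) ∑_k |ψ_{mk}⟩⟨ψ_{mk}|_E` shared by Alice, who holds the message, and
Eve, who holds the codeword but not the key; here `ψ_{mk} = U_k |m⟩` and `U_k` has phases `θ k`. -/
def rhoAE {d K : ℕ} (θ : Fin K → Fin d → ℝ) : Matrix (Fin d × Fin d) (Fin d × Fin d) ℂ :=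
  (1 / (d : ℂ)) • ∑ m : Fin d,
    ketbra (Pi.single m (1 : ℂ)) ⊗ₖ ((1 / (K : ℂ)) • ∑ k : Fin K, ketbra (codeword (θ k) m))

end

end DataLocking

/-! Parts (i) and (ii) are immediate: phases add, and for a fixed key the codewords form an
orthonormal basis, in which Bob measures. The work is in (iii).

Write each effect of Eve as `Zᴴ * Z`. A row `φ` of `Z` sees the message `m` under the key `k`
through `amp`, the Fourier transform of `φ` multiplied by random phases. Data processing on Alice's
side (`mutualInfo_mixture_le`) reduces the information to the relative entropy, with respect to the
uniform law, of the weights that an outcome puts on the messages. By `sum_mul_log_le` this is small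
when no set `T` of at most `δ³d/24` messages carries more than a fraction `O(δ)` of the weight:
heavy messages cost `log d`, the others `log (24/δ³) ≤ δ log d` for large `d`. So `captured F θ T φ
≤ O(δ) K ‖φ‖²` is wanted for all `T` and `φ` at once, possibly after discarding a few positions `w`.

The set `T` is eliminated by thresholding the amplitudes at `r² = 24/(δ²d)`: what lies below `r`
contributes `O(|T| r² K) = O(δK)`, and only the energy above it, `excess`, has to be bounded.

For the indicator vector of a set `S` the amplitudes are sub-Gaussian. A fourth moment bounds the
mean excess, and concentration in the Hamming distance gives failure probability `exp(-2δ²|S|K) ≤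
d^(-8|S|)` (`excess_ind_tail`), which beats the number of sets `S`. This is where the size of the
key enters.

A general vector is reduced to code vectors, whose nonzero coordinates are powers of `1/2`, built up
layer by layer from large coordinates to small ones. Adding a layer raises the excess by a peak
term, controlled by the flat estimate, and by a cross term. Summation by parts
(`excess_codeVec_le_sum`) turns the cross terms into pairings of an increment, which depends only on
the phases at positions already used, with the rest of the vector, which lives on fresh positions.
Given the increment, the fresh phases are independent, and Cauchy–Schwarz with the truncated weights
`dualWeight` yields one event that serves every remaining vector simultaneously
(`norm_pairing_sq_le`, `dualForm_tail`). The union bound therefore runs only over the used positions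
and their levels: `n` positions give at most `(dJ)^n` codes, against a probability `d^(-7n)`.

This union bound gives failure probability `O(1/d)` only. It is amplified through `defect`, the
least number of positions whose removal makes the estimate true: its mean is at most `δd`, and it
moves by at most one when the phases at one position change, so it exceeds `2δd` with probability at
most `exp(-2δ²d)` (`defect_tail`). Discarding a set `B` of positions adds only `2 (|B|/d) log d` to
the information bound, because each column of Eve's operators has total squared norm one. -/

namespace DataLocking

/-! ### Bounded-difference concentration on product spaces. -/

/-- Bounded measurable functions whose increments are dominated by `D` are sub-Gaussian around
their mean, with variance proxy `v`. -/
def Concentrates {X : Type*} [MeasurableSpace X] (ν : Measure X) (D : X → X → ℝ) (v : ℝ) : Prop :=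
  ∀ g : X → ℝ, Measurable g → (∃ C, ∀ x, |g x| ≤ C) → (∀ x y, |g x - g y| ≤ D x y) →
    ∀ s : ℝ, ∫ x, Real.exp (s * (g x - ∫ y, g y ∂ν)) ∂ν ≤ Real.exp (s ^ 2 * v / 2)

section Concentration

variable {X Y : Type*} [MeasurableSpace X] [MeasurableSpace Y]

lemma integrable_of_abs_le {ν : Measure X} [IsFiniteMeasure ν] {g : X → ℝ} (hg : Measurable g)
    {C : ℝ} (hC : ∀ x, |g x| ≤ C) : Integrable g ν :=
  Integrable.of_bound hg.aestronglyMeasurable C (Filter.Eventually.of_forall hC)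

lemma abs_integral_le_of_abs_le {ν : Measure X} [IsProbabilityMeasure ν] {g : X → ℝ}
    {C : ℝ} (hC : ∀ x, |g x| ≤ C) : |∫ x, g x ∂ν| ≤ C := by
  have := norm_integral_le_of_norm_le_const (μ := ν) (f := g) (C := C)
    (Filter.Eventually.of_forall hC)
  simpa using this

lemma Concentrates.zero (ν : Measure X) [IsProbabilityMeasure ν] :
    Concentrates ν (fun _ _ => 0) 0 := by
  intro g hg hb hD s
  have h0 : ∀ x y, g x = g y := fun x y => by
    have := hD x y
    have := abs_nonpos_iff.mp this
    linarith
  obtain ⟨x0⟩ : Nonempty X := ν.nonempty_of_neZero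
  have h1 : ∀ x, g x = g x0 := fun x => h0 x x0
  simp [h1]

/-- Hoeffding's lemma. -/
lemma Concentrates.of_le_one {ν : Measure X} [IsProbabilityMeasure ν] {D : X → X → ℝ}
    (hD : ∀ x y, D x y ≤ 1) : Concentrates ν D (1 / 4) := by
  intro g hg hb hg' s
  obtain ⟨C, hC⟩ := hb
  obtain ⟨x0⟩ : Nonempty X := ν.nonempty_of_neZero
  have hbdd : BddBelow (Set.range g) := ⟨-C, by rintro _ ⟨x, rfl⟩; exact (abs_le.mp (hC x)).1⟩
  have h1 : ∀ x, g x ∈ Set.Icc (⨅ y, g y) ((⨅ y, g y) + 1) := by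
    intro x
    have : Nonempty X := ⟨x⟩
    refine ⟨ciInf_le hbdd x, ?_⟩
    have : g x - 1 ≤ ⨅ y, g y :=
      le_ciInf fun y => by have := (abs_le.mp ((hg' x y).trans (hD x y))).2; linarith
    linarith
  have h2 := (hasSubgaussianMGF_of_mem_Icc (μ := ν) hg.aemeasurable
    (Filter.Eventually.of_forall h1)).mgf_le s
  unfold mgf at h2
  refine h2.trans (le_of_eq ?_)
  congr 1
  simp
  ring

/-- Average out the second coordinate. The average inherits the increments `D₁`, since `D₂` vanishes
on the diagonal; the fluctuation of `f (x, ·)` around it is controlled by `h₂` uniformly in `x`, and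
that of the average by `h₁`. -/
lemma Concentrates.prod {μ : Measure X} {ν : Measure Y} [IsProbabilityMeasure μ]
    [IsProbabilityMeasure ν] {D₁ : X → X → ℝ} {D₂ : Y → Y → ℝ} {v₁ v₂ : ℝ}
    (h₁ : Concentrates μ D₁ v₁) (h₂ : Concentrates ν D₂ v₂)
    (hD₁ : ∀ x, D₁ x x = 0) (hD₂ : ∀ y, D₂ y y = 0) :
    Concentrates (μ.prod ν) (fun p q => D₁ p.1 q.1 + D₂ p.2 q.2) (v₁ + v₂) := by
  intro f hf hb hD s
  obtain ⟨C, hC⟩ := hb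
  set g : X → ℝ := fun x => ∫ y, f (x, y) ∂ν with hgdef
  have hgm : Measurable g := by
    have : StronglyMeasurable fun x => ∫ y, f (x, y) ∂ν :=
      StronglyMeasurable.integral_prod_right' hf.stronglyMeasurable
    exact this.measurable
  have hgC : ∀ x, |g x| ≤ C := fun x => abs_integral_le_of_abs_le fun y => hC (x, y)
  have hfi : ∀ x, Integrable (fun y => f (x, y)) ν := fun x =>
    integrable_of_abs_le (hf.comp measurable_prodMk_left) fun y => hC (x, y)
  have hgD : ∀ x x', |g x - g x'| ≤ D₁ x x' := by
    intro x x'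
    rw [hgdef]
    simp only
    rw [← integral_sub (hfi x) (hfi x')]
    refine abs_integral_le_of_abs_le fun y => ?_
    have := hD (x, y) (x', y)
    simpa [hD₂] using this
  have hEf : ∫ p, f p ∂(μ.prod ν) = ∫ x, g x ∂μ :=
    integral_prod _ (integrable_of_abs_le hf hC)
  set m := ∫ x, g x ∂μ with hm
  have hmC : |m| ≤ C := abs_integral_le_of_abs_le hgC
  rw [hEf]
  have hexpm : Measurable fun p : X × Y => Real.exp (s * (f p - m)) := by fun_prop
  have hexpb : ∀ p, |Real.exp (s * (f p - m))| ≤ Real.exp (|s| * (2 * C)) := by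
    intro p
    rw [abs_of_pos (Real.exp_pos _)]
    apply Real.exp_le_exp.mpr
    calc s * (f p - m) ≤ |s * (f p - m)| := le_abs_self _
      _ = |s| * |f p - m| := abs_mul _ _
      _ ≤ |s| * (2 * C) := by
        gcongr
        have := abs_sub (f p) m
        linarith [hC p]
  rw [integral_prod _ (integrable_of_abs_le hexpm hexpb)]
  have hin : ∀ x, ∫ y, Real.exp (s * (f (x, y) - m)) ∂ν
      ≤ Real.exp (s ^ 2 * v₂ / 2) * Real.exp (s * (g x - m)) := by
    intro x
    have h := h₂ (fun y => f (x, y)) (hf.comp measurable_prodMk_left)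
      ⟨C, fun y => hC (x, y)⟩ (fun y y' => by
        have := hD (x, y) (x, y')
        simpa [hD₁] using this) s
    have : ∀ y, Real.exp (s * (f (x, y) - m))
        = Real.exp (s * (f (x, y) - g x)) * Real.exp (s * (g x - m)) := by
      intro y
      rw [← Real.exp_add]
      congr 1
      ring
    simp_rw [this]
    rw [integral_mul_const]
    gcongr
  calc ∫ x, ∫ y, Real.exp (s * (f (x, y) - m)) ∂ν ∂μ
      ≤ ∫ x, Real.exp (s ^ 2 * v₂ / 2) * Real.exp (s * (g x - m)) ∂μ := by
        refine integral_mono (integrable_of_abs_le hexpm hexpb).integral_prod_left ?_ hin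
        refine Integrable.const_mul ?_ _
        refine integrable_of_abs_le (C := Real.exp (|s| * (2 * C))) (by fun_prop) fun x => ?_
        rw [abs_of_pos (Real.exp_pos _)]
        apply Real.exp_le_exp.mpr
        calc s * (g x - m) ≤ |s * (g x - m)| := le_abs_self _
          _ = |s| * |g x - m| := abs_mul _ _
          _ ≤ |s| * (2 * C) := by
            gcongr
            have := abs_sub (g x) m
            linarith [hgC x]
    _ = Real.exp (s ^ 2 * v₂ / 2) * ∫ x, Real.exp (s * (g x - m)) ∂μ := integral_const_mul _ _
    _ ≤ Real.exp (s ^ 2 * v₂ / 2) * Real.exp (s ^ 2 * v₁ / 2) := by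
        gcongr
        exact h₁ g hgm ⟨C, hgC⟩ hgD s
    _ = Real.exp (s ^ 2 * (v₁ + v₂) / 2) := by
        rw [← Real.exp_add]
        congr 1
        ring

lemma Concentrates.of_measurePreserving {μ : Measure X} {ν : Measure Y} (e : X ≃ᵐ Y)
    (he : MeasurePreserving e μ ν) {D : Y → Y → ℝ} {v : ℝ} (h : Concentrates ν D v) :
    Concentrates μ (fun x y => D (e x) (e y)) v := by
  intro f hf hb hD s
  obtain ⟨C, hC⟩ := hb
  have key := h (f ∘ e.symm) (hf.comp e.symm.measurable) ⟨C, fun x => hC _⟩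
    (fun x y => by simpa using hD (e.symm x) (e.symm y)) s
  rw [← he.integral_comp', ← he.integral_comp'] at key
  simpa using key

lemma Concentrates.pi {n : ℕ} {X : Fin n → Type*} [∀ i, MeasurableSpace (X i)]
    {ν : ∀ i, Measure (X i)} [∀ i, IsProbabilityMeasure (ν i)] {D : ∀ i, X i → X i → ℝ}
    {v : Fin n → ℝ} (h : ∀ i, Concentrates (ν i) (D i) (v i)) (hD : ∀ i x, D i x x = 0) :
    Concentrates (Measure.pi ν) (fun x y => ∑ i, D i (x i) (y i)) (∑ i, v i) := by
  induction n with
  | zero =>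
    simpa using Concentrates.zero (Measure.pi ν)
  | succ n ih =>
    have h1 := (h 0).prod (ih (X := fun i => X i.succ) (ν := fun i => ν i.succ)
      (D := fun i => D i.succ) (v := fun i => v i.succ) (fun i => h i.succ)
      (fun i => hD i.succ)) (hD 0) (fun y => by simp [hD])
    have h2 := Concentrates.of_measurePreserving _ (measurePreserving_piFinSuccAbove ν 0) h1
    simp only [Fin.sum_univ_succ]
    exact h2

/-- Upper tail bound for concentrating measures. -/
lemma Concentrates.tail {ν : Measure X} [IsProbabilityMeasure ν] {D : X → X → ℝ} {v : ℝ}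
    (h : Concentrates ν D v) (hv : 0 < v) {g : X → ℝ} (hg : Measurable g)
    (hb : ∃ C, ∀ x, |g x| ≤ C) (hD : ∀ x y, |g x - g y| ≤ D x y) {a t : ℝ} (ht : 0 ≤ t)
    (ha : ∫ x, g x ∂ν ≤ a) :
    ν.real {x | a + t ≤ g x} ≤ Real.exp (-(t ^ 2 / (2 * v))) := by
  obtain ⟨C, hC⟩ := hb
  set m := ∫ x, g x ∂ν with hm
  have h1 := h g hg ⟨C, hC⟩ hD (t / v)
  have hint : Integrable (fun x => Real.exp (t / v * (g x - m))) ν := by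
    refine integrable_of_abs_le (C := Real.exp (t / v * (C - m))) (by fun_prop) fun x => ?_
    rw [abs_of_pos (Real.exp_pos _)]
    apply Real.exp_le_exp.mpr
    have := (abs_le.mp (hC x)).2
    gcongr
  have h2 := mul_meas_ge_le_integral_of_nonneg (μ := ν)
    (Filter.Eventually.of_forall fun x => (Real.exp_pos (t / v * (g x - m))).le) hint
    (Real.exp (t / v * t))
  have h3 : ν.real {x | a + t ≤ g x} ≤ ν.real {x | Real.exp (t / v * t)
      ≤ Real.exp (t / v * (g x - m))} := by
    refine measureReal_mono fun x (hx : a + t ≤ g x) => ?_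
    apply Real.exp_le_exp.mpr
    have : 0 ≤ t / v := by positivity
    exact mul_le_mul_of_nonneg_left (by linarith) this
  have h4 : Real.exp (t / v * t) * ν.real {x | a + t ≤ g x}
      ≤ Real.exp ((t / v) ^ 2 * v / 2) :=
    (mul_le_mul_of_nonneg_left h3 (Real.exp_pos _).le).trans (h2.trans h1)
  calc ν.real {x | a + t ≤ g x}
      = Real.exp (-(t / v * t)) * (Real.exp (t / v * t) * ν.real {x | a + t ≤ g x}) := by
        rw [← mul_assoc, ← Real.exp_add]; simp
    _ ≤ Real.exp (-(t / v * t)) * Real.exp ((t / v) ^ 2 * v / 2) := by gcongr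
    _ = Real.exp (-(t ^ 2 / (2 * v))) := by
        rw [← Real.exp_add]
        congr 1
        field_simp
        ring

end Concentration


/-! ### Sub-Gaussian sums of random phases and their exponential and fourth moments. -/

/-- The phase `e^{ix}`. -/
noncomputable def phase (x : ℝ) : ℂ := Complex.exp (Complex.I * (x : ℂ))

@[simp] lemma norm_phase (x : ℝ) : ‖phase x‖ = 1 := by
  unfold phase
  rw [mul_comm]
  exact Complex.norm_exp_ofReal_mul_I x

@[fun_prop] lemma continuous_phase : Continuous phase := by unfold phase; fun_prop

@[fun_prop] lemma measurable_phase : Measurable phase := continuous_phase.measurable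

/-- A real random variable whose moment generating function is dominated by that of a centred
Gaussian of variance `w`. -/
def MgfLe {X : Type*} [MeasurableSpace X] (ν : Measure X) (u : X → ℝ) (w : ℝ) : Prop :=
  ∀ s : ℝ, ∫ x, Real.exp (s * u x) ∂ν ≤ Real.exp (s ^ 2 * w / 2)

section Subgaussian

variable {X : Type*} [MeasurableSpace X]

lemma MgfLe.re_phase_mul {ν : Measure ℝ} [IsProbabilityMeasure ν] (hν : ∫ x, phase x ∂ν = 0)
    (c : ℂ) : MgfLe ν (fun x => (phase x * c).re) (‖c‖ ^ 2) := by
  have hi : Integrable phase ν :=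
    Integrable.of_bound continuous_phase.aestronglyMeasurable 1
      (Filter.Eventually.of_forall fun x => (norm_phase x).le)
  have h0 : ∫ x, (phase x * c).re ∂ν = 0 := by
    have h := Complex.reCLM.integral_comp_comm (hi.mul_const c)
    rw [integral_mul_const, hν, zero_mul] at h
    simpa using h
  intro s
  have h := (hasSubgaussianMGF_of_mem_Icc_of_integral_eq_zero (μ := ν) (a := -‖c‖) (b := ‖c‖)
    (X := fun x => (phase x * c).re) (by fun_prop) (Filter.Eventually.of_forall fun x => by
      have := Complex.abs_re_le_norm (phase x * c)
      rw [norm_mul, norm_phase, one_mul] at this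
      exact abs_le.mp this) h0).mgf_le s
  unfold mgf at h
  refine h.trans (le_of_eq ?_)
  congr 1
  have : ‖‖c‖ - -‖c‖‖ = 2 * ‖c‖ := by
    rw [Real.norm_of_nonneg (by linarith [norm_nonneg c])]; ring
  simp only [NNReal.coe_pow, NNReal.coe_div, coe_nnnorm, this, NNReal.coe_ofNat]
  ring

lemma MgfLe.pi {ι : Type*} [Fintype ι] {X : ι → Type*} [∀ i, MeasurableSpace (X i)]
    {ν : ∀ i, Measure (X i)} [∀ i, IsProbabilityMeasure (ν i)] {u : ∀ i, X i → ℝ} {w : ι → ℝ}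
    (h : ∀ i, MgfLe (ν i) (u i) (w i)) :
    MgfLe (Measure.pi ν) (fun x => ∑ i, u i (x i)) (∑ i, w i) := by
  intro s
  simp_rw [Finset.mul_sum, Real.exp_sum]
  rw [integral_fintype_prod_eq_prod (f := fun i x => Real.exp (s * u i x))]
  rw [Finset.sum_div, Real.exp_sum]
  exact Finset.prod_le_prod (fun i _ => integral_nonneg fun x => (Real.exp_pos _).le)
    fun i _ => h i s

/-- The integral equals `(1 - 2a)^(-1/2)`, and `(1 - 2a)(1 + 4a) ≥ 1` exactly because `0 ≤ a ≤ 1/4`.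
-/
lemma lintegral_exp_sq_gaussianReal {a : ℝ} (ha0 : 0 ≤ a) (ha : a ≤ 1 / 4) :
    ∫⁻ g, ENNReal.ofReal (Real.exp (a * g ^ 2)) ∂(gaussianReal 0 1)
      ≤ ENNReal.ofReal (Real.exp (2 * a)) := by
  rw [gaussianReal_of_var_ne_zero _ one_ne_zero, lintegral_withDensity_eq_lintegral_mul _
    (measurable_gaussianPDF 0 1) (by fun_prop)]
  have h1 : ∀ g : ℝ, (gaussianPDF 0 1 * fun g => ENNReal.ofReal (Real.exp (a * g ^ 2))) g
      = ENNReal.ofReal ((√(2 * Real.pi))⁻¹ * Real.exp (-(1 / 2 - a) * g ^ 2)) := by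
    intro g
    simp only [Pi.mul_apply, gaussianPDF, gaussianPDFReal]
    rw [← ENNReal.ofReal_mul (by positivity), mul_assoc, ← Real.exp_add]
    simp only [NNReal.coe_one, mul_one, sub_zero]
    congr 3
    ring
  simp_rw [h1]
  have hb : 0 < 1 / 2 - a := by linarith
  rw [← ofReal_integral_eq_lintegral_ofReal
    ((integrable_exp_neg_mul_sq hb).const_mul _)
    (Filter.Eventually.of_forall fun g => by positivity), integral_const_mul, integral_gaussian]
  apply ENNReal.ofReal_le_ofReal
  rw [← Real.sqrt_inv, ← Real.sqrt_mul (by positivity)]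
  have h2 : (2 * Real.pi)⁻¹ * (Real.pi / (1 / 2 - a)) = (1 - 2 * a)⁻¹ := by
    have : 1 - 2 * a ≠ 0 := by linarith
    have : 1 / 2 - a ≠ 0 := hb.ne'
    field_simp
  rw [h2]
  apply Real.sqrt_le_iff.mpr
  refine ⟨(Real.exp_pos _).le, ?_⟩
  rw [← Real.exp_nat_mul]
  have h3 : 0 < 1 - 2 * a := by linarith
  rw [inv_le_comm₀ h3 (Real.exp_pos _), ← Real.exp_neg]
  have h5 : 1 + 4 * a ≤ Real.exp (((2 : ℕ) : ℝ) * (2 * a)) := by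
    have := Real.add_one_le_exp (((2 : ℕ) : ℝ) * (2 * a))
    push_cast at this ⊢
    linarith
  rw [Real.exp_neg]
  calc (Real.exp (((2 : ℕ) : ℝ) * (2 * a)))⁻¹ ≤ (1 + 4 * a)⁻¹ := by gcongr
    _ ≤ 1 - 2 * a := by
      rw [inv_le_iff_one_le_mul₀ (by linarith)]
      nlinarith

/-- Linearise the square by an auxiliary standard Gaussian `g`: `exp (c u²)` is the mean of `exp
(√(2c) u g)`. After exchanging the integrals, the moment generating function of `u` leaves `exp (c w
g²)`. -/
lemma MgfLe.lintegral_exp_sq {ν : Measure X} [IsProbabilityMeasure ν] {u : X → ℝ} {w c : ℝ}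
    (hu : Measurable u) {C : ℝ} (hC : ∀ x, |u x| ≤ C) (h : MgfLe ν u w)
    (hw : 0 ≤ w) (hc : 0 ≤ c) (hcw : c * w ≤ 1 / 4) :
    ∫⁻ x, ENNReal.ofReal (Real.exp (c * u x ^ 2)) ∂ν ≤ ENNReal.ofReal (Real.exp (2 * (c * w))) := by
  have h1 : ∀ x, ENNReal.ofReal (Real.exp (c * u x ^ 2))
      = ∫⁻ g, ENNReal.ofReal (Real.exp (√(2 * c) * u x * g)) ∂(gaussianReal 0 1) := by
    intro x
    have hm := mgf_gaussianReal (p := gaussianReal 0 1) (X := id) (Measure.map_id)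
      (√(2 * c) * u x)
    have hi : Integrable (fun g => Real.exp (√(2 * c) * u x * g)) (gaussianReal 0 1) :=
      integrable_exp_mul_gaussianReal _
    rw [← ofReal_integral_eq_lintegral_ofReal hi
      (Filter.Eventually.of_forall fun g => (Real.exp_pos _).le)]
    unfold mgf at hm
    simp only [id] at hm
    rw [hm, mul_pow, Real.sq_sqrt (by positivity)]
    congr 2
    simp
    ring
  simp_rw [h1]
  rw [lintegral_lintegral_swap (by fun_prop)]
  refine (lintegral_mono fun g => ?_).trans (lintegral_exp_sq_gaussianReal (a := c * w)
    (by positivity) hcw)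
  have hi : Integrable (fun x => Real.exp (√(2 * c) * u x * g)) ν := by
    refine integrable_of_abs_le (C := Real.exp (√(2 * c) * C * |g|)) (by fun_prop) fun x => ?_
    rw [abs_of_pos (Real.exp_pos _)]
    apply Real.exp_le_exp.mpr
    refine (le_abs_self _).trans ?_
    rw [abs_mul, abs_mul, abs_of_nonneg (Real.sqrt_nonneg _)]
    gcongr
    exact hC x
  rw [← ofReal_integral_eq_lintegral_ofReal hi
      (Filter.Eventually.of_forall fun g => (Real.exp_pos _).le)]
  apply ENNReal.ofReal_le_ofReal
  have h2 := h (√(2 * c) * g)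
  calc ∫ x, Real.exp (√(2 * c) * u x * g) ∂ν = ∫ x, Real.exp (√(2 * c) * g * u x) ∂ν := by
        congr 1; ext x; congr 1; ring
    _ ≤ _ := h2
    _ = Real.exp (c * w * g ^ 2) := by
        congr 1
        rw [mul_pow, Real.sq_sqrt (by positivity)]
        ring

lemma MgfLe.integral_exp_sq {ν : Measure X} [IsProbabilityMeasure ν] {u : X → ℝ} {w c : ℝ}
    (hu : Measurable u) {C : ℝ} (hC : ∀ x, |u x| ≤ C) (h : MgfLe ν u w)
    (hw : 0 ≤ w) (hc : 0 ≤ c) (hcw : c * w ≤ 1 / 4) :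
    ∫ x, Real.exp (c * u x ^ 2) ∂ν ≤ Real.exp (2 * (c * w)) := by
  rw [integral_eq_lintegral_of_nonneg_ae
    (Filter.Eventually.of_forall fun g => (Real.exp_pos _).le) (by fun_prop)]
  exact ENNReal.toReal_le_of_le_ofReal (Real.exp_pos _).le (h.lintegral_exp_sq hu hC hw hc hcw)

lemma integrable_exp_sq {ν : Measure X} [IsFiniteMeasure ν] {u : X → ℝ} {c : ℝ}
    (hu : Measurable u) {C : ℝ} (hC : ∀ x, |u x| ≤ C) (hc : 0 ≤ c) :
    Integrable (fun x => Real.exp (c * u x ^ 2)) ν := by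
  refine integrable_of_abs_le (C := Real.exp (c * C ^ 2)) (by fun_prop) fun x => ?_
  rw [abs_of_pos (Real.exp_pos _)]
  apply Real.exp_le_exp.mpr
  have : u x ^ 2 ≤ C ^ 2 := sq_le_sq' (abs_le.mp (hC x)).1 (abs_le.mp (hC x)).2
  gcongr

lemma integral_exp_normSq_le {ν : Measure X} [IsProbabilityMeasure ν] {L : X → ℂ} {w κ : ℝ}
    (hL : Measurable L) {C : ℝ} (hC : ∀ x, ‖L x‖ ≤ C) (hre : MgfLe ν (fun x => (L x).re) w)
    (him : MgfLe ν (fun x => (L x).im) w) (hw : 0 ≤ w) (hκ : 0 ≤ κ) (hκw : κ * w ≤ 1) :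
    ∫ x, Real.exp (κ / 8 * ‖L x‖ ^ 2) ∂ν ≤ Real.exp (κ * w / 2) := by
  have hCre : ∀ x, |(L x).re| ≤ C := fun x => (Complex.abs_re_le_norm _).trans (hC x)
  have hCim : ∀ x, |(L x).im| ≤ C := fun x => (Complex.abs_im_le_norm _).trans (hC x)
  have hmre : Measurable fun x => (L x).re := by fun_prop
  have hmim : Measurable fun x => (L x).im := by fun_prop
  have h1 := hre.integral_exp_sq (c := κ / 4) hmre hCre hw (by positivity) (by linarith)
  have h2 := him.integral_exp_sq (c := κ / 4) hmim hCim hw (by positivity) (by linarith)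
  have i1 : Integrable (fun x => Real.exp (κ / 4 * (L x).re ^ 2)) ν :=
    integrable_exp_sq hmre hCre (by positivity)
  have i2 : Integrable (fun x => Real.exp (κ / 4 * (L x).im ^ 2)) ν :=
    integrable_exp_sq hmim hCim (by positivity)
  -- The real and imaginary parts are dependent; `exp (a + b) ≤ (exp (2a) + exp (2b)) / 2` separates
  -- them at the price of doubling the exponent.
  have hpt : ∀ x, Real.exp (κ / 8 * ‖L x‖ ^ 2)
      ≤ (Real.exp (κ / 4 * (L x).re ^ 2) + Real.exp (κ / 4 * (L x).im ^ 2)) / 2 := by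
    intro x
    rw [Complex.sq_norm, Complex.normSq_apply]
    set a := κ / 8 * (L x).re ^ 2
    set b := κ / 8 * (L x).im ^ 2
    have e1 : κ / 4 * (L x).re ^ 2 = a + a := by ring
    have e2 : κ / 4 * (L x).im ^ 2 = b + b := by ring
    have e3 : κ / 8 * ((L x).re * (L x).re + (L x).im * (L x).im) = a + b := by ring
    rw [e1, e2, e3, Real.exp_add, Real.exp_add, Real.exp_add]
    nlinarith [sq_nonneg (Real.exp a - Real.exp b)]
  calc ∫ x, Real.exp (κ / 8 * ‖L x‖ ^ 2) ∂ν
      ≤ ∫ x, (Real.exp (κ / 4 * (L x).re ^ 2) + Real.exp (κ / 4 * (L x).im ^ 2)) / 2 ∂ν := by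
        refine integral_mono ?_ ((i1.add i2).div_const 2) hpt
        exact integrable_exp_sq (u := fun x => ‖L x‖) hL.norm (C := C)
          (fun x => by simpa using hC x) (by positivity)
    _ = ((∫ x, Real.exp (κ / 4 * (L x).re ^ 2) ∂ν)
          + ∫ x, Real.exp (κ / 4 * (L x).im ^ 2) ∂ν) / 2 := by
        rw [integral_div, integral_add i1 i2]
    _ ≤ Real.exp (κ * w / 2) := by
        have : 2 * (κ / 4 * w) = κ * w / 2 := by ring
        rw [this] at h1 h2
        linarith

lemma pow_four_le_exp (x : ℝ) : x ^ 4 / 24 ≤ Real.exp x + Real.exp (-x) := by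
  have key : ∀ y : ℝ, 0 ≤ y → y ^ 4 / 24 ≤ Real.exp y := by
    intro y hy
    have := Real.pow_div_factorial_le_exp y hy 4
    simpa [Nat.factorial] using this
  rcases le_total 0 x with h | h
  · linarith [key x h, Real.exp_pos (-x)]
  · have := key (-x) (by linarith)
    rw [Even.neg_pow (by decide)] at this
    linarith [Real.exp_pos x]

lemma MgfLe.integral_pow_four {ν : Measure X} [IsProbabilityMeasure ν] {u : X → ℝ} {w : ℝ}
    (hu : Measurable u) {C : ℝ} (hC : ∀ x, |u x| ≤ C) (h : MgfLe ν u w) (hw : 0 < w) :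
    ∫ x, u x ^ 4 ∂ν ≤ 24 * w ^ 2 := by
  -- This makes both exponential moments at most `exp 2`, and `2 exp 2 < 16 = s⁴ w²`.
  set s := 2 / √w with hs
  have hsw : s ^ 2 * w = 4 := by
    rw [hs, div_pow, Real.sq_sqrt hw.le]
    field_simp
    norm_num
  have h1 := h s
  have h2 := h (-s)
  have he : ∀ t : ℝ, Integrable (fun x => Real.exp (t * u x)) ν := by
    intro t
    refine integrable_of_abs_le (C := Real.exp (|t| * C)) (by fun_prop) fun x => ?_
    rw [abs_of_pos (Real.exp_pos _)]
    apply Real.exp_le_exp.mpr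
    refine (le_abs_self _).trans ?_
    rw [abs_mul]
    gcongr
    exact hC x
  have hi4 : Integrable (fun x => u x ^ 4) ν := by
    refine integrable_of_abs_le (C := C ^ 4) (by fun_prop) fun x => ?_
    rw [abs_pow]
    exact pow_le_pow_left₀ (abs_nonneg _) (hC x) 4
  have h3 : ∫ x, (s ^ 4 / 24) * u x ^ 4 ∂ν
      ≤ ∫ x, (Real.exp (s * u x) + Real.exp (-s * u x)) ∂ν := by
    refine integral_mono (hi4.const_mul _) ((he s).add (he (-s))) fun x => ?_
    have := pow_four_le_exp (s * u x)
    calc s ^ 4 / 24 * u x ^ 4 = (s * u x) ^ 4 / 24 := by ring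
      _ ≤ _ := by simpa using this
  rw [integral_const_mul, integral_add (he s) (he (-s))] at h3
  have e2 : Real.exp 2 < 7.5 := by
    have := Real.exp_one_lt_d9
    have h : Real.exp 2 = Real.exp 1 ^ 2 := by rw [← Real.exp_nat_mul]; norm_num
    rw [h]
    nlinarith [Real.exp_pos 1]
  have e3 : s ^ 2 * w / 2 = 2 := by linarith
  have e4 : (-s) ^ 2 * w / 2 = 2 := by rw [neg_sq]; linarith
  rw [e3] at h1
  rw [e4] at h2
  have h4 : s ^ 4 / 24 * ∫ x, u x ^ 4 ∂ν ≤ 16 := by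
    have : ∫ x, Real.exp (-s * u x) ∂ν ≤ Real.exp 2 := h2
    linarith
  have h5 : s ^ 4 * w ^ 2 = 16 := by
    have : s ^ 4 * w ^ 2 = (s ^ 2 * w) ^ 2 := by ring
    rw [this, hsw]; norm_num
  have h6 : 0 ≤ ∫ x, u x ^ 4 ∂ν := integral_nonneg fun x => by positivity
  nlinarith [mul_le_mul_of_nonneg_right h4 (sq_nonneg w)]

lemma integral_norm_pow_four_le {ν : Measure X} [IsProbabilityMeasure ν] {L : X → ℂ} {w : ℝ}
    (hL : Measurable L) {C : ℝ} (hC : ∀ x, ‖L x‖ ≤ C) (hre : MgfLe ν (fun x => (L x).re) w)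
    (him : MgfLe ν (fun x => (L x).im) w) (hw : 0 < w) :
    ∫ x, ‖L x‖ ^ 4 ∂ν ≤ 96 * w ^ 2 := by
  have hCre : ∀ x, |(L x).re| ≤ C := fun x => (Complex.abs_re_le_norm _).trans (hC x)
  have hCim : ∀ x, |(L x).im| ≤ C := fun x => (Complex.abs_im_le_norm _).trans (hC x)
  have hmre : Measurable fun x => (L x).re := by fun_prop
  have hmim : Measurable fun x => (L x).im := by fun_prop
  have h1 := hre.integral_pow_four hmre hCre hw
  have h2 := him.integral_pow_four hmim hCim hw
  have i1 : Integrable (fun x => (L x).re ^ 4) ν :=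
    integrable_of_abs_le (C := C ^ 4) (by fun_prop) fun x => by
      rw [abs_pow]; exact pow_le_pow_left₀ (abs_nonneg _) (hCre x) 4
  have i2 : Integrable (fun x => (L x).im ^ 4) ν :=
    integrable_of_abs_le (C := C ^ 4) (by fun_prop) fun x => by
      rw [abs_pow]; exact pow_le_pow_left₀ (abs_nonneg _) (hCim x) 4
  calc ∫ x, ‖L x‖ ^ 4 ∂ν ≤ ∫ x, (2 * (L x).re ^ 4 + 2 * (L x).im ^ 4) ∂ν := by
        refine integral_mono ?_ ((i1.const_mul 2).add (i2.const_mul 2)) fun x => ?_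
        · exact integrable_of_abs_le (C := C ^ 4) (by fun_prop) fun x => by
            rw [abs_of_nonneg (by positivity)]
            exact pow_le_pow_left₀ (norm_nonneg _) (hC x) 4
        · have : ‖L x‖ ^ 4 = (‖L x‖ ^ 2) ^ 2 := by ring
          simp only
          rw [this, Complex.sq_norm, Complex.normSq_apply]
          nlinarith [sq_nonneg ((L x).re ^ 2 - (L x).im ^ 2)]
    _ = 2 * (∫ x, (L x).re ^ 4 ∂ν) + 2 * ∫ x, (L x).im ^ 4 ∂ν := by
        rw [integral_add (i1.const_mul 2) (i2.const_mul 2), integral_const_mul,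
          integral_const_mul]
    _ ≤ 96 * w ^ 2 := by linarith

end Subgaussian


/-! ### Soft thresholding in the complex plane. -/

section SoftThreshold

/-- Soft thresholding of a complex number at level `r`: the displacement from `u` to the disc of
radius `r`. -/
noncomputable def soft (r : ℝ) (u : ℂ) : ℂ := ((max (‖u‖ - r) 0 / ‖u‖ : ℝ) : ℂ) * u

lemma soft_of_le {r : ℝ} {u : ℂ} (h : ‖u‖ ≤ r) : soft r u = 0 := by
  simp [soft, max_eq_right (sub_nonpos.mpr h)]

lemma norm_soft {r : ℝ} (hr : 0 ≤ r) (u : ℂ) : ‖soft r u‖ = max (‖u‖ - r) 0 := by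
  unfold soft
  rw [norm_mul, Complex.norm_real, Real.norm_of_nonneg (by positivity)]
  rcases eq_or_ne u 0 with rfl | hu
  · simp [hr]
  · have : ‖u‖ ≠ 0 := norm_ne_zero_iff.mpr hu
    field_simp

lemma norm_sub_soft_le {r : ℝ} (hr : 0 ≤ r) (u : ℂ) : ‖u - soft r u‖ ≤ r := by
  rcases le_or_gt ‖u‖ r with h | h
  · simpa [soft_of_le h] using h
  · have hu : 0 < ‖u‖ := hr.trans_lt h
    have : u - soft r u = ((r / ‖u‖ : ℝ) : ℂ) * u := by
      unfold soft
      rw [max_eq_left (by linarith)]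
      have : (‖u‖ : ℂ) ≠ 0 := by exact_mod_cast hu.ne'
      push_cast
      field_simp
      ring
    rw [this, norm_mul, Complex.norm_real, Real.norm_of_nonneg (by positivity),
      div_mul_cancel₀ _ hu.ne']

/-- The left side is the distance from `u + a` to the disc of radius `r`, and `u - soft r u` is a
point of that disc. This allows an increment to be pulled out of the threshold with no loss in the
cross term. -/
lemma norm_soft_add_le {r : ℝ} (hr : 0 ≤ r) (u a : ℂ) : ‖soft r (u + a)‖ ≤ ‖soft r u + a‖ := by
  rw [norm_soft hr]
  apply max_le _ (norm_nonneg _)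
  have h1 := norm_sub_soft_le hr u
  have h2 : u + a = (soft r u + a) + (u - soft r u) := by ring
  have h3 := norm_add_le (soft r u + a) (u - soft r u)
  rw [← h2] at h3
  linarith

lemma norm_sq_sub_unit (a b : ℝ) (p q : ℂ) (hp : ‖p‖ = 1) (hq : ‖q‖ = 1) :
    ‖(a : ℂ) * p - b * q‖ ^ 2 = (a - b) ^ 2 + a * b * ‖p - q‖ ^ 2 := by
  have hp' : p.re * p.re + p.im * p.im = 1 := by
    rw [← Complex.normSq_apply, ← Complex.sq_norm, hp]; norm_num
  have hq' : q.re * q.re + q.im * q.im = 1 := by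
    rw [← Complex.normSq_apply, ← Complex.sq_norm, hq]; norm_num
  simp only [Complex.sq_norm, Complex.normSq_apply, Complex.sub_re, Complex.mul_re,
    Complex.ofReal_re, Complex.ofReal_im, zero_mul, sub_zero, Complex.sub_im, Complex.mul_im,
    add_zero]
  linear_combination (a ^ 2 - a * b) * hp' + (b ^ 2 - a * b) * hq'

/-- In polar form (`norm_sq_sub_unit`), when both points lie outside the disc, thresholding keeps
the radial difference and shrinks the factor of the angular term from `‖u‖ ‖v‖` to `(‖u‖ - r) (‖v‖ -
r)`. -/
lemma norm_soft_sub_soft_le {r : ℝ} (hr : 0 ≤ r) (u v : ℂ) :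
    ‖soft r u - soft r v‖ ≤ ‖u - v‖ := by
  have one : ∀ u v : ℂ, ‖v‖ ≤ r → ‖soft r u - soft r v‖ ≤ ‖u - v‖ := by
    intro u v h
    rw [soft_of_le h, sub_zero, norm_soft hr]
    apply max_le _ (norm_nonneg _)
    have := norm_sub_norm_le u v
    linarith
  rcases le_or_gt ‖v‖ r with hv | hv
  · exact one u v hv
  rcases le_or_gt ‖u‖ r with hu | hu
  · rw [norm_sub_rev, norm_sub_rev u]; exact one v u hu
  have hu0 : 0 < ‖u‖ := hr.trans_lt hu
  have hv0 : 0 < ‖v‖ := hr.trans_lt hv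
  set p : ℂ := ((‖u‖⁻¹ : ℝ) : ℂ) * u with hp
  set q : ℂ := ((‖v‖⁻¹ : ℝ) : ℂ) * v with hq
  have hp1 : ‖p‖ = 1 := by
    rw [hp, norm_mul, Complex.norm_real, Real.norm_of_nonneg (by positivity)]
    field_simp
  have hq1 : ‖q‖ = 1 := by
    rw [hq, norm_mul, Complex.norm_real, Real.norm_of_nonneg (by positivity)]
    field_simp
  have hu0' : (‖u‖ : ℂ) ≠ 0 := by exact_mod_cast hu0.ne'
  have hv0' : (‖v‖ : ℂ) ≠ 0 := by exact_mod_cast hv0.ne'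
  have eu : u = ((‖u‖ : ℝ) : ℂ) * p := by rw [hp]; push_cast; field_simp
  have ev : v = ((‖v‖ : ℝ) : ℂ) * q := by rw [hq]; push_cast; field_simp
  have su : soft r u = ((‖u‖ - r : ℝ) : ℂ) * p := by
    unfold soft; rw [max_eq_left (by linarith), hp]; push_cast; field_simp
  have sv : soft r v = ((‖v‖ - r : ℝ) : ℂ) * q := by
    unfold soft; rw [max_eq_left (by linarith), hq]; push_cast; field_simp
  rw [su, sv]
  refine (sq_le_sq₀ (norm_nonneg _) (norm_nonneg _)).mp ?_
  have e1 : ‖u - v‖ ^ 2 = (‖u‖ - ‖v‖) ^ 2 + ‖u‖ * ‖v‖ * ‖p - q‖ ^ 2 := by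
    rw [← norm_sq_sub_unit ‖u‖ ‖v‖ p q hp1 hq1, ← eu, ← ev]
  rw [norm_sq_sub_unit _ _ p q hp1 hq1, e1]
  have : (‖u‖ - r) * (‖v‖ - r) ≤ ‖u‖ * ‖v‖ :=
    mul_le_mul (by linarith) (by linarith) (by linarith) hu0.le
  nlinarith [mul_le_mul_of_nonneg_right this (sq_nonneg ‖p - q‖)]

lemma continuous_soft {r : ℝ} (hr : 0 ≤ r) : Continuous (soft r) := by
  refine (LipschitzWith.of_dist_le_mul (K := 1) fun u v => ?_).continuous
  simpa [dist_eq_norm] using norm_soft_sub_soft_le hr u v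

/-- From `(‖u‖ - 2r)² ≥ 0` one gets `‖u‖ - r ≤ ‖u‖² / (4r)`. The gain `r⁻²` lets a fourth moment
bound the mean excess. -/
lemma norm_soft_sq_le_pow_four {r : ℝ} (hr : 0 < r) (u : ℂ) :
    ‖soft r u‖ ^ 2 ≤ ‖u‖ ^ 4 / (16 * r ^ 2) := by
  have h1 : ‖soft r u‖ ≤ ‖u‖ ^ 2 / (4 * r) := by
    rw [norm_soft hr.le]
    apply max_le _ (by positivity)
    rw [le_div_iff₀ (by positivity)]
    nlinarith [sq_nonneg (‖u‖ - 2 * r)]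
  calc ‖soft r u‖ ^ 2 ≤ (‖u‖ ^ 2 / (4 * r)) ^ 2 := pow_le_pow_left₀ (norm_nonneg _) h1 2
    _ = ‖u‖ ^ 4 / (16 * r ^ 2) := by field_simp; ring

lemma norm_sq_le_soft {r : ℝ} (hr : 0 ≤ r) (u : ℂ) :
    ‖u‖ ^ 2 ≤ 2 * ‖soft r u‖ ^ 2 + 2 * r ^ 2 := by
  have h : ‖u‖ ≤ ‖soft r u‖ + r := by
    rw [norm_soft hr]
    linarith [le_max_left (‖u‖ - r) 0]
  have h2 := pow_le_pow_left₀ (norm_nonneg u) h 2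
  nlinarith [sq_nonneg (‖soft r u‖ - r)]

end SoftThreshold

/-! ### Amplitudes under independent phases. -/

section Model

variable {d K : ℕ}

/-- A unitary matrix all of whose entries have the same modulus. -/
structure IsFlatUnitary (F : Fin d → Fin d → ℂ) : Prop where
  sum_norm_sq : ∀ φ : Fin d → ℂ, ∑ m, ‖∑ w, φ w * F m w‖ ^ 2 = ∑ w, ‖φ w‖ ^ 2
  sum_norm_sq_transpose : ∀ g : Fin d → ℂ, ∑ w, ‖∑ m, g m * F m w‖ ^ 2 = ∑ m, ‖g m‖ ^ 2
  norm_sq : ∀ m w, ‖F m w‖ ^ 2 = 1 / d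

/-- The amplitude of `φ`, rotated by the phases of key `k`, on the `m`-th row of `F`. -/
noncomputable def amp (F : Fin d → Fin d → ℂ) (θ : Fin d → Fin K → ℝ) (φ : Fin d → ℂ)
    (k : Fin K) (m : Fin d) : ℂ :=
  ∑ w, φ w * phase (θ w k) * F m w

/-- The law of independent phases. -/
noncomputable def phaseLaw (ν : Fin d → Fin K → Measure ℝ) : Measure (Fin d → Fin K → ℝ) :=
  Measure.pi fun w => Measure.pi fun k => ν w k

instance (ν : Fin d → Fin K → Measure ℝ) [∀ w k, IsProbabilityMeasure (ν w k)] :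
    IsProbabilityMeasure (phaseLaw ν) := by unfold phaseLaw; infer_instance

variable {F : Fin d → Fin d → ℂ}

lemma sum_norm_sq_amp (hF : IsFlatUnitary F) (θ : Fin d → Fin K → ℝ) (φ : Fin d → ℂ)
    (k : Fin K) : ∑ m, ‖amp F θ φ k m‖ ^ 2 = ∑ w, ‖φ w‖ ^ 2 := by
  unfold amp
  rw [hF.sum_norm_sq (fun w => φ w * phase (θ w k))]
  simp

lemma amp_add (θ : Fin d → Fin K → ℝ) (φ ψ : Fin d → ℂ) (k : Fin K) (m : Fin d) :
    amp F θ (fun w => φ w + ψ w) k m = amp F θ φ k m + amp F θ ψ k m := by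
  simp only [amp, add_mul, Finset.sum_add_distrib]

lemma amp_mul (θ : Fin d → Fin K → ℝ) (c : ℂ) (φ : Fin d → ℂ) (k : Fin K) (m : Fin d) :
    amp F θ (fun w => c * φ w) k m = c * amp F θ φ k m := by
  simp only [amp, mul_assoc, Finset.mul_sum]

lemma amp_congr {θ θ' : Fin d → Fin K → ℝ} {φ : Fin d → ℂ} (h : ∀ w, φ w ≠ 0 → θ w = θ' w) :
    amp F θ φ = amp F θ' φ := by
  ext k m
  unfold amp
  refine Finset.sum_congr rfl fun w _ => ?_
  by_cases hw : φ w = 0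
  · simp [hw]
  · rw [h w hw]

lemma continuous_amp (φ : Fin d → ℂ) (k : Fin K) (m : Fin d) :
    Continuous fun θ : Fin d → Fin K → ℝ => amp F θ φ k m := by
  unfold amp; fun_prop

lemma norm_amp_le (hF : IsFlatUnitary F) (θ : Fin d → Fin K → ℝ) (φ : Fin d → ℂ) (k : Fin K)
    (m : Fin d) : ‖amp F θ φ k m‖ ≤ √(∑ w, ‖φ w‖ ^ 2) := by
  apply Real.le_sqrt_of_sq_le
  rw [← sum_norm_sq_amp hF θ φ k]
  exact Finset.single_le_sum (f := fun m => ‖amp F θ φ k m‖ ^ 2) (fun _ _ => by positivity)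
    (Finset.mem_univ m)

variable {ν : Fin d → Fin K → Measure ℝ} [∀ w k, IsProbabilityMeasure (ν w k)]

lemma mgfLe_phaseLaw_re (hν : ∀ w k, ∫ x, phase x ∂(ν w k) = 0) (c : Fin d → Fin K → ℂ) :
    MgfLe (phaseLaw ν) (fun θ => (∑ w, ∑ k, phase (θ w k) * c w k).re)
      (∑ w, ∑ k, ‖c w k‖ ^ 2) := by
  have h := MgfLe.pi fun w => MgfLe.pi fun k => MgfLe.re_phase_mul (hν w k) (c w k)
  simp only [Complex.re_sum]
  exact h

lemma mgfLe_phaseLaw_im (hν : ∀ w k, ∫ x, phase x ∂(ν w k) = 0) (c : Fin d → Fin K → ℂ) :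
    MgfLe (phaseLaw ν) (fun θ => (∑ w, ∑ k, phase (θ w k) * c w k).im)
      (∑ w, ∑ k, ‖c w k‖ ^ 2) := by
  have h := mgfLe_phaseLaw_re hν (fun w k => -Complex.I * c w k)
  simp only [norm_mul, norm_neg, Complex.norm_I, one_mul] at h
  convert h using 2 with θ
  have : ∑ w, ∑ k, phase (θ w k) * (-Complex.I * c w k)
      = -Complex.I * ∑ w, ∑ k, phase (θ w k) * c w k := by
    simp only [Finset.mul_sum]
    refine Finset.sum_congr rfl fun w _ => Finset.sum_congr rfl fun k _ => by ring
  rw [this]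
  simp

lemma concentrates_phaseLaw_hamming (S : Finset (Fin d)) :
    Concentrates (phaseLaw ν)
      (fun θ θ' => ∑ w, ∑ k, if w ∈ S ∧ θ w k ≠ θ' w k then (1 : ℝ) else 0)
      (S.card * K / 4) := by
  have h0 : ∀ w k, Concentrates (ν w k)
      (fun x y => if w ∈ S ∧ x ≠ y then (1 : ℝ) else 0) (if w ∈ S then 1 / 4 else 0) := by
    intro w k
    by_cases hw : w ∈ S
    · simp only [hw, true_and, if_true]
      exact Concentrates.of_le_one fun x y => by split_ifs <;> norm_num
    · simp only [hw, false_and, if_false]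
      exact Concentrates.zero _
  have h1 := fun w => Concentrates.pi (fun k => h0 w k) (by simp)
  have h2 := Concentrates.pi h1 (by simp)
  have e : ∑ w, ∑ _k : Fin K, (if w ∈ S then (1 / 4 : ℝ) else 0) = S.card * K / 4 := by
    simp only [Finset.sum_const, Finset.card_univ, Fintype.card_fin, nsmul_eq_mul, ← Finset.mul_sum,
      Finset.sum_ite_mem, Finset.univ_inter]
    ring
  rw [e] at h2
  exact h2

/-- All `K` phases at one position count as a single coordinate, so the variance proxy does not grow
with `K`. -/
lemma concentrates_phaseLaw_block :
    Concentrates (phaseLaw ν)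
      (fun θ θ' => ∑ w, if θ w ≠ θ' w then (1 : ℝ) else 0) (d / 4) := by
  have h := Concentrates.pi (fun w => Concentrates.of_le_one (ν := Measure.pi (ν w))
    (D := fun x y => if x ≠ y then (1 : ℝ) else 0) fun x y => by split_ifs <;> norm_num) (by simp)
  have e : ∑ _w : Fin d, (1 / 4 : ℝ) = d / 4 := by simp; ring
  rw [e] at h
  exact h

end Model


/-! ### Excess energy of indicator vectors. -/

section FlatVectors

variable {d K : ℕ} {F : Fin d → Fin d → ℂ}

/-- The indicator vector of a set of coordinates. -/
noncomputable def ind (S : Finset (Fin d)) : Fin d → ℂ := fun w => if w ∈ S then 1 else 0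

lemma sum_norm_sq_ind (S : Finset (Fin d)) : ∑ w, ‖ind S w‖ ^ 2 = S.card := by
  have : ∀ w, ‖ind S w‖ ^ 2 = if w ∈ S then 1 else 0 := by
    intro w; unfold ind; split_ifs <;> simp
  simp [this]

/-- Total energy, over all keys, of the amplitudes of `φ` in excess of the level `r`. -/
noncomputable def excess (F : Fin d → Fin d → ℂ) (r : ℝ) (φ : Fin d → ℂ)
    (θ : Fin d → Fin K → ℝ) : ℝ :=
  ∑ k, ∑ m, ‖soft r (amp F θ φ k m)‖ ^ 2

lemma excess_nonneg (r : ℝ) (φ : Fin d → ℂ) (θ : Fin d → Fin K → ℝ) : 0 ≤ excess F r φ θ := by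
  unfold excess; positivity

lemma continuous_excess {r : ℝ} (hr : 0 ≤ r) (φ : Fin d → ℂ) :
    Continuous (excess (K := K) F r φ) := by
  unfold excess
  have := continuous_soft hr
  have h := continuous_amp (K := K) (F := F) φ
  fun_prop

/-- Replace the phases at the positions in `B`. -/
def splice (B : Finset (Fin d × Fin K)) (θ' θ : Fin d → Fin K → ℝ) : Fin d → Fin K → ℝ :=
  fun w k => if (w, k) ∈ B then θ' w k else θ w k

lemma continuous_splice (B : Finset (Fin d × Fin K)) (θ' : Fin d → Fin K → ℝ) :
    Continuous (splice B θ') := by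
  refine continuous_pi fun w => continuous_pi fun k => ?_
  unfold splice
  split_ifs <;> fun_prop

/-- Thresholding is nonexpansive and `F` is unitary, so altering the phases in `B` moves all
amplitudes by a total energy of at most `4 * B.card`. It follows that the regularised excess is
comparable to the excess. -/
lemma excess_le_splice (hF : IsFlatUnitary F) {r : ℝ} (hr : 0 ≤ r) (S : Finset (Fin d))
    (B : Finset (Fin d × Fin K)) (θ' θ : Fin d → Fin K → ℝ) :
    excess F r (ind S) θ ≤ 8 * (B.card + excess F r (ind S) (splice B θ' θ)) := by
  have h1 : ∀ u v : ℂ, ‖soft r u‖ ^ 2 ≤ 2 * ‖soft r v‖ ^ 2 + 2 * ‖u - v‖ ^ 2 := by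
    intro u v
    have h : ‖soft r u‖ ≤ ‖soft r v‖ + ‖u - v‖ := by
      have h2 := norm_soft_sub_soft_le hr u v
      have h3 := norm_sub_norm_le (soft r u) (soft r v)
      linarith
    have h2 := pow_le_pow_left₀ (norm_nonneg _) h 2
    nlinarith [sq_nonneg (‖soft r v‖ - ‖u - v‖)]
  have h2 : ∀ k, ∑ m, ‖amp F θ (ind S) k m - amp F (splice B θ' θ) (ind S) k m‖ ^ 2
      ≤ ∑ w, (if (w, k) ∈ B then (4 : ℝ) else 0) := by
    intro k
    have e : ∀ m, amp F θ (ind S) k m - amp F (splice B θ' θ) (ind S) k m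
        = ∑ w, (ind S w * (phase (θ w k) - phase (splice B θ' θ w k))) * F m w := by
      intro m
      unfold amp
      rw [← Finset.sum_sub_distrib]
      refine Finset.sum_congr rfl fun w _ => by ring
    simp_rw [e]
    rw [hF.sum_norm_sq]
    refine Finset.sum_le_sum fun w _ => ?_
    by_cases hB : (w, k) ∈ B
    · simp only [hB, if_true]
      have hi : ‖ind S w‖ ≤ 1 := by unfold ind; split_ifs <;> simp
      have hp : ‖phase (θ w k) - phase (splice B θ' θ w k)‖ ≤ 2 := by
        refine (norm_sub_le _ _).trans ?_
        simp; norm_num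
      have : ‖ind S w * (phase (θ w k) - phase (splice B θ' θ w k))‖ ≤ 1 * 2 := by
        rw [norm_mul]; gcongr
      calc _ ≤ (1 * 2 : ℝ) ^ 2 := pow_le_pow_left₀ (norm_nonneg _) this 2
        _ = 4 := by norm_num
    · have : splice B θ' θ w k = θ w k := by simp [splice, hB]
      simp [hB, this]
  have h3 : ∑ k, ∑ w, (if (w, k) ∈ B then (4 : ℝ) else 0) = 4 * B.card := by
    rw [Finset.sum_comm, ← Fintype.sum_prod_type' (f := fun w k => if (w, k) ∈ B then (4 : ℝ) else 0)]
    simp [mul_comm]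
  have h4 : ∑ k, ∑ m, ‖amp F θ (ind S) k m - amp F (splice B θ' θ) (ind S) k m‖ ^ 2
      ≤ 4 * B.card := by
    rw [← h3]
    exact Finset.sum_le_sum fun k _ => h2 k
  have h5 : excess F r (ind S) θ ≤ 2 * excess F r (ind S) (splice B θ' θ)
      + 2 * ∑ k, ∑ m, ‖amp F θ (ind S) k m - amp F (splice B θ' θ) (ind S) k m‖ ^ 2 := by
    unfold excess
    rw [Finset.mul_sum, Finset.mul_sum, ← Finset.sum_add_distrib]
    refine Finset.sum_le_sum fun k _ => ?_
    rw [Finset.mul_sum, Finset.mul_sum, ← Finset.sum_add_distrib]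
    exact Finset.sum_le_sum fun m _ => h1 _ _
  have := excess_nonneg (F := F) r (ind S) (splice B θ' θ)
  linarith

/-- A regularisation of the excess energy of a flat vector which is Lipschitz for the Hamming
distance. -/
noncomputable def regExcess (F : Fin d → Fin d → ℂ) (r : ℝ) (S : Finset (Fin d))
    (θ : Fin d → Fin K → ℝ) : ℝ :=
  ⨅ q : Finset (Fin d × Fin K) × (Fin d → Fin K → ℝ),
    ((q.1.card : ℝ) + excess F r (ind S) (splice q.1 q.2 θ))

lemma bddBelow_regExcess (r : ℝ) (S : Finset (Fin d)) (θ : Fin d → Fin K → ℝ) :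
    BddBelow (Set.range fun q : Finset (Fin d × Fin K) × (Fin d → Fin K → ℝ) =>
      ((q.1.card : ℝ) + excess F r (ind S) (splice q.1 q.2 θ))) :=
  ⟨0, by
    rintro _ ⟨q, rfl⟩
    exact add_nonneg (Nat.cast_nonneg _) (excess_nonneg _ _ _)⟩

lemma regExcess_nonneg (r : ℝ) (S : Finset (Fin d)) (θ : Fin d → Fin K → ℝ) :
    0 ≤ regExcess F r S θ :=
  Real.iInf_nonneg fun _ => add_nonneg (Nat.cast_nonneg _) (excess_nonneg _ _ _)

lemma regExcess_le_excess (r : ℝ) (S : Finset (Fin d)) (θ : Fin d → Fin K → ℝ) :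
    regExcess F r S θ ≤ excess F r (ind S) θ := by
  refine (ciInf_le (bddBelow_regExcess r S θ) (∅, θ)).trans (le_of_eq ?_)
  have : splice ∅ θ θ = θ := by ext; simp [splice]
  simp [this]

lemma excess_le_regExcess (hF : IsFlatUnitary F) {r : ℝ} (hr : 0 ≤ r) (S : Finset (Fin d))
    (θ : Fin d → Fin K → ℝ) : excess F r (ind S) θ ≤ 8 * regExcess F r S θ := by
  have : excess F r (ind S) θ / 8 ≤ regExcess F r S θ :=
    le_ciInf fun q => by
      have := excess_le_splice hF hr S q.1 q.2 θ
      linarith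
  linarith

/-- The infimum is over an uncountable family, but an infimum of continuous functions is upper
semicontinuous. -/
lemma measurable_regExcess {r : ℝ} (hr : 0 ≤ r) (S : Finset (Fin d)) :
    Measurable (regExcess (K := K) F r S) := by
  refine UpperSemicontinuous.measurable ?_
  refine upperSemicontinuous_ciInf (fun θ => bddBelow_regExcess r S θ) fun q => ?_
  exact (continuous_const.add
    ((continuous_excess hr _).comp (continuous_splice q.1 q.2))).upperSemicontinuous

/-- Positions at which the configurations differ may be added to the spliced set at unit cost each.
Those outside `S` are free, because `ind S` vanishes there. -/
lemma regExcess_le_add (r : ℝ) (S : Finset (Fin d)) (θ₁ θ₂ : Fin d → Fin K → ℝ) :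
    regExcess F r S θ₁ ≤ regExcess F r S θ₂
      + ∑ w, ∑ k, if w ∈ S ∧ θ₁ w k ≠ θ₂ w k then (1 : ℝ) else 0 := by
  rw [← sub_le_iff_le_add]
  refine le_ciInf fun q => ?_
  rw [sub_le_iff_le_add]
  classical
  set D : Finset (Fin d × Fin K) :=
    Finset.univ.filter fun p => p.1 ∈ S ∧ θ₁ p.1 p.2 ≠ θ₂ p.1 p.2 with hD
  have hDc : (D.card : ℝ) = ∑ w, ∑ k, if w ∈ S ∧ θ₁ w k ≠ θ₂ w k then (1 : ℝ) else 0 := by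
    rw [hD, Finset.card_filter, ← Fintype.sum_prod_type'
      (f := fun w k => if w ∈ S ∧ θ₁ w k ≠ θ₂ w k then (1 : ℝ) else 0)]
    push_cast
    rfl
  rw [← hDc]
  -- Splicing in `splice q.1 q.2 θ₂` on the enlarged set reproduces on `S` the competitor that `q`
  -- gives for `θ₂`.
  refine (ciInf_le (bddBelow_regExcess r S θ₁) (q.1 ∪ D, splice q.1 q.2 θ₂)).trans ?_
  have h1 : (((q.1 ∪ D).card : ℕ) : ℝ) ≤ q.1.card + D.card := by
    exact_mod_cast Finset.card_union_le _ _
  have h2 : excess F r (ind S) (splice (q.1 ∪ D) (splice q.1 q.2 θ₂) θ₁)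
      = excess F r (ind S) (splice q.1 q.2 θ₂) := by
    unfold excess
    rw [amp_congr (θ' := splice q.1 q.2 θ₂)]
    intro w hw
    have hwS : w ∈ S := by by_contra h; simp [ind, h] at hw
    ext k
    by_cases h : (w, k) ∈ q.1 ∪ D
    · simp [splice, h]
    · have h3 : (w, k) ∉ q.1 := fun h' => h (Finset.mem_union_left _ h')
      have h4 : (w, k) ∉ D := fun h' => h (Finset.mem_union_right _ h')
      have h5 : θ₁ w k = θ₂ w k := by
        by_contra h6
        exact h4 (by simp [hD, hwS, h6])
      simp only [splice, h, h3, if_false, h5]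
  simp only at h2 ⊢
  rw [h2]
  linarith

variable {ν : Fin d → Fin K → Measure ℝ} [∀ w k, IsProbabilityMeasure (ν w k)]

lemma integral_norm_amp_ind_pow_four_le (hF : IsFlatUnitary F)
    (hν : ∀ w k, ∫ x, phase x ∂(ν w k) = 0) {S : Finset (Fin d)} (hS : S.Nonempty)
    (k : Fin K) (m : Fin d) :
    ∫ θ, ‖amp F θ (ind S) k m‖ ^ 4 ∂(phaseLaw ν) ≤ 96 * (S.card / d) ^ 2 := by
  set c : Fin d → Fin K → ℂ := fun w k' => if k' = k then ind S w * F m w else 0 with hc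
  have hL : ∀ θ : Fin d → Fin K → ℝ, amp F θ (ind S) k m = ∑ w, ∑ k', phase (θ w k') * c w k' := by
    intro θ
    unfold amp
    refine Finset.sum_congr rfl fun w _ => ?_
    simp only [hc, mul_ite, mul_zero, Finset.sum_ite_eq', Finset.mem_univ, if_true]
    ring
  have hw : ∑ w, ∑ k', ‖c w k'‖ ^ 2 = S.card / d := by
    have : ∀ w k', ‖c w k'‖ ^ 2 = if k' = k then ‖ind S w‖ ^ 2 * (1 / d) else 0 := by
      intro w k'
      simp only [hc]
      split_ifs
      · rw [norm_mul, mul_pow, hF.norm_sq]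
      · simp
    simp only [this, Finset.sum_ite_eq', Finset.mem_univ, if_true, ← Finset.sum_mul,
      sum_norm_sq_ind]
    ring
  have h1 := mgfLe_phaseLaw_re hν c
  have h2 := mgfLe_phaseLaw_im hν c
  rw [hw] at h1 h2
  simp_rw [← hL] at h1 h2
  have hd : 0 < d := Fin.pos m
  have hcard : 0 < S.card := hS.card_pos
  exact integral_norm_pow_four_le (continuous_amp _ k m).measurable
    (fun θ => norm_amp_le hF θ _ k m) h1 h2 (by positivity)

lemma integral_excess_ind_le (hF : IsFlatUnitary F)
    (hν : ∀ w k, ∫ x, phase x ∂(ν w k) = 0) {S : Finset (Fin d)} (hS : S.Nonempty)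
    {r : ℝ} (hr : 0 < r) :
    ∫ θ, excess F r (ind S) θ ∂(phaseLaw ν) ≤ K * d * (6 * (S.card / d) ^ 2 / r ^ 2) := by
  have hb : ∀ k m, ∀ θ : Fin d → Fin K → ℝ, ‖amp F θ (ind S) k m‖ ≤ √(∑ w, ‖ind S w‖ ^ 2) :=
    fun k m θ => norm_amp_le hF θ _ k m
  have hi : ∀ k m, Integrable (fun θ => ‖soft r (amp F θ (ind S) k m)‖ ^ 2) (phaseLaw ν) := by
    intro k m
    have hm : Measurable fun θ : Fin d → Fin K → ℝ => ‖soft r (amp F θ (ind S) k m)‖ ^ 2 :=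
      (((continuous_soft hr.le).comp (continuous_amp _ k m)).norm.pow 2).measurable
    refine integrable_of_abs_le (C := √(∑ w, ‖ind S w‖ ^ 2) ^ 2) hm fun θ => ?_
    rw [abs_of_nonneg (by positivity)]
    refine pow_le_pow_left₀ (norm_nonneg _) (le_trans ?_ (hb k m θ)) 2
    rw [norm_soft hr.le]
    exact max_le (by linarith) (norm_nonneg _)
  have h1 : ∀ k m, ∫ θ, ‖soft r (amp F θ (ind S) k m)‖ ^ 2 ∂(phaseLaw ν)
      ≤ 6 * (S.card / d) ^ 2 / r ^ 2 := by
    intro k m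
    have h2 : ∫ θ, ‖soft r (amp F θ (ind S) k m)‖ ^ 2 ∂(phaseLaw ν)
        ≤ ∫ θ, ‖amp F θ (ind S) k m‖ ^ 4 / (16 * r ^ 2) ∂(phaseLaw ν) := by
      refine integral_mono (hi k m) ?_ fun θ => norm_soft_sq_le_pow_four hr _
      have hm : Measurable fun θ : Fin d → Fin K → ℝ => ‖amp F θ (ind S) k m‖ ^ 4 :=
        ((continuous_amp _ k m).norm.pow 4).measurable
      refine Integrable.div_const (integrable_of_abs_le (C := √(∑ w, ‖ind S w‖ ^ 2) ^ 4) hm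
        fun θ => ?_) _
      rw [abs_of_nonneg (by positivity)]
      exact pow_le_pow_left₀ (norm_nonneg _) (hb k m θ) 4
    refine h2.trans ?_
    rw [integral_div]
    have h3 := integral_norm_amp_ind_pow_four_le hF hν hS k m
    calc _ ≤ 96 * (S.card / d : ℝ) ^ 2 / (16 * r ^ 2) := by gcongr
      _ = 6 * (S.card / d) ^ 2 / r ^ 2 := by field_simp; ring
  unfold excess
  rw [integral_finsetSum _ fun k _ => integrable_finsetSum _ fun m _ => hi k m]
  calc _ ≤ ∑ _k : Fin K, ∑ _m : Fin d, 6 * (S.card / d : ℝ) ^ 2 / r ^ 2 := by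
        refine Finset.sum_le_sum fun k _ => ?_
        rw [integral_finsetSum _ fun m _ => hi k m]
        exact Finset.sum_le_sum fun m _ => h1 k m
    _ = _ := by simp; ring

/-- The excess energy of a flat vector is small, with probability exponentially close to one in
the size of its support times the number of keys. -/
lemma excess_ind_tail (hF : IsFlatUnitary F) (hν : ∀ w k, ∫ x, phase x ∂(ν w k) = 0)
    (hK : 0 < K) {S : Finset (Fin d)} (hS : S.Nonempty) {r δ : ℝ} (hr : 0 < r) (hδ : 0 < δ)
    (hr2 : r ^ 2 = 6 / δ * (S.card / d)) :
    (phaseLaw ν).real {θ | 16 * δ * S.card * K < excess F r (ind S) θ}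
      ≤ Real.exp (-(2 * δ ^ 2 * S.card * K)) := by
  have hn : (0 : ℝ) < S.card := by exact_mod_cast hS.card_pos
  have hK' : (0 : ℝ) < K := by exact_mod_cast hK
  obtain ⟨w0, _⟩ := hS
  have hd : (0 : ℝ) < d := by exact_mod_cast Fin.pos w0
  -- The value of `r ^ 2` is the one for which the fourth-moment bound equals `δ * S.card * K`.
  have hE : ∫ θ, regExcess F r S θ ∂(phaseLaw ν) ≤ δ * S.card * K := by
    have h1 := integral_excess_ind_le (ν := ν) hF hν ⟨w0, ‹_›⟩ hr
    have h2 : K * d * (6 * (S.card / d : ℝ) ^ 2 / r ^ 2) = δ * S.card * K := by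
      rw [hr2]; field_simp
    rw [h2] at h1
    refine le_trans (integral_mono_of_nonneg
      (Filter.Eventually.of_forall fun θ => regExcess_nonneg r S θ) ?_
      (Filter.Eventually.of_forall fun θ => regExcess_le_excess r S θ)) h1
    have hm : Measurable (excess (K := K) F r (ind S)) := (continuous_excess hr.le _).measurable
    refine integrable_of_abs_le (C := K * S.card) hm fun θ => ?_
    rw [abs_of_nonneg (excess_nonneg _ _ _)]
    unfold excess
    calc _ ≤ ∑ k : Fin K, ∑ m, ‖amp F θ (ind S) k m‖ ^ 2 := by
          gcongr with k _ m _
          rw [norm_soft hr.le]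
          exact max_le (by linarith) (norm_nonneg _)
      _ = _ := by simp [sum_norm_sq_amp hF, sum_norm_sq_ind]
  have hLip : ∀ x y : Fin d → Fin K → ℝ, |regExcess F r S x - regExcess F r S y|
      ≤ ∑ w, ∑ k, if w ∈ S ∧ x w k ≠ y w k then (1 : ℝ) else 0 := by
    intro x y
    have h1 := regExcess_le_add (F := F) r S x y
    have h2 := regExcess_le_add (F := F) r S y x
    simp_rw [fun w k => ne_comm (a := y w k) (b := x w k)] at h2
    rw [abs_le]
    constructor <;> linarith
  have hbd : ∃ C, ∀ x : Fin d → Fin K → ℝ, |regExcess F r S x| ≤ C := by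
    refine ⟨K * S.card, fun θ => ?_⟩
    rw [abs_of_nonneg (regExcess_nonneg _ _ _)]
    refine (regExcess_le_excess r S θ).trans ?_
    unfold excess
    calc _ ≤ ∑ k : Fin K, ∑ m, ‖amp F θ (ind S) k m‖ ^ 2 := by
          gcongr with k _ m _
          rw [norm_soft hr.le]
          exact max_le (by linarith) (norm_nonneg _)
      _ = _ := by simp [sum_norm_sq_amp hF, sum_norm_sq_ind]
  -- A deviation equal to the bound on the mean puts the regularised excess below `2 * δ * S.card *
  -- K`; the comparison constant 8 makes this 16 for the excess itself.
  have key := (concentrates_phaseLaw_hamming (ν := ν) S).tail (by positivity)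
    (measurable_regExcess hr.le S) hbd hLip (t := δ * S.card * K) (by positivity) hE
  have e : (δ * S.card * K) ^ 2 / (2 * (S.card * K / 4)) = 2 * δ ^ 2 * S.card * K := by
    field_simp; ring
  rw [e] at key
  refine le_trans (measureReal_mono ?_) key
  intro θ hθ
  have := excess_le_regExcess hF hr.le S θ
  simp only [Set.mem_ofPred_eq] at hθ ⊢
  linarith

end FlatVectors


/-! ### Pairings of a vector with amplitudes driven by fresh phases. -/

section Decoupling

variable {d K : ℕ} {F : Fin d → Fin d → ℂ}

/-- The adjoint of the amplitude map, without the phases. -/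
noncomputable def dualCoeff (F : Fin d → Fin d → ℂ) (g : Fin K → Fin d → ℂ) (k : Fin K)
    (w : Fin d) : ℂ :=
  ∑ m, star (g k m) * F m w

/-- The coefficient of `ψ w` in the pairing of `g` with the amplitudes of `ψ`. -/
noncomputable def dualForm (F : Fin d → Fin d → ℂ) (g : Fin K → Fin d → ℂ) (w : Fin d)
    (x : Fin K → ℝ) : ℂ :=
  ∑ k, phase (x k) * dualCoeff F g k w

/-- Squared Euclidean norm of a family of vectors. -/
noncomputable def energy (g : Fin K → Fin d → ℂ) : ℝ := ∑ k, ∑ m, ‖g k m‖ ^ 2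

/-- The part of the energy of `g` sitting, after applying the adjoint, at the position `w`. -/
noncomputable def dualEnergy (F : Fin d → Fin d → ℂ) (g : Fin K → Fin d → ℂ) (w : Fin d) : ℝ :=
  ∑ k, ‖dualCoeff F g k w‖ ^ 2

/-- Weights truncating the dual energy. -/
noncomputable def dualWeight (F : Fin d → Fin d → ℂ) (N : ℝ) (g : Fin K → Fin d → ℂ)
    (w : Fin d) : ℝ :=
  N / (energy g + N * dualEnergy F g w)

lemma energy_nonneg (g : Fin K → Fin d → ℂ) : 0 ≤ energy g := by unfold energy; positivity

lemma dualEnergy_nonneg (g : Fin K → Fin d → ℂ) (w : Fin d) : 0 ≤ dualEnergy F g w := by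
  unfold dualEnergy; positivity

lemma sum_dualEnergy (hF : IsFlatUnitary F) (g : Fin K → Fin d → ℂ) :
    ∑ w, dualEnergy F g w = energy g := by
  unfold dualEnergy energy dualCoeff
  rw [Finset.sum_comm]
  refine Finset.sum_congr rfl fun k _ => ?_
  rw [hF.sum_norm_sq_transpose (fun m => star (g k m))]
  simp

lemma dualWeight_nonneg {N : ℝ} (hN : 0 ≤ N) (g : Fin K → Fin d → ℂ) (w : Fin d) :
    0 ≤ dualWeight F N g w := by
  unfold dualWeight
  have := energy_nonneg g
  have := dualEnergy_nonneg (F := F) g w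
  positivity

/-- The summand `N * dualEnergy` in the denominator caps each term. This is what makes the
exponential moment of the weighted square finite with universal constants. -/
lemma dualWeight_mul_le_one {N : ℝ} (hN : 0 ≤ N) (g : Fin K → Fin d → ℂ) (w : Fin d) :
    dualWeight F N g w * dualEnergy F g w ≤ 1 := by
  unfold dualWeight
  have h1 := energy_nonneg g
  have h2 := dualEnergy_nonneg (F := F) g w
  rw [div_mul_eq_mul_div]
  apply div_le_one_of_le₀ _ (by positivity)
  linarith

/-- Each weight is at most `N / energy g`, and the dual energies add up to `energy g`. -/
lemma sum_dualWeight_mul_le (hF : IsFlatUnitary F) {N : ℝ} (hN : 0 ≤ N) (g : Fin K → Fin d → ℂ)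
    (s : Finset (Fin d)) : ∑ w ∈ s, dualWeight F N g w * dualEnergy F g w ≤ N := by
  have h2 := fun w => dualEnergy_nonneg (F := F) g w
  rcases (energy_nonneg g).eq_or_lt with h | h
  · have h0 : ∀ w, dualEnergy F g w = 0 := by
      intro w
      have := sum_dualEnergy hF g
      rw [← h] at this
      exact (Finset.sum_eq_zero_iff_of_nonneg fun w _ => h2 w).mp this w (Finset.mem_univ w)
    simpa [h0] using hN
  · calc ∑ w ∈ s, dualWeight F N g w * dualEnergy F g w
        ≤ ∑ w, dualWeight F N g w * dualEnergy F g w :=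
          Finset.sum_le_sum_of_subset_of_nonneg (Finset.subset_univ s) fun w _ _ =>
            mul_nonneg (dualWeight_nonneg hN g w) (h2 w)
      _ ≤ ∑ w, N / energy g * dualEnergy F g w := by
          refine Finset.sum_le_sum fun w _ => mul_le_mul_of_nonneg_right ?_ (h2 w)
          unfold dualWeight
          have := mul_nonneg hN (h2 w)
          exact div_le_div_of_nonneg_left hN h (by linarith)
      _ = N := by
          rw [← Finset.mul_sum, sum_dualEnergy hF]
          field_simp

lemma pairing_eq (g : Fin K → Fin d → ℂ) (θ : Fin d → Fin K → ℝ) (ψ : Fin d → ℂ) :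
    ∑ k, ∑ m, star (g k m) * amp F θ ψ k m = ∑ w, ψ w * dualForm F g w (θ w) := by
  unfold amp dualForm dualCoeff
  simp only [Finset.mul_sum]
  rw [Finset.sum_comm (s := (Finset.univ : Finset (Fin d))) (t := (Finset.univ : Finset (Fin K)))]
  refine Finset.sum_congr rfl fun k _ => ?_
  rw [Finset.sum_comm]
  refine Finset.sum_congr rfl fun w _ => Finset.sum_congr rfl fun m _ => by ring

lemma norm_dualForm_le (g : Fin K → Fin d → ℂ) (w : Fin d) (x : Fin K → ℝ) :
    ‖dualForm F g w x‖ ≤ ∑ k, ‖dualCoeff F g k w‖ := by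
  unfold dualForm
  refine (norm_sum_le _ _).trans (le_of_eq ?_)
  simp

/-- On the event controlled by `dualForm_tail`, the pairing of `g` with the amplitudes of vectors
with small coordinates is small. -/
lemma norm_pairing_sq_le (hF : IsFlatUnitary F) {N : ℝ} (hN : 0 < N) (g : Fin K → Fin d → ℂ)
    (θ : Fin d → Fin K → ℝ) (V : Finset (Fin d)) (ψ : Fin d → ℂ) {a : ℝ}
    (hV : ∀ w ∈ V, ψ w = 0) (ha : ∀ w, ‖ψ w‖ ^ 2 ≤ a) (hψ : ∑ w, ‖ψ w‖ ^ 2 ≤ 1)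
    (hev : ∑ w ∈ Vᶜ, dualWeight F N g w * ‖dualForm F g w (θ w)‖ ^ 2 ≤ 64 * N) :
    ‖∑ k, ∑ m, star (g k m) * amp F θ ψ k m‖ ^ 2 ≤ 64 * energy g * (a * N + 1) := by
  have h2 := fun w => dualEnergy_nonneg (F := F) g w
  rw [pairing_eq]
  have hsum : ∑ w, ψ w * dualForm F g w (θ w) = ∑ w ∈ Vᶜ, ψ w * dualForm F g w (θ w) := by
    refine (Finset.sum_subset (Finset.subset_univ _) fun w _ hw => ?_).symm
    rw [hV w (by simpa using hw), zero_mul]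
  rw [hsum]
  rcases (energy_nonneg g).eq_or_lt with h | h
  · have h0 : ∀ k w, dualCoeff F g k w = 0 := by
      intro k w
      have := sum_dualEnergy hF g
      rw [← h] at this
      have h3 := (Finset.sum_eq_zero_iff_of_nonneg fun w _ => h2 w).mp this w (Finset.mem_univ w)
      unfold dualEnergy at h3
      have := (Finset.sum_eq_zero_iff_of_nonneg fun k _ => by positivity).mp h3 k
        (Finset.mem_univ k)
      simpa using this
    simp [dualForm, h0, ← h]
  · have hden : ∀ w, 0 < energy g + N * dualEnergy F g w := fun w => by
      have := mul_nonneg hN.le (h2 w); linarith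
    -- The inverse weight is `energy g / N + dualEnergy F g w`: the first summand will meet the norm
    -- bound on `ψ`, the second the bound `a` on its coordinates.
    have hcs := Finset.sum_sq_le_sum_mul_sum_of_sq_le_mul (Vᶜ)
      (r := fun w => ‖ψ w‖ * ‖dualForm F g w (θ w)‖)
      (f := fun w => ‖ψ w‖ ^ 2 * ((energy g + N * dualEnergy F g w) / N))
      (g := fun w => dualWeight F N g w * ‖dualForm F g w (θ w)‖ ^ 2)
      (fun w _ => by have := hden w; positivity)
      (fun w _ => mul_nonneg (dualWeight_nonneg hN.le g w) (by positivity))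
      (fun w _ => by
        have := (hden w).ne'
        unfold dualWeight
        apply le_of_eq
        field_simp)
    have hf : ∑ w ∈ Vᶜ, ‖ψ w‖ ^ 2 * ((energy g + N * dualEnergy F g w) / N)
        ≤ energy g / N + a * energy g := by
      calc _ ≤ ∑ w, ‖ψ w‖ ^ 2 * ((energy g + N * dualEnergy F g w) / N) :=
            Finset.sum_le_sum_of_subset_of_nonneg (Finset.subset_univ _) fun w _ _ => by
              have := hden w; positivity
        _ = ∑ w, (‖ψ w‖ ^ 2 * (energy g / N) + ‖ψ w‖ ^ 2 * dualEnergy F g w) := by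
            refine Finset.sum_congr rfl fun w _ => ?_
            field_simp
        _ ≤ ∑ w, (‖ψ w‖ ^ 2 * (energy g / N) + a * dualEnergy F g w) := by
            refine Finset.sum_le_sum fun w _ => ?_
            have := mul_le_mul_of_nonneg_right (ha w) (h2 w)
            linarith
        _ = (∑ w, ‖ψ w‖ ^ 2) * (energy g / N) + a * energy g := by
            rw [Finset.sum_add_distrib, ← Finset.sum_mul, ← Finset.mul_sum, sum_dualEnergy hF]
        _ ≤ _ := by
            have : 0 ≤ energy g / N := by positivity
            nlinarith
    have h3 : ‖∑ w ∈ Vᶜ, ψ w * dualForm F g w (θ w)‖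
        ≤ ∑ w ∈ Vᶜ, ‖ψ w‖ * ‖dualForm F g w (θ w)‖ := by
      refine (norm_sum_le _ _).trans (le_of_eq ?_)
      simp
    have hf0 : 0 ≤ ∑ w ∈ Vᶜ, ‖ψ w‖ ^ 2 * ((energy g + N * dualEnergy F g w) / N) :=
      Finset.sum_nonneg fun w _ => by have := hden w; positivity
    calc _ ≤ (∑ w ∈ Vᶜ, ‖ψ w‖ * ‖dualForm F g w (θ w)‖) ^ 2 :=
          pow_le_pow_left₀ (norm_nonneg _) h3 2
      _ ≤ _ := hcs
      _ ≤ (energy g / N + a * energy g) * (64 * N) := by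
          refine mul_le_mul hf hev (Finset.sum_nonneg fun w _ =>
            mul_nonneg (dualWeight_nonneg hN.le g w) (by positivity)) (hf0.trans hf)
      _ = _ := by field_simp; ring

variable {ν : Fin d → Fin K → Measure ℝ} [∀ w k, IsProbabilityMeasure (ν w k)]

lemma mgfLe_dualForm (hν : ∀ w k, ∫ x, phase x ∂(ν w k) = 0) (g : Fin K → Fin d → ℂ)
    (w : Fin d) :
    MgfLe (Measure.pi (ν w)) (fun x => (dualForm F g w x).re) (dualEnergy F g w) ∧
    MgfLe (Measure.pi (ν w)) (fun x => (dualForm F g w x).im) (dualEnergy F g w) := by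
  have h1 := MgfLe.pi fun k => MgfLe.re_phase_mul (hν w k) (dualCoeff F g k w)
  have h2 := MgfLe.pi fun k => MgfLe.re_phase_mul (hν w k) (-Complex.I * dualCoeff F g k w)
  refine ⟨?_, ?_⟩
  · simp only [dualForm, Complex.re_sum]
    exact h1
  · simp only [dualForm, Complex.im_sum]
    simp only [norm_mul, norm_neg, Complex.norm_I, one_mul] at h2
    convert h2 using 3 with x
    · simp [Complex.mul_re, Complex.mul_im]
      ring
    · rfl

lemma integral_exp_dualForm_le (hν : ∀ w k, ∫ x, phase x ∂(ν w k) = 0) {N : ℝ} (hN : 0 ≤ N)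
    (g : Fin K → Fin d → ℂ) (w : Fin d) :
    ∫ x, Real.exp (dualWeight F N g w / 8 * ‖dualForm F g w x‖ ^ 2) ∂(Measure.pi (ν w))
      ≤ Real.exp (dualWeight F N g w * dualEnergy F g w / 2) := by
  have hm : Measurable (dualForm F g w) := by unfold dualForm; fun_prop
  obtain ⟨h1, h2⟩ := mgfLe_dualForm (F := F) hν g w
  exact integral_exp_normSq_le hm (norm_dualForm_le g w) h1 h2 (dualEnergy_nonneg g w)
    (dualWeight_nonneg hN g w) (dualWeight_mul_le_one hN g w)

/-- By Fubini, fix the phases in `V` first. Then `g` is constant, the blocks off `V` are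
independent, and the exponential moment factorises over positions. -/
lemma lintegral_exp_sum_dualForm_le (hF : IsFlatUnitary F)
    (hν : ∀ w k, ∫ x, phase x ∂(ν w k) = 0) {N : ℝ} (hN : 0 ≤ N) (V : Finset (Fin d))
    (g : (Fin d → Fin K → ℝ) → Fin K → Fin d → ℂ) (hgm : ∀ k m, Measurable fun θ => g θ k m)
    (hgV : ∀ θ θ', (∀ w ∈ V, θ w = θ' w) → g θ = g θ') :
    ∫⁻ θ, ENNReal.ofReal (Real.exp (∑ w ∈ Vᶜ,
        dualWeight F N (g θ) w / 8 * ‖dualForm F (g θ) w (θ w)‖ ^ 2)) ∂(phaseLaw ν)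
      ≤ ENNReal.ofReal (Real.exp (N / 2)) := by
  have hmp := measurePreserving_piEquivPiSubtypeProd (fun w => Measure.pi (ν w)) (· ∈ V)
  set e := MeasurableEquiv.piEquivPiSubtypeProd (fun _ : Fin d => Fin K → ℝ) (· ∈ V) with he
  have hmeas : Measurable fun θ : Fin d → Fin K → ℝ => ENNReal.ofReal (Real.exp (∑ w ∈ Vᶜ,
        dualWeight F N (g θ) w / 8 * ‖dualForm F (g θ) w (θ w)‖ ^ 2)) := by
    unfold dualWeight dualForm dualEnergy energy dualCoeff
    fun_prop
  have h1 := hmp.symm.lintegral_comp hmeas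
  have h2 := hmeas.comp e.symm.measurable
  simp only [Function.comp_def] at h2
  unfold phaseLaw
  rw [← h1, lintegral_prod _ h2.aemeasurable]
  have hin : ∀ x : {w // w ∈ V} → Fin K → ℝ,
      ∫⁻ y, ENNReal.ofReal (Real.exp (∑ w ∈ Vᶜ,
        dualWeight F N (g (e.symm (x, y))) w / 8
          * ‖dualForm F (g (e.symm (x, y))) w (e.symm (x, y) w)‖ ^ 2))
        ∂(Measure.pi fun w : {w // ¬ w ∈ V} => Measure.pi (ν w))
      ≤ ENNReal.ofReal (Real.exp (N / 2)) := by
    intro x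
    -- The zero phases off `V` are arbitrary: `g` only reads the phases in `V`.
    set g0 := g (e.symm (x, fun _ _ => 0)) with hg0
    have hg : ∀ y, g (e.symm (x, y)) = g0 := by
      intro y
      refine hgV _ _ fun w hw => ?_
      simp [he, MeasurableEquiv.piEquivPiSubtypeProd, Equiv.piEquivPiSubtypeProd, hw]
    have hval : ∀ y, Real.exp (∑ w ∈ Vᶜ,
        dualWeight F N (g (e.symm (x, y))) w / 8
          * ‖dualForm F (g (e.symm (x, y))) w (e.symm (x, y) w)‖ ^ 2)
        = ∏ w : {w // ¬ w ∈ V},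
          Real.exp (dualWeight F N g0 w / 8 * ‖dualForm F g0 w (y w)‖ ^ 2) := by
      intro y
      rw [hg y, ← Real.exp_sum]
      congr 1
      rw [Finset.sum_subtype (p := fun w => ¬ w ∈ V) Vᶜ (by simp)]
      refine Finset.sum_congr rfl fun w _ => ?_
      simp [he, MeasurableEquiv.piEquivPiSubtypeProd, Equiv.piEquivPiSubtypeProd, w.2]
    simp_rw [hval]
    have hb : ∀ w x, Real.exp (dualWeight F N g0 w / 8 * ‖dualForm F g0 w x‖ ^ 2)
        ≤ Real.exp (dualWeight F N g0 w / 8 * (∑ k, ‖dualCoeff F g0 k w‖) ^ 2) := by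
      intro w x
      have := dualWeight_nonneg (F := F) hN g0 w
      gcongr
      exact norm_dualForm_le g0 w x
    rw [← ofReal_integral_eq_lintegral_ofReal ?_
      (Filter.Eventually.of_forall fun y => Finset.prod_nonneg fun w _ => (Real.exp_pos _).le)]
    · apply ENNReal.ofReal_le_ofReal
      rw [integral_fintype_prod_eq_prod (f := fun (w : {w // ¬ w ∈ V}) x =>
        Real.exp (dualWeight F N g0 w / 8 * ‖dualForm F g0 w x‖ ^ 2))]
      calc _ ≤ ∏ w : {w // ¬ w ∈ V}, Real.exp (dualWeight F N g0 w * dualEnergy F g0 w / 2) :=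
            Finset.prod_le_prod (fun w _ => integral_nonneg fun x => (Real.exp_pos _).le)
              fun w _ => integral_exp_dualForm_le hν hN g0 w
        _ = Real.exp ((∑ w ∈ Vᶜ, dualWeight F N g0 w * dualEnergy F g0 w) / 2) := by
            rw [← Real.exp_sum, ← Finset.sum_div]
            rw [Finset.sum_subtype (p := fun w => ¬ w ∈ V) Vᶜ (by simp)]
        _ ≤ _ := by
            apply Real.exp_le_exp.mpr
            have := sum_dualWeight_mul_le hF hN g0 Vᶜ
            linarith
    · refine integrable_of_abs_le (C := ∏ w : {w // ¬ w ∈ V},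
        Real.exp (dualWeight F N g0 w / 8 * (∑ k, ‖dualCoeff F g0 k w‖) ^ 2)) ?_ fun y => ?_
      · unfold dualForm; fun_prop
      · rw [abs_of_nonneg (Finset.prod_nonneg fun w _ => (Real.exp_pos _).le)]
        exact Finset.prod_le_prod (fun w _ => (Real.exp_pos _).le) fun w _ => hb w _
  refine (lintegral_mono hin).trans ?_
  simp

/-- Tail bound for the pairing of a vector depending only on the phases in `V` with the amplitudes
of vectors supported off `V`. -/
lemma dualForm_tail (hF : IsFlatUnitary F)
    (hν : ∀ w k, ∫ x, phase x ∂(ν w k) = 0) {N : ℝ} (hN : 0 ≤ N) (V : Finset (Fin d))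
    (g : (Fin d → Fin K → ℝ) → Fin K → Fin d → ℂ) (hgm : ∀ k m, Measurable fun θ => g θ k m)
    (hgV : ∀ θ θ', (∀ w ∈ V, θ w = θ' w) → g θ = g θ') :
    (phaseLaw ν).real {θ | 64 * N <
        ∑ w ∈ Vᶜ, dualWeight F N (g θ) w * ‖dualForm F (g θ) w (θ w)‖ ^ 2}
      ≤ Real.exp (-(7 * N)) := by
  have h := lintegral_exp_sum_dualForm_le (ν := ν) hF hν hN V g hgm hgV
  have hmeas : Measurable fun θ : Fin d → Fin K → ℝ => ENNReal.ofReal (Real.exp (∑ w ∈ Vᶜ,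
        dualWeight F N (g θ) w / 8 * ‖dualForm F (g θ) w (θ w)‖ ^ 2)) := by
    unfold dualWeight dualForm dualEnergy energy dualCoeff
    fun_prop
  -- Markov's inequality at the level `exp (8N)`; the `64 N` of the event is divided by the 8 in the
  -- exponent.
  have hM := mul_meas_ge_le_lintegral (μ := phaseLaw ν) hmeas (ENNReal.ofReal (Real.exp (8 * N)))
  have hsub : {θ : Fin d → Fin K → ℝ | 64 * N <
        ∑ w ∈ Vᶜ, dualWeight F N (g θ) w * ‖dualForm F (g θ) w (θ w)‖ ^ 2} ⊆
      {θ | ENNReal.ofReal (Real.exp (8 * N)) ≤ ENNReal.ofReal (Real.exp (∑ w ∈ Vᶜ,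
        dualWeight F N (g θ) w / 8 * ‖dualForm F (g θ) w (θ w)‖ ^ 2))} := by
    intro θ hθ
    simp only [Set.mem_ofPred_eq] at hθ ⊢
    apply ENNReal.ofReal_le_ofReal
    apply Real.exp_le_exp.mpr
    have : ∑ w ∈ Vᶜ, dualWeight F N (g θ) w / 8 * ‖dualForm F (g θ) w (θ w)‖ ^ 2
        = (∑ w ∈ Vᶜ, dualWeight F N (g θ) w * ‖dualForm F (g θ) w (θ w)‖ ^ 2) / 8 := by
      rw [Finset.sum_div]
      refine Finset.sum_congr rfl fun w _ => by ring
    rw [this]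
    linarith
  have h2 : ENNReal.ofReal (Real.exp (8 * N)) * (phaseLaw ν) {θ | 64 * N <
        ∑ w ∈ Vᶜ, dualWeight F N (g θ) w * ‖dualForm F (g θ) w (θ w)‖ ^ 2}
      ≤ ENNReal.ofReal (Real.exp (N / 2)) :=
    (mul_le_mul_right (measure_mono hsub) _).trans (hM.trans h)
  have h3 := ENNReal.toReal_mono ENNReal.ofReal_ne_top h2
  rw [ENNReal.toReal_mul, ENNReal.toReal_ofReal (Real.exp_pos _).le,
    ENNReal.toReal_ofReal (Real.exp_pos _).le] at h3
  change Real.exp (8 * N) * (phaseLaw ν).real _ ≤ _ at h3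
  calc _ = Real.exp (-(8 * N)) * (Real.exp (8 * N) * (phaseLaw ν).real {θ | 64 * N <
        ∑ w ∈ Vᶜ, dualWeight F N (g θ) w * ‖dualForm F (g θ) w (θ w)‖ ^ 2}) := by
        rw [← mul_assoc, ← Real.exp_add]; simp
    _ ≤ Real.exp (-(8 * N)) * Real.exp (N / 2) := by gcongr
    _ ≤ _ := by
        rw [← Real.exp_add]
        apply Real.exp_le_exp.mpr
        linarith

end Decoupling


/-! ### Code vectors, built up level by level. -/

section Chaining

variable {d K : ℕ} {F : Fin d → Fin d → ℂ}

/-- The vector with coordinate `2^{-lev w}` at the positions of level below `l`. -/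
noncomputable def codeVec (lev : Fin d → ℕ) (l : ℕ) : Fin d → ℂ :=
  fun w => if lev w < l then (((1 / 2) ^ lev w : ℝ) : ℂ) else 0

/-- The positions of level `l`. -/
def layer (lev : Fin d → ℕ) (l : ℕ) : Finset (Fin d) := Finset.univ.filter fun w => lev w = l

/-- The positions of level below `l`. -/
def below (lev : Fin d → ℕ) (l : ℕ) : Finset (Fin d) := Finset.univ.filter fun w => lev w < l

/-- The increment at level `l` of the soft-thresholded amplitudes of a code vector. -/
noncomputable def softIncr (F : Fin d → Fin d → ℂ) (r : ℝ) (lev : Fin d → ℕ) (l : ℕ)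
    (θ : Fin d → Fin K → ℝ) (k : Fin K) (m : Fin d) : ℂ :=
  soft r (amp F θ (codeVec lev (l + 1)) k m) - soft r (amp F θ (codeVec lev l) k m)

lemma codeVec_succ (lev : Fin d → ℕ) (l : ℕ) (w : Fin d) :
    codeVec lev (l + 1) w = codeVec lev l w + (((1 / 2) ^ l : ℝ) : ℂ) * ind (layer lev l) w := by
  unfold codeVec ind layer
  rcases lt_trichotomy (lev w) l with h | h | h
  · simp [h, h.ne, Nat.lt_succ_of_lt h]
  · simp [h]
  · simp [h.not_gt, h.ne', show ¬ lev w < l + 1 by omega]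

lemma card_below_succ (lev : Fin d → ℕ) (l : ℕ) :
    (below lev (l + 1)).card = (below lev l).card + (layer lev l).card := by
  unfold below layer
  rw [← Finset.card_union_of_disjoint]
  · congr 1
    ext w
    simp
    omega
  · rw [Finset.disjoint_filter]
    intro w _ h
    omega

lemma sum_norm_sq_codeVec_succ (lev : Fin d → ℕ) (l : ℕ) :
    ∑ w, ‖codeVec lev (l + 1) w‖ ^ 2
      = ∑ w, ‖codeVec lev l w‖ ^ 2 + (1 / 4) ^ l * (layer lev l).card := by
  rw [← sum_norm_sq_ind, Finset.mul_sum, ← Finset.sum_add_distrib]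
  refine Finset.sum_congr rfl fun w _ => ?_
  unfold codeVec ind layer
  rcases lt_trichotomy (lev w) l with h | h | h
  · simp [h, h.ne, Nat.lt_succ_of_lt h]
  · simp only [h, lt_add_iff_pos_right, zero_lt_one, if_true, lt_irrefl, if_false,
      Finset.mem_filter, Finset.mem_univ, true_and, norm_zero, norm_one]
    rw [Complex.norm_real, Real.norm_of_nonneg (by positivity), ← pow_mul, mul_comm l 2, pow_mul]
    norm_num
  · simp [h.not_gt, h.ne', show ¬ lev w < l + 1 by omega]

lemma sum_norm_sq_codeVec_mono (lev : Fin d → ℕ) {l l' : ℕ} (h : l ≤ l') :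
    ∑ w, ‖codeVec lev l w‖ ^ 2 ≤ ∑ w, ‖codeVec lev l' w‖ ^ 2 := by
  induction l', h using Nat.le_induction with
  | base => exact le_rfl
  | succ n _ ih =>
    rw [sum_norm_sq_codeVec_succ]
    have : (0 : ℝ) ≤ (1 / 4) ^ n * (layer lev n).card := by positivity
    linarith

/-- A position of level `j` is counted at every `i ≥ j`, and the geometric tail of `(1/4)^(i+1)`
from `j` on is `(1/4)^j / 3`. So the cost of all levels together stays bounded, with no factor for
the number of levels. -/
lemma sum_pow_mul_card_below (lev : Fin d → ℕ) (l : ℕ) :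
    ∑ i ∈ Finset.range l, (1 / 4 : ℝ) ^ (i + 1) * (below lev (i + 1)).card
      + 1 / 3 * (1 / 4) ^ l * (below lev l).card = 1 / 3 * ∑ w, ‖codeVec lev l w‖ ^ 2 := by
  induction l with
  | zero => simp [codeVec, below]
  | succ n ih =>
    rw [Finset.sum_range_succ, sum_norm_sq_codeVec_succ, card_below_succ]
    push_cast
    rw [mul_add (1 / 3), ← ih]
    ring

lemma amp_codeVec_succ (θ : Fin d → Fin K → ℝ) (lev : Fin d → ℕ) (l : ℕ) (k : Fin K)
    (m : Fin d) :
    amp F θ (codeVec lev (l + 1)) k m = amp F θ (codeVec lev l) k m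
      + (((1 / 2) ^ l : ℝ) : ℂ) * amp F θ (ind (layer lev l)) k m := by
  rw [← amp_mul, ← amp_add]
  congr 1
  ext w
  exact codeVec_succ lev l w

lemma softIncr_congr (r : ℝ) (lev : Fin d → ℕ) (l : ℕ) {θ θ' : Fin d → Fin K → ℝ}
    (h : ∀ w ∈ below lev (l + 1), θ w = θ' w) :
    softIncr F r lev l θ = softIncr F r lev l θ' := by
  have h1 : ∀ j, j ≤ l + 1 → amp F θ (codeVec lev j) = amp F θ' (codeVec lev j) := by
    intro j hj
    refine amp_congr fun w hw => h w ?_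
    have : lev w < j := by
      by_contra h'
      simp [codeVec, h'] at hw
    simp [below]
    omega
  ext k m
  unfold softIncr
  rw [h1 _ le_rfl, h1 l (Nat.le_succ l)]

lemma measurable_softIncr {r : ℝ} (hr : 0 ≤ r) (lev : Fin d → ℕ) (l : ℕ) (k : Fin K)
    (m : Fin d) : Measurable fun θ : Fin d → Fin K → ℝ => softIncr F r lev l θ k m := by
  have h := continuous_soft hr
  exact ((h.comp (continuous_amp _ k m)).sub (h.comp (continuous_amp _ k m))).measurable

/-- The energy of the layer `l` at the places where the amplitudes of the code vector exceed the
threshold. -/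
noncomputable def peakEnergy (F : Fin d → Fin d → ℂ) (r : ℝ) (lev : Fin d → ℕ) (l : ℕ)
    (θ : Fin d → Fin K → ℝ) : ℝ :=
  ∑ k, ∑ m, if r < ‖amp F θ (codeVec lev l) k m‖ ∨ r < ‖amp F θ (codeVec lev (l + 1)) k m‖
    then ‖(((1 / 2) ^ l : ℝ) : ℂ) * amp F θ (ind (layer lev l)) k m‖ ^ 2 else 0

lemma energy_softIncr_le {r : ℝ} (hr : 0 ≤ r) (lev : Fin d → ℕ) (l : ℕ)
    (θ : Fin d → Fin K → ℝ) :
    energy (softIncr F r lev l θ) ≤ peakEnergy F r lev l θ := by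
  unfold energy peakEnergy
  refine Finset.sum_le_sum fun k _ => Finset.sum_le_sum fun m _ => ?_
  split_ifs with h
  · refine pow_le_pow_left₀ (norm_nonneg _) ?_ 2
    unfold softIncr
    refine (norm_soft_sub_soft_le hr _ _).trans (le_of_eq ?_)
    rw [amp_codeVec_succ, add_sub_cancel_left]
  · push Not at h
    simp [softIncr, soft_of_le h.1, soft_of_le h.2]

/-- Split the layer's amplitude at `σ`. The part above `σ` is excess, bounded by `B`. The part below
costs `2σ²` per peak, and peaks are rare by Markov: each of the two code vectors has total energy at
most one per key. -/
lemma peakEnergy_le (hF : IsFlatUnitary F) {r σ B : ℝ} (hr : 0 < r) (hσ : 0 ≤ σ)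
    (lev : Fin d → ℕ) (l : ℕ) (θ : Fin d → Fin K → ℝ)
    (hc : ∑ w, ‖codeVec lev (l + 1) w‖ ^ 2 ≤ 1)
    (hB : excess F σ (ind (layer lev l)) θ ≤ B) :
    peakEnergy F r lev l θ ≤ (1 / 4) ^ l * (2 * B + 4 * K * σ ^ 2 / r ^ 2) := by
  have hc0 : ∑ w, ‖codeVec lev l w‖ ^ 2 ≤ 1 :=
    (sum_norm_sq_codeVec_mono lev (Nat.le_succ l)).trans hc
  have hpt : ∀ k m, (if r < ‖amp F θ (codeVec lev l) k m‖ ∨ r < ‖amp F θ (codeVec lev (l + 1)) k m‖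
      then ‖(((1 / 2) ^ l : ℝ) : ℂ) * amp F θ (ind (layer lev l)) k m‖ ^ 2 else 0)
      ≤ (1 / 4) ^ l * (2 * ‖soft σ (amp F θ (ind (layer lev l)) k m)‖ ^ 2
        + 2 * σ ^ 2 / r ^ 2 * (‖amp F θ (codeVec lev l) k m‖ ^ 2
          + ‖amp F θ (codeVec lev (l + 1)) k m‖ ^ 2)) := by
    intro k m
    split_ifs with h
    · rw [norm_mul, mul_pow, Complex.norm_real, Real.norm_of_nonneg (by positivity), ← pow_mul,
        mul_comm l 2, pow_mul, show ((1 / 2 : ℝ) ^ 2) = 1 / 4 by norm_num]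
      gcongr
      have h1 := norm_sq_le_soft hσ (amp F θ (ind (layer lev l)) k m)
      have h2 : r ^ 2 ≤ ‖amp F θ (codeVec lev l) k m‖ ^ 2
          + ‖amp F θ (codeVec lev (l + 1)) k m‖ ^ 2 := by
        rcases h with h | h
        · have := pow_le_pow_left₀ hr.le h.le 2
          linarith [sq_nonneg ‖amp F θ (codeVec lev (l + 1)) k m‖]
        · have := pow_le_pow_left₀ hr.le h.le 2
          linarith [sq_nonneg ‖amp F θ (codeVec lev l) k m‖]
      have h3 : 2 * σ ^ 2 ≤ 2 * σ ^ 2 / r ^ 2 * (‖amp F θ (codeVec lev l) k m‖ ^ 2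
          + ‖amp F θ (codeVec lev (l + 1)) k m‖ ^ 2) := by
        calc 2 * σ ^ 2 = 2 * σ ^ 2 / r ^ 2 * r ^ 2 := by field_simp
          _ ≤ _ := by gcongr
      linarith
    · positivity
  calc peakEnergy F r lev l θ ≤ ∑ k : Fin K, ∑ m, (1 / 4) ^ l *
        (2 * ‖soft σ (amp F θ (ind (layer lev l)) k m)‖ ^ 2
        + 2 * σ ^ 2 / r ^ 2 * (‖amp F θ (codeVec lev l) k m‖ ^ 2
          + ‖amp F θ (codeVec lev (l + 1)) k m‖ ^ 2)) :=
        Finset.sum_le_sum fun k _ => Finset.sum_le_sum fun m _ => hpt k m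
    _ = (1 / 4) ^ l * (2 * excess F σ (ind (layer lev l)) θ + 2 * σ ^ 2 / r ^ 2 *
          (K * (∑ w, ‖codeVec lev l w‖ ^ 2 + ∑ w, ‖codeVec lev (l + 1) w‖ ^ 2))) := by
        simp only [← Finset.mul_sum, Finset.sum_add_distrib, excess, sum_norm_sq_amp hF]
        simp only [Finset.sum_const, Finset.card_univ, Fintype.card_fin, nsmul_eq_mul]
        ring
    _ ≤ (1 / 4) ^ l * (2 * B + 2 * σ ^ 2 / r ^ 2 * (K * (1 + 1))) := by
        gcongr
    _ = _ := by ring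

/-- The pairing of two families of vectors. -/
noncomputable def pairing (g h : Fin K → Fin d → ℂ) : ℂ := ∑ k, ∑ m, star (g k m) * h k m

/-- By `norm_soft_add_le` the layer is added outside the threshold, and the square is expanded.
Where neither amplitude exceeds `r` both thresholded values vanish, so the quadratic term is paid on
the peaks only. -/
lemma excess_codeVec_succ_le {r : ℝ} (hr : 0 ≤ r) (lev : Fin d → ℕ) (l : ℕ)
    (θ : Fin d → Fin K → ℝ) :
    excess F r (codeVec lev (l + 1)) θ ≤ excess F r (codeVec lev l) θ
      + 2 * (pairing (fun k m => soft r (amp F θ (codeVec lev l) k m))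
          (fun k m => (((1 / 2) ^ l : ℝ) : ℂ) * amp F θ (ind (layer lev l)) k m)).re
      + peakEnergy F r lev l θ := by
  unfold excess pairing peakEnergy
  rw [Complex.re_sum, Finset.mul_sum, ← Finset.sum_add_distrib, ← Finset.sum_add_distrib]
  refine Finset.sum_le_sum fun k _ => ?_
  rw [Complex.re_sum, Finset.mul_sum, ← Finset.sum_add_distrib, ← Finset.sum_add_distrib]
  refine Finset.sum_le_sum fun m _ => ?_
  split_ifs with h
  · rw [amp_codeVec_succ]
    set u := amp F θ (codeVec lev l) k m
    set a := (((1 / 2) ^ l : ℝ) : ℂ) * amp F θ (ind (layer lev l)) k m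
    have h1 := pow_le_pow_left₀ (norm_nonneg _) (norm_soft_add_le hr u a) 2
    have h2 : ‖soft r u + a‖ ^ 2 = ‖soft r u‖ ^ 2 + 2 * (star (soft r u) * a).re + ‖a‖ ^ 2 := by
      simp only [Complex.sq_norm, Complex.normSq_apply, Complex.add_re, Complex.add_im,
        Complex.star_def, Complex.mul_re, Complex.conj_re, Complex.conj_im]
      ring
    linarith
  · push Not at h
    simp [soft_of_le h.1, soft_of_le h.2]

lemma pairing_sub_left (g g' h : Fin K → Fin d → ℂ) :
    pairing (fun k m => g k m - g' k m) h = pairing g h - pairing g' h := by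
  simp only [pairing, star_sub, sub_mul, Finset.sum_sub_distrib]

lemma pairing_sub_right (g h h' : Fin K → Fin d → ℂ) :
    pairing g (fun k m => h k m - h' k m) = pairing g h - pairing g h' := by
  simp only [pairing, mul_sub, Finset.sum_sub_distrib]

/-- Summation by parts for the excess energy along the levels of a code vector. -/
lemma excess_codeVec_le_sum {r : ℝ} (hr : 0 ≤ r) (lev : Fin d → ℕ) (J : ℕ)
    (θ : Fin d → Fin K → ℝ) :
    excess F r (codeVec lev J) θ ≤ ∑ i ∈ Finset.range J,
      (2 * (pairing (softIncr F r lev i θ)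
        (amp F θ (fun w => codeVec lev J w - codeVec lev (i + 1) w))).re
        + peakEnergy F r lev i θ) := by
  have hsub : ∀ l k m, amp F θ (fun w => codeVec lev J w - codeVec lev l w) k m
      = amp F θ (codeVec lev J) k m - amp F θ (codeVec lev l) k m := by
    intro l k m
    simp only [amp, sub_mul, Finset.sum_sub_distrib]
  -- The induction carries along the pairing of the current thresholded amplitudes with the whole
  -- part of the vector still to be added; this pairing is zero at `l = J`.
  have key : ∀ l, excess F r (codeVec lev l) θ
      + 2 * (pairing (fun k m => soft r (amp F θ (codeVec lev l) k m))
        (amp F θ (fun w => codeVec lev J w - codeVec lev l w))).re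
      ≤ ∑ i ∈ Finset.range l,
      (2 * (pairing (softIncr F r lev i θ)
        (amp F θ (fun w => codeVec lev J w - codeVec lev (i + 1) w))).re
        + peakEnergy F r lev i θ) := by
    intro l
    induction l with
    | zero =>
      have h0 : ∀ k m, amp F θ (codeVec lev 0) k m = 0 := by
        intro k m; simp [amp, codeVec]
      simp [excess, h0, pairing, soft]
    | succ l ih =>
      rw [Finset.sum_range_succ]
      refine le_trans ?_ (add_le_add_left ih _)
      have h1 := excess_codeVec_succ_le (F := F) hr lev l θ
      have h2 : pairing (softIncr F r lev l θ)
          (amp F θ (fun w => codeVec lev J w - codeVec lev (l + 1) w))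
          = pairing (fun k m => soft r (amp F θ (codeVec lev (l + 1)) k m))
            (amp F θ (fun w => codeVec lev J w - codeVec lev (l + 1) w))
          - pairing (fun k m => soft r (amp F θ (codeVec lev l) k m))
            (amp F θ (fun w => codeVec lev J w - codeVec lev (l + 1) w)) := by
        rw [← pairing_sub_left]
        rfl
      have h3 : pairing (fun k m => soft r (amp F θ (codeVec lev l) k m))
            (amp F θ (fun w => codeVec lev J w - codeVec lev (l + 1) w))
          = pairing (fun k m => soft r (amp F θ (codeVec lev l) k m))
            (amp F θ (fun w => codeVec lev J w - codeVec lev l w))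
          - pairing (fun k m => soft r (amp F θ (codeVec lev l) k m))
          (fun k m => (((1 / 2) ^ l : ℝ) : ℂ) * amp F θ (ind (layer lev l)) k m) := by
        rw [← pairing_sub_right]
        congr 1
        ext k m
        rw [hsub, hsub, amp_codeVec_succ]
        ring
      rw [h2, Complex.sub_re, h3, Complex.sub_re]
      linarith
  have h := key J
  have h0 : ∀ k m, amp F θ (fun w => codeVec lev J w - codeVec lev J w) k m = 0 := by
    intro k m; simp [amp]
  have h1 : pairing (fun k m => soft r (amp F θ (codeVec lev J) k m))
        (amp F θ (fun w => codeVec lev J w - codeVec lev J w)) = 0 := by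
    simp only [pairing, h0, mul_zero, Finset.sum_const_zero]
  rw [h1] at h
  simpa using h

lemma norm_codeVec_sub_sq_le (lev : Fin d → ℕ) (J l : ℕ) (w : Fin d) :
    ‖codeVec lev J w - codeVec lev l w‖ ^ 2 ≤ if l ≤ J then (1 / 4) ^ l else 1 := by
  unfold codeVec
  have hn : ∀ n : ℕ, ‖(((1 / 2) ^ n : ℝ) : ℂ)‖ ^ 2 = (1 / 4) ^ n := by
    intro n
    rw [Complex.norm_real, Real.norm_of_nonneg (by positivity), ← pow_mul, mul_comm n 2, pow_mul]
    norm_num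
  by_cases h1 : lev w < l
  · by_cases h2 : lev w < J
    · simp only [h1, h2, if_true, sub_self, norm_zero, zero_pow two_ne_zero]
      split_ifs <;> positivity
    · simp only [h1, h2, if_true, if_false, zero_sub, norm_neg, hn]
      rw [if_neg (by omega)]
      exact pow_le_one₀ (by norm_num) (by norm_num)
  · by_cases h2 : lev w < J
    · simp only [h1, h2, if_true, if_false, sub_zero, hn]
      rw [if_pos (by omega)]
      exact pow_le_pow_of_le_one (by norm_num) (by norm_num) (by omega)
    · simp only [h1, h2, if_false, sub_zero, norm_zero, zero_pow two_ne_zero]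
      split_ifs <;> positivity

/-- The two families of events, indexed by sets of positions and by codes, on which the excess
energy of code vectors is controlled. -/
structure Regular (F : Fin d → Fin d → ℂ) (r δ : ℝ) (J : ℕ) (θ : Fin d → Fin K → ℝ) : Prop where
  flat : ∀ S : Finset (Fin d), S.Nonempty →
    excess F (√(6 / δ * (S.card / d))) (ind S) θ ≤ 16 * δ * S.card * K
  decoupled : ∀ lev : Fin d → ℕ, (∀ w, lev w ≤ J) → (below lev J).Nonempty → ∀ l < J,
    ∑ w ∈ (below lev J)ᶜ,
      dualWeight F ((below lev J).card * Real.log d) (softIncr F r lev l θ) w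
        * ‖dualForm F (softIncr F r lev l θ) w (θ w)‖ ^ 2
      ≤ 64 * ((below lev J).card * Real.log d)

/-- The coordinates still to be added are at most `(1/2)^(l+1)`, so the decoupling estimate gives
`x² ≤ 64 G b` for the pairing. The arithmetic–geometric mean inequality then absorbs `G`, at most
the peak energy, additively. -/
lemma Regular.pairing_le (hF : IsFlatUnitary F) {r δ : ℝ} {J : ℕ} {θ : Fin d → Fin K → ℝ}
    (h : Regular F r δ J θ) (hr : 0 ≤ r) (hd : 2 ≤ d) (lev : Fin d → ℕ)
    (hc : ∑ w, ‖codeVec lev J w‖ ^ 2 ≤ 1) {l : ℕ} (hl : l < J) :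
    2 * (pairing (softIncr F r lev l θ)
        (amp F θ (fun w => codeVec lev J w - codeVec lev (l + 1) w))).re
      ≤ peakEnergy F r lev l θ
        + 64 * ((1 / 4) ^ (l + 1) * (below lev (l + 1)).card * Real.log d + 1) := by
  have hlog : 0 < Real.log d := Real.log_pos (by exact_mod_cast hd)
  have hE := energy_softIncr_le (F := F) hr lev l θ
  set G := energy (softIncr F r lev l θ) with hG
  set ψ : Fin d → ℂ := fun w => codeVec lev J w - codeVec lev (l + 1) w with hψ
  have hsq : ‖pairing (softIncr F r lev l θ) (amp F θ ψ)‖ ^ 2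
      ≤ 64 * G * ((1 / 4) ^ (l + 1) * ((below lev (l + 1)).card * Real.log d) + 1) := by
    by_cases hne : (below lev (l + 1)).Nonempty
    -- Moving all levels above `l` to `J` leaves the increment unchanged and makes `below lev' J`
    -- equal to `below lev (l + 1)`. The event used is thus priced by the positions used so far, not
    -- by those of the whole code.
    · set lev' : Fin d → ℕ := fun w => if lev w ≤ l then lev w else J with hlev'
      have hb : below lev' J = below lev (l + 1) := by
        ext w
        simp only [below, hlev', Finset.mem_filter, Finset.mem_univ, true_and]
        split_ifs <;> omega
      have hcv : ∀ j, j ≤ l + 1 → codeVec lev' j = codeVec lev j := by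
        intro j hj
        ext w
        simp only [codeVec, hlev']
        by_cases h1 : lev w ≤ l
        · simp [h1]
        · simp [h1, show ¬ J < j by omega, show ¬ lev w < j by omega]
      have hinc : softIncr F r lev' l θ = softIncr F r lev l θ := by
        ext k m
        unfold softIncr
        rw [hcv _ le_rfl, hcv l (Nat.le_succ l)]
      have hdec := h.decoupled lev' (fun w => by simp only [hlev']; split_ifs <;> omega)
        (by rwa [hb]) l hl
      rw [hb, hinc] at hdec
      refine norm_pairing_sq_le hF ?_ (softIncr F r lev l θ) θ (below lev (l + 1)) ψ ?_ ?_ ?_ hdec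
      · have : 0 < (below lev (l + 1)).card := hne.card_pos
        positivity
      · intro w hw
        have : lev w < l + 1 := by simpa [below] using hw
        simp only [hψ, codeVec, this, if_true, show lev w < J by omega, sub_self]
      · intro w
        have := norm_codeVec_sub_sq_le lev J (l + 1) w
        rwa [if_pos (by omega)] at this
      · refine le_trans (Finset.sum_le_sum fun w _ => ?_) hc
        simp only [hψ, codeVec]
        split_ifs <;> first | (exfalso; omega) | simp
    · have h0 : ∀ j, j ≤ l + 1 → ∀ k m, amp F θ (codeVec lev j) k m = 0 := by
        intro j hj k m
        unfold amp
        refine Finset.sum_eq_zero fun w _ => ?_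
        have : ¬ lev w < j := by
          intro h'
          exact hne ⟨w, by simp [below]; omega⟩
        simp [codeVec, this]
      have h1 : ∀ k m, softIncr F r lev l θ k m = 0 := by
        intro k m
        simp [softIncr, h0 _ le_rfl, h0 l (Nat.le_succ l)]
      have hG0 : G = 0 := by simp [hG, energy, h1]
      simp [pairing, h1, hG0]
  have hre := (Complex.abs_re_le_norm (pairing (softIncr F r lev l θ) (amp F θ ψ)))
  have hre2 := (le_abs_self _).trans hre
  set x := ‖pairing (softIncr F r lev l θ) (amp F θ ψ)‖
  set b := (1 / 4 : ℝ) ^ (l + 1) * (below lev (l + 1)).card * Real.log d + 1 with hb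
  have hb0 : 0 ≤ b := by positivity
  have hG0 : 0 ≤ G := energy_nonneg _
  have hx : x ^ 2 ≤ G * (64 * b) := by
    rw [hb]
    calc x ^ 2 ≤ _ := hsq
      _ = _ := by ring
  have h2x : 2 * x ≤ G + 64 * b := by
    refine abs_le_of_sq_le_sq' ?_ (by positivity) |>.2
    nlinarith [sq_nonneg (G - 64 * b)]
  linarith

/-- On the regular event the excess energy of every code vector is of order `δ K`. -/
lemma Regular.excess_codeVec_le (hF : IsFlatUnitary F) {r δ : ℝ} {J : ℕ}
    {θ : Fin d → Fin K → ℝ} (h : Regular F r δ J θ) (hd : 2 ≤ d) (hδ : 0 < δ) (hδ1 : δ ≤ 1)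
    (hr : 0 < r) (hr2 : r ^ 2 = 24 / (δ ^ 2 * d)) (hJ : (J : ℝ) ≤ 2 * Real.log d)
    (hK : 4 * Real.log d ≤ δ ^ 2 * K) (lev : Fin d → ℕ)
    (hc : ∑ w, ‖codeVec lev J w‖ ^ 2 ≤ 1) :
    excess F r (codeVec lev J) θ ≤ 130 * δ * K := by
  have hd' : (0 : ℝ) < d := by exact_mod_cast (by omega : 0 < d)
  have hlog : 0 < Real.log d := Real.log_pos (by exact_mod_cast hd)
  -- With `n` the size of the layer and `σ² = 6n/(δd)`, the flat bound contributes `32 δ K n` and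
  -- the term `4 K σ² / r²` contributes `δ K n`.
  have hpeak : ∀ l < J, peakEnergy F r lev l θ
      ≤ 33 * δ * K * ((1 / 4) ^ l * (layer lev l).card) := by
    intro l hl
    rcases (layer lev l).eq_empty_or_nonempty with he | hne
    · have : ∀ k m, amp F θ (ind (layer lev l)) k m = 0 := by
        intro k m; simp [amp, ind, he]
      simp only [peakEnergy, this, mul_zero, norm_zero, zero_pow two_ne_zero, ite_self,
        Finset.sum_const_zero]
      simp [he]
    · have hσ := peakEnergy_le hF hr (Real.sqrt_nonneg (6 / δ * ((layer lev l).card / d))) lev l θ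
        ((sum_norm_sq_codeVec_mono lev (by omega)).trans hc) (h.flat _ hne)
      rw [Real.sq_sqrt (by positivity), hr2] at hσ
      refine hσ.trans (le_of_eq ?_)
      field_simp
      ring
  have hsum := excess_codeVec_le_sum (F := F) hr.le lev J θ
  have hterm : ∀ i ∈ Finset.range J, (2 * (pairing (softIncr F r lev i θ)
        (amp F θ (fun w => codeVec lev J w - codeVec lev (i + 1) w))).re
        + peakEnergy F r lev i θ)
      ≤ 66 * δ * K * ((1 / 4) ^ i * (layer lev i).card)
        + (64 * Real.log d * ((1 / 4) ^ (i + 1) * (below lev (i + 1)).card) + 64) := by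
    intro i hi
    have hi' := Finset.mem_range.mp hi
    have h1 := h.pairing_le hF hr.le hd lev hc hi'
    have h2 := hpeak i hi'
    linarith
  have hlayers : ∑ i ∈ Finset.range J, ((1 / 4 : ℝ) ^ i * (layer lev i).card) ≤ 1 := by
    refine le_trans (le_of_eq ?_) hc
    clear hsum hterm hpeak hc h hJ
    induction J with
    | zero => simp [codeVec]
    | succ n ih => rw [Finset.sum_range_succ, ih, sum_norm_sq_codeVec_succ]
  have hbelow : ∑ i ∈ Finset.range J, ((1 / 4 : ℝ) ^ (i + 1) * (below lev (i + 1)).card)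
      ≤ 1 / 3 := by
    have h1 := sum_pow_mul_card_below lev J
    have h2 : (0 : ℝ) ≤ 1 / 3 * (1 / 4) ^ J * (below lev J).card := by positivity
    linarith
  have htot := hsum.trans (Finset.sum_le_sum hterm)
  rw [Finset.sum_add_distrib, Finset.sum_add_distrib, ← Finset.mul_sum, ← Finset.mul_sum,
    Finset.sum_const, Finset.card_range, nsmul_eq_mul] at htot
  -- As `J ≤ 2 log d` and `4 log d ≤ δ² K`, the terms `64 J + (64/3) log d` are below `38 δ K`; the
  -- layers give `66 δ K`.
  have hδK : δ ^ 2 * K ≤ δ * K := by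
    have : (0 : ℝ) ≤ K := Nat.cast_nonneg K
    nlinarith
  have e1 : 66 * δ * K * ∑ i ∈ Finset.range J, ((1 / 4 : ℝ) ^ i * (layer lev i).card)
      ≤ 66 * δ * K * 1 := by gcongr
  have e2 : 64 * Real.log d * ∑ i ∈ Finset.range J,
      ((1 / 4 : ℝ) ^ (i + 1) * (below lev (i + 1)).card) ≤ 64 * Real.log d * (1 / 3) := by gcongr
  linarith

end Chaining


/-! ### From code vectors to all vectors. -/

section Captured

variable {d K : ℕ} {F : Fin d → Fin d → ℂ}

/-- The energy of the amplitudes captured by a set of messages. -/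
noncomputable def captured (F : Fin d → Fin d → ℂ) (θ : Fin d → Fin K → ℝ) (T : Finset (Fin d))
    (φ : Fin d → ℂ) : ℝ :=
  ∑ k, ∑ m ∈ T, ‖amp F θ φ k m‖ ^ 2

lemma captured_nonneg (θ : Fin d → Fin K → ℝ) (T : Finset (Fin d)) (φ : Fin d → ℂ) :
    0 ≤ captured F θ T φ := by
  unfold captured; positivity

lemma captured_add_le (θ : Fin d → Fin K → ℝ) (T : Finset (Fin d)) (φ ψ : Fin d → ℂ) :
    captured F θ T (fun w => φ w + ψ w) ≤ 2 * captured F θ T φ + 2 * captured F θ T ψ := by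
  unfold captured
  simp only [Finset.mul_sum, ← Finset.sum_add_distrib]
  refine Finset.sum_le_sum fun k _ => Finset.sum_le_sum fun m _ => ?_
  rw [amp_add]
  have h := parallelogram_law_with_norm ℝ (amp F θ φ k m) (amp F θ ψ k m)
  nlinarith [mul_self_nonneg ‖amp F θ φ k m - amp F θ ψ k m‖]

lemma captured_mul (θ : Fin d → Fin K → ℝ) (T : Finset (Fin d)) (c : ℂ) (φ : Fin d → ℂ) :
    captured F θ T (fun w => c * φ w) = ‖c‖ ^ 2 * captured F θ T φ := by
  unfold captured
  simp only [Finset.mul_sum, amp_mul, norm_mul, mul_pow]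

lemma captured_le (hF : IsFlatUnitary F) (θ : Fin d → Fin K → ℝ) (T : Finset (Fin d))
    (φ : Fin d → ℂ) : captured F θ T φ ≤ K * ∑ w, ‖φ w‖ ^ 2 := by
  unfold captured
  calc ∑ k : Fin K, ∑ m ∈ T, ‖amp F θ φ k m‖ ^ 2 ≤ ∑ k : Fin K, ∑ w, ‖φ w‖ ^ 2 := by
        refine Finset.sum_le_sum fun k _ => ?_
        rw [← sum_norm_sq_amp hF θ φ k]
        exact Finset.sum_le_sum_of_subset_of_nonneg (Finset.subset_univ _)
          fun _ _ _ => by positivity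
    _ = _ := by simp

lemma captured_le_excess {r : ℝ} (hr : 0 ≤ r) (θ : Fin d → Fin K → ℝ) (T : Finset (Fin d))
    (φ : Fin d → ℂ) : captured F θ T φ ≤ 2 * excess F r φ θ + 2 * (T.card * r ^ 2) * K := by
  calc captured F θ T φ ≤ ∑ k : Fin K, ∑ m ∈ T, (2 * ‖soft r (amp F θ φ k m)‖ ^ 2 + 2 * r ^ 2) :=
        Finset.sum_le_sum fun k _ => Finset.sum_le_sum fun m _ => norm_sq_le_soft hr _
    _ = 2 * ∑ k : Fin K, ∑ m ∈ T, ‖soft r (amp F θ φ k m)‖ ^ 2 + 2 * (T.card * r ^ 2) * K := by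
        simp only [Finset.sum_add_distrib, ← Finset.mul_sum, Finset.sum_const, nsmul_eq_mul,
          Finset.card_univ, Fintype.card_fin]
        ring
    _ ≤ _ := by
        gcongr
        unfold excess
        refine Finset.sum_le_sum fun k _ => ?_
        exact Finset.sum_le_sum_of_subset_of_nonneg (Finset.subset_univ _)
          fun _ _ _ => by positivity

/-- Dyadic truncation of a nonnegative vector in the unit ball. -/
lemma exists_codeVec_add {J : ℕ} (hJ : 16 * (d : ℝ) ≤ 4 ^ (J - 1)) (hJ1 : 1 ≤ J) (x : Fin d → ℝ)
    (hx : ∀ w, 0 ≤ x w) (hx1 : ∑ w, x w ^ 2 ≤ 1) :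
    ∃ (lev : Fin d → ℕ) (y : Fin d → ℝ), (∀ w, 0 ≤ y w) ∧
      (∀ w, (x w : ℂ) = codeVec lev J w + (y w : ℂ)) ∧
      ∑ w, ‖codeVec lev J w‖ ^ 2 ≤ 1 ∧ ∑ w, y w ^ 2 ≤ 5 / 16 := by
  have hxle : ∀ w, x w ≤ 1 := by
    intro w
    have h1 : x w ^ 2 ≤ 1 :=
      (Finset.single_le_sum (f := fun w => x w ^ 2) (fun _ _ => sq_nonneg _)
        (Finset.mem_univ w)).trans hx1
    nlinarith [hx w]
  -- Take the least `l` with `(1/2)^l ≤ x w`, so that rounding down loses at most half of `x w`. If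
  -- there is none below `J`, the coordinate is dropped by giving it the level `J`.
  have hpt : ∀ w, ∃ l : ℕ, ((l < J ∧ (1 / 2 : ℝ) ^ l ≤ x w ∧ x w - (1 / 2) ^ l ≤ x w / 2) ∨
      (l = J ∧ x w ≤ (1 / 2) ^ (J - 1))) := by
    intro w
    by_cases h : ∃ l, (1 / 2 : ℝ) ^ l ≤ x w
    · classical
      have hs := Nat.find_spec h
      rcases lt_or_ge (Nat.find h) J with hl | hl
      · refine ⟨Nat.find h, Or.inl ⟨hl, hs, ?_⟩⟩
        rcases Nat.eq_zero_or_pos (Nat.find h) with h0 | h0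
        · rw [h0]
          have := hxle w
          have := hx w
          norm_num
          linarith
        · have hm := Nat.find_min h (Nat.sub_one_lt_of_lt h0)
          push Not at hm
          obtain ⟨n, hn⟩ : ∃ n, Nat.find h = n + 1 := ⟨Nat.find h - 1, by omega⟩
          rw [hn, Nat.add_sub_cancel] at hm
          rw [hn, pow_succ]
          linarith
      · refine ⟨J, Or.inr ⟨rfl, ?_⟩⟩
        have hm := Nat.find_min h (show J - 1 < Nat.find h by omega)
        push Not at hm
        exact hm.le
    · push Not at h
      exact ⟨J, Or.inr ⟨rfl, (h _).le⟩⟩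
  choose lev hlev using hpt
  set c : Fin d → ℝ := fun w => if lev w < J then (1 / 2) ^ lev w else 0 with hc
  have hcode : ∀ w, codeVec lev J w = (c w : ℂ) := by
    intro w
    simp only [codeVec, hc]
    split_ifs <;> simp
  have hc0 : ∀ w, 0 ≤ c w := by
    intro w
    simp only [hc]
    split_ifs <;> positivity
  have hcx : ∀ w, c w ≤ x w := by
    intro w
    simp only [hc]
    rcases hlev w with ⟨h1, h2, h3⟩ | ⟨h1, h2⟩
    · simpa [h1] using h2
    · simpa [h1] using hx w
  have hy : ∀ w, (x w - c w) ^ 2 ≤ x w ^ 2 / 4 + (1 / 4) ^ (J - 1) := by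
    intro w
    have h0 := hcx w
    have hp : (0 : ℝ) ≤ (1 / 4) ^ (J - 1) := by positivity
    rcases hlev w with ⟨h1, h2, h3⟩ | ⟨h1, h2⟩
    · have h4 : x w - c w ≤ x w / 2 := by simpa [hc, h1] using h3
      have := pow_le_pow_left₀ (sub_nonneg.mpr h0) h4 2
      linarith
    · have h4 : c w = 0 := by simp [hc, h1]
      rw [h4, sub_zero]
      have := pow_le_pow_left₀ (hx w) h2 2
      rw [← pow_mul, mul_comm, pow_mul] at this
      norm_num at this ⊢
      linarith [sq_nonneg (x w)]
  refine ⟨lev, fun w => x w - c w, fun w => sub_nonneg.mpr (hcx w), fun w => ?_, ?_, ?_⟩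
  · rw [hcode]; push_cast; ring
  · refine le_trans (Finset.sum_le_sum fun w _ => ?_) hx1
    rw [hcode, Complex.norm_real, Real.norm_of_nonneg (hc0 w)]
    exact pow_le_pow_left₀ (hc0 w) (hcx w) 2
  · refine (Finset.sum_le_sum fun w _ => hy w).trans ?_
    rw [Finset.sum_add_distrib, ← Finset.sum_div]
    simp only [Finset.sum_const, Finset.card_univ, Fintype.card_fin, nsmul_eq_mul]
    have h4 : (d : ℝ) * (1 / 4) ^ (J - 1) ≤ 1 / 16 := by
      rw [div_pow, one_pow, mul_one_div, div_le_iff₀ (by positivity)]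
      linarith
    linarith

/-- A bound for the captured energy of code vectors extends to nonnegative vectors. -/
lemma captured_ofReal_le (hF : IsFlatUnitary F) {θ : Fin d → Fin K → ℝ} {T : Finset (Fin d)}
    {b : ℝ} {J : ℕ} (hJ : 16 * (d : ℝ) ≤ 4 ^ (J - 1)) (hJ1 : 1 ≤ J)
    (hb : ∀ lev : Fin d → ℕ, ∑ w, ‖codeVec lev J w‖ ^ 2 ≤ 1 →
      captured F θ T (codeVec lev J) ≤ b) (x : Fin d → ℝ) (hx : ∀ w, 0 ≤ x w) :
    captured F θ T (fun w => (x w : ℂ)) ≤ 16 / 3 * b * ∑ w, x w ^ 2 := by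
  have hb0 : 0 ≤ b := (captured_nonneg _ _ _).trans (hb (fun _ => J) (by simp [codeVec]))
  -- Each truncation leaves squared norm at most `5/16`, and splitting the energy doubles it: the
  -- error contracts by `5/8`, starting from the trivial bound `K`, and `16/3 * b` is the fixed
  -- point of `c ↦ 2 * b + 5/8 * c`.
  have key : ∀ n : ℕ, ∀ x : Fin d → ℝ, (∀ w, 0 ≤ x w) →
      captured F θ T (fun w => (x w : ℂ)) ≤ (16 / 3 * b + (5 / 8) ^ n * K) * ∑ w, x w ^ 2 := by
    intro n
    induction n with
    | zero =>
      intro x hx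
      have h := captured_le hF θ T (fun w => (x w : ℂ))
      simp only [Complex.norm_real, Real.norm_eq_abs, sq_abs] at h
      refine h.trans ?_
      gcongr
      simp only [pow_zero, one_mul]
      linarith
    | succ n ih =>
      intro x hx
      set s := ∑ w, x w ^ 2 with hs
      have hs0 : 0 ≤ s := by positivity
      rcases hs0.eq_or_lt with h0 | h0
      · rw [← h0, mul_zero]
        have h := captured_le hF θ T (fun w => (x w : ℂ))
        simp only [Complex.norm_real, Real.norm_eq_abs, sq_abs, ← hs] at h
        rwa [← h0, mul_zero] at h
      · set q := √s with hq
        have hq0 : 0 < q := Real.sqrt_pos.mpr h0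
        have hq2 : q ^ 2 = s := Real.sq_sqrt hs0
        obtain ⟨lev, y, hy0, hxy, hcode, hy⟩ := exists_codeVec_add hJ hJ1 (fun w => x w / q)
          (fun w => div_nonneg (hx w) hq0.le) (by
            simp only [div_pow, ← Finset.sum_div, hq2, ← hs]
            exact (div_self h0.ne').le)
        have hxq : (fun w => (x w : ℂ)) = fun w => (q : ℂ) * (codeVec lev J w + (y w : ℂ)) := by
          ext w
          rw [← hxy w]
          push_cast
          field_simp
        rw [hxq, captured_mul, Complex.norm_real, Real.norm_of_nonneg hq0.le, hq2, mul_comm s]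
        refine mul_le_mul_of_nonneg_right ?_ hs0
        have h1 := captured_add_le (F := F) θ T (codeVec lev J) (fun w => (y w : ℂ))
        have h2 := hb lev hcode
        have h3 := (ih y hy0).trans (mul_le_mul_of_nonneg_left hy (by positivity))
        rw [pow_succ]
        linarith
  have hlim : Filter.Tendsto (fun n : ℕ => (16 / 3 * b + (5 / 8) ^ n * K) * ∑ w, x w ^ 2)
      Filter.atTop (nhds ((16 / 3 * b + 0 * K) * ∑ w, x w ^ 2)) :=
    (((tendsto_pow_atTop_nhds_zero_of_lt_one (by norm_num) (by norm_num)).mul_const _).const_add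
      _).mul_const _
  have := ge_of_tendsto' hlim fun n => key n x hx
  simpa using this

/-- Splitting into real and imaginary parts, and each into positive and negative parts, costs a
factor two each time. -/
lemma captured_le_of_codeVec (hF : IsFlatUnitary F) {θ : Fin d → Fin K → ℝ} {T : Finset (Fin d)}
    {b : ℝ} {J : ℕ} (hJ : 16 * (d : ℝ) ≤ 4 ^ (J - 1)) (hJ1 : 1 ≤ J)
    (hb : ∀ lev : Fin d → ℕ, ∑ w, ‖codeVec lev J w‖ ^ 2 ≤ 1 →
      captured F θ T (codeVec lev J) ≤ b) (φ : Fin d → ℂ) :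
    captured F θ T φ ≤ 64 / 3 * b * ∑ w, ‖φ w‖ ^ 2 := by
  have h := captured_ofReal_le hF hJ hJ1 hb
  have signed : ∀ x : Fin d → ℝ,
      captured F θ T (fun w => (x w : ℂ)) ≤ 32 / 3 * b * ∑ w, x w ^ 2 := by
    intro x
    have hx : (fun w => (x w : ℂ))
        = fun w => ((max (x w) 0 : ℝ) : ℂ) + (-1) * ((max (-x w) 0 : ℝ) : ℂ) := by
      ext w
      rcases le_total 0 (x w) with h0 | h0
      · simp [h0]
      · simp [h0]
    have hsq : ∑ w, x w ^ 2 = ∑ w, max (x w) 0 ^ 2 + ∑ w, max (-x w) 0 ^ 2 := by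
      rw [← Finset.sum_add_distrib]
      refine Finset.sum_congr rfl fun w _ => ?_
      rcases le_total 0 (x w) with h0 | h0
      · simp [h0]
      · simp [h0]
    rw [hx, hsq]
    refine (captured_add_le θ T _ _).trans ?_
    rw [captured_mul]
    have h1 := h (fun w => max (x w) 0) fun w => le_max_right _ _
    have h2 := h (fun w => max (-x w) 0) fun w => le_max_right _ _
    simp only [norm_neg, norm_one, one_pow, one_mul]
    linarith
  have hφ : φ = fun w => ((φ w).re : ℂ) + Complex.I * ((φ w).im : ℂ) := by
    ext w
    rw [mul_comm, Complex.re_add_im]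
  have hsq : ∑ w, ‖φ w‖ ^ 2 = ∑ w, (φ w).re ^ 2 + ∑ w, (φ w).im ^ 2 := by
    rw [← Finset.sum_add_distrib]
    refine Finset.sum_congr rfl fun w _ => ?_
    rw [Complex.sq_norm, Complex.normSq_apply]
    ring
  have h1 := signed fun w => (φ w).re
  have h2 := signed fun w => (φ w).im
  rw [hsq]
  conv_lhs => rw [hφ]
  refine (captured_add_le θ T _ _).trans ?_
  rw [captured_mul]
  simp only [Complex.norm_I, one_pow, one_mul]
  linarith

/-- On the regular event small sets of messages capture little energy. -/
lemma Regular.captured_le (hF : IsFlatUnitary F) {δ : ℝ} {J : ℕ}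
    {θ : Fin d → Fin K → ℝ} (h : Regular F (√(24 / (δ ^ 2 * d))) δ J θ) (hd : 2 ≤ d) (hδ : 0 < δ)
    (hδ1 : δ ≤ 1) (hJ : (J : ℝ) ≤ 2 * Real.log d) (hJ' : 16 * (d : ℝ) ≤ 4 ^ (J - 1)) (hJ1 : 1 ≤ J)
    (hK : 4 * Real.log d ≤ δ ^ 2 * K) (T : Finset (Fin d)) (hT : 24 * (T.card : ℝ) ≤ δ ^ 3 * d)
    (φ : Fin d → ℂ) : captured F θ T φ ≤ 6000 * δ * K * ∑ w, ‖φ w‖ ^ 2 := by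
  have hd' : (0 : ℝ) < d := by exact_mod_cast (by omega : 0 < d)
  have hr : 0 < √(24 / (δ ^ 2 * d)) := Real.sqrt_pos.mpr (by positivity)
  have hr2 : √(24 / (δ ^ 2 * d)) ^ 2 = 24 / (δ ^ 2 * d) := Real.sq_sqrt (by positivity)
  have hTr : T.card * √(24 / (δ ^ 2 * d)) ^ 2 ≤ δ := by
    rw [hr2, mul_div_assoc', div_le_iff₀ (by positivity)]
    linarith
  have hcode : ∀ lev : Fin d → ℕ, ∑ w, ‖codeVec lev J w‖ ^ 2 ≤ 1 →
      captured F θ T (codeVec lev J) ≤ 262 * δ * K := by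
    intro lev hc
    have h1 := h.excess_codeVec_le hF hd hδ hδ1 hr hr2 hJ hK lev hc
    have h2 := captured_le_excess (F := F) hr.le θ T (codeVec lev J)
    have h3 : T.card * √(24 / (δ ^ 2 * d)) ^ 2 * K ≤ δ * K := by gcongr
    linarith
  refine (captured_le_of_codeVec hF hJ' hJ1 hcode φ).trans ?_
  gcongr ?_ * _
  have : 0 ≤ δ * K := by positivity
  linarith

end Captured


/-! ### Union bounds over sets and codes. -/

section UnionBound

/-- A union bound over nonempty sets costs little when each element has small weight. -/
lemma one_add_pow_sub_one_le {n : ℕ} {x : ℝ} (hx : 0 ≤ x) (h : n * x ≤ 1) :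
    (1 + x) ^ n - 1 ≤ 2 * (n * x) := by
  have h0 : 0 ≤ n * x := by positivity
  have h1 : (1 + x) ^ n ≤ Real.exp (n * x) := by
    rw [Real.exp_nat_mul]
    exact pow_le_pow_left₀ (by positivity) (by linarith [Real.add_one_le_exp x]) n
  have h2 := Real.abs_exp_sub_one_sub_id_le (x := n * x) (by rwa [abs_of_nonneg h0])
  have h3 := (abs_le.mp h2).2
  nlinarith

lemma sum_nonempty_pow_card {d : ℕ} (p : ℝ) :
    ∑ S : Finset (Fin d) with S.Nonempty, p ^ S.card = (1 + p) ^ d - 1 := by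
  have h := Fintype.sum_pow_mul_eq_add_pow (Fin d) p 1
  simp only [one_pow, mul_one, Fintype.card_fin] at h
  have h2 : (Finset.univ.filter fun S : Finset (Fin d) => S.Nonempty) = Finset.univ.erase ∅ := by
    ext S
    simp [Finset.nonempty_iff_ne_empty]
  rw [add_comm, ← h, h2, ← Finset.add_sum_erase _ _ (Finset.mem_univ (∅ : Finset (Fin d)))]
  simp

/-- Expand the product: each position chooses one of `J` levels at price `p`, or the level `J` for
free. The subtracted one is the empty code. -/
lemma sum_code_pow_card {d J : ℕ} (p : ℝ) :
    ∑ lev : Fin d → Fin (J + 1) with (below (fun w => (lev w : ℕ)) J).Nonempty,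
      p ^ (below (fun w => (lev w : ℕ)) J).card = (1 + J * p) ^ d - 1 := by
  have h := Fintype.prod_sum (fun (_ : Fin d) (l : Fin (J + 1)) => if (l : ℕ) < J then p else 1)
  have h1 : ∑ l : Fin (J + 1), (if (l : ℕ) < J then p else 1) = 1 + J * p := by
    rw [Fin.sum_univ_castSucc]
    simp [add_comm]
  simp only [h1, Finset.prod_const, Finset.card_univ, Fintype.card_fin] at h
  have h2 : ∀ lev : Fin d → Fin (J + 1), ∏ w, (if ((lev w : Fin (J + 1)) : ℕ) < J then p else 1)
      = p ^ (below (fun w => (lev w : ℕ)) J).card := by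
    intro lev
    rw [Finset.prod_ite]
    simp [below]
  simp only [h2] at h
  set last : Fin d → Fin (J + 1) := fun _ => Fin.last J
  have h3 : (Finset.univ.filter fun lev : Fin d → Fin (J + 1) =>
      (below (fun w => (lev w : ℕ)) J).Nonempty) = Finset.univ.erase last := by
    ext lev
    simp only [Finset.mem_filter, Finset.mem_univ, true_and, Finset.mem_erase, and_true]
    constructor
    · rintro ⟨w, hw⟩ rfl
      simp [below, last] at hw
    · intro hne
      by_contra hemp
      apply hne
      ext w
      have hw : w ∉ below (fun w => (lev w : ℕ)) J := by
        rw [Finset.not_nonempty_iff_eq_empty.mp hemp]; simp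
      simp only [below, Finset.mem_filter, Finset.mem_univ, true_and, not_lt] at hw
      have := (lev w).is_lt
      simp only [last, Fin.val_last]
      omega
  rw [h, h3, ← Finset.add_sum_erase _ _ (Finset.mem_univ last)]
  simp [below, last]

variable {d K : ℕ} {F : Fin d → Fin d → ℂ} {ν : Fin d → Fin K → Measure ℝ}
  [∀ w k, IsProbabilityMeasure (ν w k)]

lemma real_not_regular_le_sum (hF : IsFlatUnitary F) (hν : ∀ w k, ∫ x, phase x ∂(ν w k) = 0)
    (hd : 2 ≤ d) (hK0 : 0 < K) {r δ : ℝ} (hr : 0 ≤ r) (hδ : 0 < δ) (J : ℕ) :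
    (phaseLaw ν).real {θ | ¬ Regular F r δ J θ}
      ≤ ∑ S : Finset (Fin d) with S.Nonempty, Real.exp (-(2 * δ ^ 2 * S.card * K))
        + ∑ lev : Fin d → Fin (J + 1) with (below (fun w => (lev w : ℕ)) J).Nonempty,
          J * Real.exp (-(7 * ((below (fun w => (lev w : ℕ)) J).card * Real.log d))) := by
  have hlog : 0 < Real.log d := Real.log_pos (by exact_mod_cast hd)
  have hd' : (0 : ℝ) < d := by exact_mod_cast (by omega : 0 < d)
  set E₁ : Finset (Fin d) → Set (Fin d → Fin K → ℝ) := fun S =>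
    {θ | 16 * δ * S.card * K < excess F (√(6 / δ * (S.card / d))) (ind S) θ} with hE₁
  set E₂ : (Fin d → Fin (J + 1)) → ℕ → Set (Fin d → Fin K → ℝ) := fun lev l =>
    {θ | 64 * ((below (fun w => (lev w : ℕ)) J).card * Real.log d) <
      ∑ w ∈ (below (fun w => (lev w : ℕ)) J)ᶜ,
      dualWeight F ((below (fun w => (lev w : ℕ)) J).card * Real.log d)
        (softIncr F r (fun w => (lev w : ℕ)) l θ) w
        * ‖dualForm F (softIncr F r (fun w => (lev w : ℕ)) l θ) w (θ w)‖ ^ 2} with hE₂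
  have hsub : {θ : Fin d → Fin K → ℝ | ¬ Regular F r δ J θ} ⊆
      (⋃ S ∈ Finset.univ.filter fun S : Finset (Fin d) => S.Nonempty, E₁ S) ∪
      ⋃ lev ∈ Finset.univ.filter fun lev : Fin d → Fin (J + 1) =>
        (below (fun w => (lev w : ℕ)) J).Nonempty, ⋃ l ∈ Finset.range J, E₂ lev l := by
    intro θ hθ
    by_contra hcon
    simp only [Set.mem_union, Set.mem_iUnion, Finset.mem_filter, Finset.mem_univ, true_and,
      exists_prop, not_or, not_exists, not_and, hE₁, hE₂, Set.mem_ofPred_eq, not_lt,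
      Finset.mem_range] at hcon
    refine hθ ⟨hcon.1, fun lev hlev hne l hl => ?_⟩
    exact hcon.2 (fun w => ⟨lev w, Nat.lt_succ_of_le (hlev w)⟩) hne l hl
  refine (measureReal_mono hsub).trans ((measureReal_union_le _ _).trans (add_le_add ?_ ?_))
  · refine (measureReal_biUnion_finset_le _ _).trans (Finset.sum_le_sum fun S hS => ?_)
    have hS' : S.Nonempty := by simpa using hS
    have hc : (0 : ℝ) < S.card := by exact_mod_cast hS'.card_pos
    exact excess_ind_tail hF hν hK0 hS' (Real.sqrt_pos.mpr (by positivity)) hδ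
      (Real.sq_sqrt (by positivity))
  · refine (measureReal_biUnion_finset_le _ _).trans (Finset.sum_le_sum fun lev hlev => ?_)
    refine (measureReal_biUnion_finset_le _ _).trans ?_
    refine (Finset.sum_le_card_nsmul _ _
      (Real.exp (-(7 * ((below (fun w => (lev w : ℕ)) J).card * Real.log d))))
      fun l hl => ?_).trans (le_of_eq ?_)
    · refine dualForm_tail hF hν (by positivity) _ _ (measurable_softIncr hr _ l) ?_
      intro θ θ' h
      refine softIncr_congr r _ l fun w hw => h w ?_
      have := Finset.mem_range.mp hl
      simp only [below, Finset.mem_filter, Finset.mem_univ, true_and] at hw ⊢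
      omega
    · simp

/-- The regular event fails with probability `O(1/d)`. -/
lemma real_not_regular_le (hF : IsFlatUnitary F) (hν : ∀ w k, ∫ x, phase x ∂(ν w k) = 0)
    (hd : 2 ≤ d) (hK0 : 0 < K) {r δ : ℝ} (hr : 0 ≤ r) (hδ : 0 < δ) {J : ℕ}
    (hJ : (J : ℝ) ≤ 2 * Real.log d) (hK : 4 * Real.log d ≤ δ ^ 2 * K) :
    (phaseLaw ν).real {θ | ¬ Regular F r δ J θ} ≤ 10 / d := by
  have hd' : (0 : ℝ) < d := by exact_mod_cast (by omega : 0 < d)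
  have hd2 : (2 : ℝ) ≤ d := by exact_mod_cast hd
  refine (real_not_regular_le_sum hF hν hd hK0 hr hδ J).trans ?_
  set q : ℝ := 1 / d with hq
  have hq0 : 0 < q := by positivity
  have hq1 : q ≤ 1 / 2 := by
    rw [hq]; exact one_div_le_one_div_of_le (by norm_num) hd2
  have hdq : d * q = 1 := by rw [hq]; field_simp
  have hqexp : ∀ a b : ℕ, Real.exp (-(a * (b * Real.log d))) = (q ^ a) ^ b := by
    intro a b
    rw [← pow_mul, hq, one_div, inv_pow, Real.exp_neg, ← mul_assoc, ← Nat.cast_mul,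
      Real.exp_nat_mul, Real.exp_log hd']
  have hJq : J * q ≤ 2 := by
    have h1 := Real.log_le_sub_one_of_pos hd'
    calc J * q ≤ (2 * d) * q := by gcongr; linarith
      _ = 2 := by rw [mul_assoc, hdq, mul_one]
  have hJ0 : (0 : ℝ) ≤ J * q := by positivity
  -- Since `δ² K ≥ 4 log d`, a set of size `n` fails with probability at most `d^(-8n)`.
  have s1 : ∑ S : Finset (Fin d) with S.Nonempty, Real.exp (-(2 * δ ^ 2 * S.card * K))
      ≤ 2 * q := by
    calc _ ≤ ∑ S : Finset (Fin d) with S.Nonempty, (q ^ 8) ^ S.card := by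
          refine Finset.sum_le_sum fun S _ => ?_
          rw [← hqexp]
          apply Real.exp_le_exp.mpr
          have : (0 : ℝ) ≤ S.card := Nat.cast_nonneg _
          push_cast
          nlinarith
      _ = (1 + q ^ 8) ^ d - 1 := sum_nonempty_pow_card _
      _ ≤ 2 * (d * q ^ 8) := by
          refine one_add_pow_sub_one_le (by positivity) ?_
          calc d * q ^ 8 = (d * q) * q ^ 7 := by ring
            _ ≤ 1 := by rw [hdq, one_mul]; exact pow_le_one₀ hq0.le (by linarith)
      _ = 2 * (q ^ 6 * q) := by rw [show d * q ^ 8 = (d * q) * (q ^ 6 * q) by ring, hdq, one_mul]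
      _ ≤ 2 * (1 * q) := by gcongr; exact pow_le_one₀ hq0.le (by linarith)
      _ = 2 * q := by ring
  -- The exponent 7 absorbs the positions, their levels and the factor `J` for the choice of `l`,
  -- using `J ≤ 2d`.
  have s2 : ∑ lev : Fin d → Fin (J + 1) with (below (fun w => (lev w : ℕ)) J).Nonempty,
          J * Real.exp (-(7 * ((below (fun w => (lev w : ℕ)) J).card * Real.log d)))
      ≤ 8 * q := by
    have h7 : ∀ b : ℕ, Real.exp (-(7 * (b * Real.log d))) = (q ^ 7) ^ b := by
      intro b; exact_mod_cast hqexp 7 b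
    simp only [h7]
    rw [← Finset.mul_sum, sum_code_pow_card]
    have hq6 : q ^ 5 ≤ (1 / 2) ^ 5 := pow_le_pow_left₀ hq0.le hq1 5
    calc J * ((1 + J * q ^ 7) ^ d - 1) ≤ J * (2 * (d * (J * q ^ 7))) := by
          gcongr
          refine one_add_pow_sub_one_le (by positivity) ?_
          calc d * (J * q ^ 7) = (d * q) * ((J * q) * q ^ 5) := by ring
            _ ≤ 1 * (2 * (1 / 2) ^ 5) := by rw [hdq]; gcongr
            _ ≤ 1 := by norm_num
      _ = 2 * (d * q) * ((J * q) * (J * q)) * q ^ 3 * q := by ring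
      _ ≤ 2 * 1 * (2 * 2) * 1 * q := by
          rw [hdq]
          gcongr
          exact pow_le_one₀ hq0.le (by linarith)
      _ = 8 * q := by ring
  calc _ ≤ 2 * q + 8 * q := add_le_add s1 s2
    _ = 10 / d := by rw [hq]; ring

end UnionBound

/-! ### Amplification from probability `O(1/d)` to exponentially small. -/

section Defect

variable {d K : ℕ} {F : Fin d → Fin d → ℂ}

/-- Every vector supported in `V` puts at most the fraction `b` of its energy, summed over the
keys, on each set of at most `t` messages. -/
def Tame (F : Fin d → Fin d → ℂ) (t b : ℝ) (V : Finset (Fin d)) (θ : Fin d → Fin K → ℝ) : Prop :=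
  ∀ T : Finset (Fin d), (T.card : ℝ) ≤ t → ∀ φ : Fin d → ℂ, (∀ w ∉ V, φ w = 0) →
    captured F θ T φ ≤ b * ∑ w, ‖φ w‖ ^ 2

lemma Tame.mono {t b : ℝ} {V W : Finset (Fin d)} {θ : Fin d → Fin K → ℝ} (h : Tame F t b W θ)
    (hVW : V ⊆ W) : Tame F t b V θ :=
  fun T hT φ hφ => h T hT φ fun w hw => hφ w fun h' => hw (hVW h')

lemma Tame.congr {t b : ℝ} {V : Finset (Fin d)} {θ θ' : Fin d → Fin K → ℝ} (h : Tame F t b V θ)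
    (hθ : ∀ w ∈ V, θ w = θ' w) : Tame F t b V θ' := by
  intro T hT φ hφ
  have h1 := h T hT φ hφ
  have h2 : amp F θ φ = amp F θ' φ := amp_congr fun w hw => hθ w (by
    by_contra h'
    exact hw (hφ w h'))
  unfold captured at h1 ⊢
  rwa [h2] at h1

lemma tame_empty (t b : ℝ) (θ : Fin d → Fin K → ℝ) : Tame F t b ∅ θ := by
  intro T _ φ hφ
  have : φ = 0 := by ext w; exact hφ w (by simp)
  simp [this, captured, amp]

lemma measurableSet_tame (t b : ℝ) (V : Finset (Fin d)) :
    MeasurableSet {θ : Fin d → Fin K → ℝ | Tame F t b V θ} := by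
  apply IsClosed.measurableSet
  simp only [Tame, Set.ofPred_forall]
  refine isClosed_iInter fun T => isClosed_iInter fun _ => isClosed_iInter fun φ =>
    isClosed_iInter fun _ => isClosed_le ?_ continuous_const
  unfold captured
  have := fun k m => continuous_amp (F := F) (K := K) φ k m
  fun_prop

lemma exists_tame_compl (F : Fin d → Fin d → ℂ) (t b : ℝ) (θ : Fin d → Fin K → ℝ) :
    {n : ℕ | ∃ B : Finset (Fin d), B.card = n ∧ Tame F t b Bᶜ θ}.Nonempty :=
  ⟨_, Finset.univ, rfl, by rw [Finset.compl_univ]; exact tame_empty t b θ⟩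

/-- The least number of positions to be removed to achieve tameness. -/
noncomputable def defect (F : Fin d → Fin d → ℂ) (t b : ℝ) (θ : Fin d → Fin K → ℝ) : ℕ :=
  sInf {n : ℕ | ∃ B : Finset (Fin d), B.card = n ∧ Tame F t b Bᶜ θ}

lemma exists_defect_eq_card (F : Fin d → Fin d → ℂ) (t b : ℝ) (θ : Fin d → Fin K → ℝ) :
    ∃ B : Finset (Fin d), B.card = defect F t b θ ∧ Tame F t b Bᶜ θ :=
  Nat.sInf_mem (exists_tame_compl F t b θ)

lemma defect_le {t b : ℝ} {θ : Fin d → Fin K → ℝ} {B : Finset (Fin d)} (h : Tame F t b Bᶜ θ) :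
    defect F t b θ ≤ B.card :=
  Nat.sInf_le ⟨B, rfl, h⟩

lemma defect_le_dim (t b : ℝ) (θ : Fin d → Fin K → ℝ) : defect F t b θ ≤ d := by
  obtain ⟨B, hB, -⟩ := exists_defect_eq_card F t b θ
  rw [← hB]
  simpa using Finset.card_le_univ B

/-- Enlarge an optimal removal set for `θ'` by the positions at which the configurations differ; on
the complement nothing has changed. -/
lemma defect_le_defect_add (t b : ℝ) (θ θ' : Fin d → Fin K → ℝ) :
    (defect F t b θ : ℝ) ≤ defect F t b θ' + ∑ w, if θ w ≠ θ' w then (1 : ℝ) else 0 := by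
  classical
  obtain ⟨B, hB, hT⟩ := exists_defect_eq_card F t b θ'
  set D := Finset.univ.filter fun w => θ w ≠ θ' w with hD
  have h1 : Tame F t b (B ∪ D)ᶜ θ := by
    refine (hT.mono (Finset.compl_subset_compl.mpr Finset.subset_union_left)).congr fun w hw => ?_
    simp [hD] at hw
    exact hw.2.symm
  have h2 := (defect_le h1).trans (Finset.card_union_le _ _)
  rw [hB] at h2
  have h3 : ∑ w, (if θ w ≠ θ' w then (1 : ℝ) else 0) = D.card := by
    rw [hD, Finset.sum_boole]
  rw [h3]
  exact_mod_cast h2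

lemma abs_defect_sub_le (t b : ℝ) (θ θ' : Fin d → Fin K → ℝ) :
    |(defect F t b θ : ℝ) - defect F t b θ'| ≤ ∑ w, if θ w ≠ θ' w then (1 : ℝ) else 0 := by
  rw [abs_le]
  have h1 := defect_le_defect_add (F := F) t b θ θ'
  have h2 := defect_le_defect_add (F := F) t b θ' θ
  simp only [ne_comm (a := θ' _)] at h2
  constructor <;> linarith

lemma measurable_defect (t b : ℝ) :
    Measurable fun θ : Fin d → Fin K → ℝ => defect F t b θ := by
  refine measurable_of_Iic fun n => ?_
  have : (fun θ : Fin d → Fin K → ℝ => defect F t b θ) ⁻¹' Set.Iic n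
      = ⋃ B ∈ {B : Finset (Fin d) | B.card ≤ n}, {θ | Tame F t b Bᶜ θ} := by
    ext θ
    simp only [Set.mem_preimage, Set.mem_Iic, Set.mem_iUnion, Set.mem_ofPred_eq, exists_prop]
    constructor
    · intro h
      obtain ⟨B, hB, hT⟩ := exists_defect_eq_card F t b θ
      exact ⟨B, by omega, hT⟩
    · rintro ⟨B, hB, hT⟩
      exact (defect_le hT).trans hB
  rw [this]
  exact MeasurableSet.biUnion (Set.to_countable _) fun B _ => measurableSet_tame t b _

variable {ν : Fin d → Fin K → Measure ℝ} [∀ w k, IsProbabilityMeasure (ν w k)]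

lemma integral_defect_le (t b : ℝ) :
    ∫ θ, (defect F t b θ : ℝ) ∂(phaseLaw ν)
      ≤ d * (phaseLaw ν).real {θ | ¬ Tame F t b Finset.univ θ} := by
  have hm : MeasurableSet {θ : Fin d → Fin K → ℝ | ¬ Tame F t b Finset.univ θ} :=
    (measurableSet_tame t b Finset.univ).compl
  calc ∫ θ, (defect F t b θ : ℝ) ∂(phaseLaw ν)
      ≤ ∫ θ, {θ | ¬ Tame F t b Finset.univ θ}.indicator (fun _ => (d : ℝ)) θ ∂(phaseLaw ν) := by
        refine integral_mono_of_nonneg (Filter.Eventually.of_forall fun θ => Nat.cast_nonneg _)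
          ((integrable_const _).indicator hm) (Filter.Eventually.of_forall fun θ => ?_)
        by_cases h : Tame F t b Finset.univ θ
        · have h0 : defect F t b θ = 0 := by
            have := defect_le (B := ∅) (by rwa [Finset.compl_empty])
            simpa using this
          simp [h, h0]
        · simp only [Set.indicator, Set.mem_ofPred_eq, h, not_false_eq_true, if_true]
          exact_mod_cast defect_le_dim t b θ
    _ = _ := by rw [integral_indicator_const _ hm, smul_eq_mul, mul_comm]

/-- With overwhelming probability, removing a small fraction of the positions achieves
tameness. -/
lemma defect_tail (hF : IsFlatUnitary F) (hν : ∀ w k, ∫ x, phase x ∂(ν w k) = 0)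
    (hd : 2 ≤ d) (hK0 : 0 < K) {δ : ℝ} (hδ : 0 < δ) (hδ1 : δ ≤ 1) {J : ℕ}
    (hJ : (J : ℝ) ≤ 2 * Real.log d) (hJ' : 16 * (d : ℝ) ≤ 4 ^ (J - 1)) (hJ1 : 1 ≤ J)
    (hK : 4 * Real.log d ≤ δ ^ 2 * K) (hdδ : 10 / d ≤ δ) :
    (phaseLaw ν).real {θ | 2 * δ * d ≤ defect F (δ ^ 3 * d / 24) (6000 * δ * K) θ}
      ≤ Real.exp (-(2 * δ ^ 2 * d)) := by
  have hd' : (0 : ℝ) < d := by exact_mod_cast (by omega : 0 < d)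
  -- The defect is zero on the regular event and at most `d` elsewhere, so the weak bound `10/d`
  -- already suffices for the mean.
  have hE : ∫ θ, (defect F (δ ^ 3 * d / 24) (6000 * δ * K) θ : ℝ) ∂(phaseLaw ν) ≤ δ * d := by
    refine (integral_defect_le _ _).trans ?_
    rw [mul_comm]
    gcongr
    refine (measureReal_mono ?_).trans ((real_not_regular_le (r := √(24 / (δ ^ 2 * d))) hF hν hd hK0
      (Real.sqrt_nonneg _) hδ hJ hK).trans hdδ)
    intro θ hθ hreg
    refine hθ fun T hT φ _ => hreg.captured_le hF hd hδ hδ1 hJ hJ' hJ1 hK T ?_ φ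
    linarith
  have h := (concentrates_phaseLaw_block (ν := ν)).tail (by positivity)
    (g := fun θ => (defect F (δ ^ 3 * d / 24) (6000 * δ * K) θ : ℝ))
    (measurable_from_nat.comp (measurable_defect _ _))
    ⟨d, fun θ => by
      rw [abs_of_nonneg (Nat.cast_nonneg _)]
      exact_mod_cast defect_le_dim _ _ θ⟩
    (abs_defect_sub_le _ _) (t := δ * d) (by positivity) hE
  rw [show δ * d + δ * d = 2 * δ * d by ring] at h
  refine h.trans (le_of_eq ?_)
  congr 2
  field_simp
  norm_num

end Defect


/-! ### The Fourier basis, perfect decoding and the group of phase unitaries. -/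

section Fourier

lemma ofReal_sum_norm_sq {n : Type*} [Fintype n] (v : n → ℂ) :
    ((∑ i, ‖v i‖ ^ 2 : ℝ) : ℂ) = star v ⬝ᵥ v := by
  simp only [dotProduct, Complex.ofReal_sum, Pi.star_apply, Complex.star_def, Complex.conj_mul']
  push_cast
  rfl

lemma sum_norm_sq_mulVec {n : Type*} [Fintype n] [DecidableEq n] {G : Matrix n n ℂ}
    (hG : Gᴴ * G = 1) (φ : n → ℂ) : ∑ i, ‖(G *ᵥ φ) i‖ ^ 2 = ∑ i, ‖φ i‖ ^ 2 := by
  have : ((∑ i, ‖(G *ᵥ φ) i‖ ^ 2 : ℝ) : ℂ) = ((∑ i, ‖φ i‖ ^ 2 : ℝ) : ℂ) := by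
    rw [ofReal_sum_norm_sq, ofReal_sum_norm_sq, Matrix.star_mulVec, Matrix.dotProduct_mulVec,
      Matrix.vecMul_vecMul, hG, Matrix.vecMul_one]
  exact_mod_cast this

lemma fourierVec_comm (d : ℕ) (m w : Fin d) : fourierVec d m w = fourierVec d w m := by
  unfold fourierVec
  congr 2
  ring

lemma norm_fourierVec_sq (d : ℕ) (m w : Fin d) : ‖fourierVec d m w‖ ^ 2 = 1 / d := by
  have h : 2 * Real.pi * Complex.I * (((m : ℕ) : ℂ) + 1) * (((w : ℕ) : ℂ) + 1) / (d : ℂ)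
      = ((2 * Real.pi * (m + 1) * (w + 1) / d : ℝ) : ℂ) * Complex.I := by
    push_cast; ring
  unfold fourierVec
  rw [h, norm_div, Complex.norm_exp_ofReal_mul_I, Complex.norm_real,
    Real.norm_of_nonneg (Real.sqrt_nonneg _), div_pow, one_pow, Real.sq_sqrt (Nat.cast_nonneg _)]

lemma fourierVec_eq_pow (d : ℕ) (m w : Fin d) :
    fourierVec d m w
      = (Complex.exp (2 * Real.pi * Complex.I / d) ^ ((w : ℕ) + 1)) ^ ((m : ℕ) + 1)
        / (Real.sqrt d : ℂ) := by
  unfold fourierVec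
  rw [← pow_mul, ← Complex.exp_nat_mul]
  congr 2
  push_cast
  ring

lemma sum_star_fourierVec_mul (d : ℕ) (w w' : Fin d) :
    ∑ m, star (fourierVec d m w) * fourierVec d m w' = if w = w' then 1 else 0 := by
  have hd : d ≠ 0 := (Fin.pos w).ne'
  split_ifs with h
  · subst h
    have : ∀ m, star (fourierVec d m w) * fourierVec d m w = 1 / d := by
      intro m
      rw [Complex.star_def, Complex.conj_mul', ← Complex.ofReal_pow, norm_fourierVec_sq]
      simp
    simp only [this, Finset.sum_const, Finset.card_univ, Fintype.card_fin, nsmul_eq_mul]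
    field_simp
  -- Off the diagonal the sum is geometric, its ratio `z` a nontrivial `d`-th root of unity; the
  -- shift of the labels by one only contributes a constant factor.
  · set ζ := Complex.exp (2 * Real.pi * Complex.I / d) with hζ
    have hprim : IsPrimitiveRoot ζ d := Complex.isPrimitiveRoot_exp d hd
    have hnorm : ‖ζ‖ = 1 := hprim.norm'_eq_one hd
    have hζ0 : ζ ≠ 0 := hprim.ne_zero hd
    set z := star (ζ ^ ((w : ℕ) + 1)) * ζ ^ ((w' : ℕ) + 1) with hz
    have hstar : star (ζ ^ ((w : ℕ) + 1)) * ζ ^ ((w : ℕ) + 1) = 1 := by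
      rw [Complex.star_def, Complex.conj_mul', norm_pow, hnorm]
      simp
    have hz1 : z ≠ 1 := by
      intro h1
      have h2 : star (ζ ^ ((w : ℕ) + 1)) ≠ 0 := left_ne_zero_of_mul_eq_one hstar
      have h3 : ζ ^ ((w' : ℕ) + 1) = ζ ^ ((w : ℕ) + 1) := mul_left_cancel₀ h2 (h1.trans hstar.symm)
      rw [pow_succ, pow_succ] at h3
      have h4 := hprim.pow_inj w'.is_lt w.is_lt (mul_right_cancel₀ hζ0 h3)
      exact h (Fin.ext h4.symm)
    have hzd : z ^ d = 1 := by
      rw [hz, mul_pow, ← star_pow, ← pow_mul, ← pow_mul, mul_comm _ d, mul_comm _ d, pow_mul,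
        pow_mul, hprim.pow_eq_one]
      simp
    have hterm : ∀ m : Fin d, star (fourierVec d m w) * fourierVec d m w'
        = z / d * z ^ (m : ℕ) := by
      intro m
      rw [fourierVec_eq_pow, fourierVec_eq_pow, ← hζ, star_div₀, div_mul_div_comm]
      have hs : star (Real.sqrt d : ℂ) * (Real.sqrt d : ℂ) = d := by
        rw [Complex.star_def, Complex.conj_ofReal, ← Complex.ofReal_mul,
          Real.mul_self_sqrt (Nat.cast_nonneg _)]
        simp
      rw [hs, star_pow, ← mul_pow, ← hz, pow_succ]
      ring
    have hsum : ∑ m : Fin d, z ^ (m : ℕ) = 0 := by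
      rw [Fin.sum_univ_eq_sum_range (fun i => z ^ i) d]
      have := geom_sum_mul z d
      rw [hzd, sub_self] at this
      exact (mul_eq_zero.mp this).resolve_right (sub_ne_zero.mpr hz1)
    simp only [hterm, ← Finset.mul_sum, hsum, mul_zero]

lemma isFlatUnitary_fourierVec (d : ℕ) : IsFlatUnitary (fourierVec d) := by
  have hG : (Matrix.of (fourierVec d))ᴴ * Matrix.of (fourierVec d) = 1 := by
    ext w w'
    simp only [Matrix.mul_apply, Matrix.conjTranspose_apply, Matrix.of_apply, Matrix.one_apply]
    exact sum_star_fourierVec_mul d w w'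
  have h : ∀ φ : Fin d → ℂ, ∑ m, ‖∑ w, φ w * fourierVec d m w‖ ^ 2 = ∑ w, ‖φ w‖ ^ 2 := by
    intro φ
    rw [← sum_norm_sq_mulVec hG φ]
    simp only [Matrix.mulVec, dotProduct, Matrix.of_apply, mul_comm]
  refine ⟨h, fun g => ?_, norm_fourierVec_sq d⟩
  rw [← h g]
  simp only [fourierVec_comm]

lemma codeword_apply {d : ℕ} (t : Fin d → ℝ) (m w : Fin d) :
    codeword t m w = phase (t w) * fourierVec d m w := by
  unfold codeword phaseUnitary phase
  rw [Matrix.mulVec_diagonal]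

lemma sum_norm_sq_codeword {d : ℕ} (t : Fin d → ℝ) (m : Fin d) :
    ∑ w, ‖codeword t m w‖ ^ 2 = 1 := by
  have hd : (d : ℝ) ≠ 0 := by exact_mod_cast (Fin.pos m).ne'
  simp only [codeword_apply, norm_mul, norm_phase, one_mul, norm_fourierVec_sq, Finset.sum_const,
    Finset.card_univ, Fintype.card_fin, nsmul_eq_mul]
  field_simp

lemma trace_ketbra_mul {n : Type*} [Fintype n] (v : n → ℂ) (M : Matrix n n ℂ) :
    Matrix.trace (ketbra v * M) = star v ⬝ᵥ (M *ᵥ v) := by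
  rw [ketbra, Matrix.vecMulVec_mul, Matrix.trace_vecMulVec, dotProduct_comm,
    ← Matrix.dotProduct_mulVec]

lemma trace_ketbra_mul_conjTranspose_mul {n l : Type*} [Fintype n] [Fintype l] (v : n → ℂ)
    (Z : Matrix l n ℂ) :
    Matrix.trace (ketbra v * (Zᴴ * Z)) = ((∑ i, ‖(Z *ᵥ v) i‖ ^ 2 : ℝ) : ℂ) := by
  rw [trace_ketbra_mul, ofReal_sum_norm_sq, Matrix.star_mulVec, ← Matrix.dotProduct_mulVec,
    Matrix.mulVec_mulVec]

lemma posSemidef_ketbra {n : Type*} [Fintype n] (v : n → ℂ) : (ketbra v).PosSemidef :=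
  Matrix.posSemidef_vecMulVec_self_star v

/-- The codewords of a single key form an orthonormal basis. -/
lemma sum_ketbra_codeword {d : ℕ} (t : Fin d → ℝ) : ∑ m, ketbra (codeword t m) = 1 := by
  ext w w'
  rw [Matrix.sum_apply]
  simp only [ketbra, Matrix.vecMulVec_apply, Pi.star_apply, codeword_apply, star_mul]
  have h : ∀ m, phase (t w) * fourierVec d m w * (star (fourierVec d m w') * star (phase (t w')))
      = phase (t w) * star (phase (t w')) * (star (fourierVec d m w') * fourierVec d m w) := by
    intro m; ring
  simp only [h, ← Finset.mul_sum, sum_star_fourierVec_mul, Matrix.one_apply]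
  rcases eq_or_ne w w' with rfl | hne
  · simp only [if_true, mul_one]
    rw [Complex.star_def, Complex.mul_conj', norm_phase]
    simp
  · simp [hne, hne.symm]

lemma exists_perfect_decoder {d : ℕ} (hd : 1 ≤ d) (t : Fin d → ℝ) :
    ∃ Λ : POVM (Fin d) (Fin d), successProb t Λ = 1 := by
  refine ⟨⟨fun m => ketbra (codeword t m), fun m => posSemidef_ketbra _, sum_ketbra_codeword t⟩, ?_⟩
  have h : ∀ m, (Matrix.trace (ketbra (codeword t m) * ketbra (codeword t m))).re = 1 := by
    intro m
    rw [trace_ketbra_mul, ketbra, Matrix.vecMulVec_mulVec, ← ofReal_sum_norm_sq,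
      sum_norm_sq_codeword]
    simp only [Complex.ofReal_one, MulOpposite.op_one, one_smul]
    rw [← ofReal_sum_norm_sq, sum_norm_sq_codeword]
    simp
  have hd' : (d : ℝ) ≠ 0 := by exact_mod_cast (by omega : d ≠ 0)
  simp only [successProb, h, Finset.sum_const, Finset.card_univ, Fintype.card_fin, nsmul_eq_mul,
    mul_one]
  field_simp

lemma phaseUnitary_mul {d : ℕ} (s t : Fin d → ℝ) :
    phaseUnitary s * phaseUnitary t = phaseUnitary (s + t) := by
  unfold phaseUnitary
  rw [Matrix.diagonal_mul_diagonal]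
  congr 1
  ext w
  rw [← Complex.exp_add]
  congr 1
  simp only [Pi.add_apply]
  push_cast
  ring

lemma phaseUnitary_zero (d : ℕ) : phaseUnitary (0 : Fin d → ℝ) = 1 := by
  simp [phaseUnitary]

lemma star_phaseUnitary {d : ℕ} (t : Fin d → ℝ) : star (phaseUnitary t) = phaseUnitary (-t) := by
  unfold phaseUnitary
  rw [Matrix.star_eq_conjTranspose, Matrix.diagonal_conjTranspose]
  congr 1
  ext w
  simp only [Pi.star_apply, Complex.star_def, ← Complex.exp_conj, map_mul, Complex.conj_I,
    Complex.conj_ofReal, Pi.neg_apply]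
  push_cast
  ring_nf

lemma phaseUnitary_mem {d : ℕ} (t : Fin d → ℝ) :
    phaseUnitary t ∈ Matrix.unitaryGroup (Fin d) ℂ := by
  rw [Matrix.mem_unitaryGroup_iff, star_phaseUnitary, phaseUnitary_mul, add_neg_cancel,
    phaseUnitary_zero]

/-- The group of phase unitaries. -/
def phaseGroup (d : ℕ) : Subgroup (Matrix.unitaryGroup (Fin d) ℂ) where
  carrier := {V | ∃ t : Fin d → ℝ, (V : Matrix (Fin d) (Fin d) ℂ) = phaseUnitary t}
  mul_mem' := by
    rintro V W ⟨s, hs⟩ ⟨t, ht⟩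
    exact ⟨s + t, by rw [Submonoid.coe_mul, hs, ht, phaseUnitary_mul]⟩
  one_mem' := ⟨0, by rw [phaseUnitary_zero]; rfl⟩
  inv_mem' := by
    rintro V ⟨t, ht⟩
    exact ⟨-t, by rw [← star_phaseUnitary, ← ht]; rfl⟩

lemma mem_phaseGroup {d : ℕ} {V : Matrix.unitaryGroup (Fin d) ℂ} :
    V ∈ phaseGroup d ↔ ∃ t : Fin d → ℝ, (V : Matrix (Fin d) (Fin d) ℂ) = phaseUnitary t :=
  Iff.rfl

lemma exists_phaseGroup (d : ℕ) : ∃ H : Subgroup (Matrix.unitaryGroup (Fin d) ℂ),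
    (∀ U : Matrix (Fin d) (Fin d) ℂ, (∃ V ∈ H, (V : Matrix (Fin d) (Fin d) ℂ) = U) ↔
      ∃ t : Fin d → ℝ, U = phaseUnitary t) ∧ ∀ V ∈ H, ∀ W ∈ H, V * W = W * V := by
  refine ⟨phaseGroup d, fun U => ⟨?_, ?_⟩, ?_⟩
  · rintro ⟨V, ⟨t, ht⟩, rfl⟩
    exact ⟨t, ht⟩
  · rintro ⟨t, rfl⟩
    exact ⟨⟨phaseUnitary t, phaseUnitary_mem t⟩, ⟨t, rfl⟩, rfl⟩
  · intro V hV W hW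
    obtain ⟨s, hs⟩ := mem_phaseGroup.mp hV
    obtain ⟨t, ht⟩ := mem_phaseGroup.mp hW
    apply Subtype.ext
    rw [Submonoid.coe_mul, Submonoid.coe_mul, hs, ht, phaseUnitary_mul, phaseUnitary_mul, add_comm]

end Fourier


/-! ### Bounds on mutual information. -/

section Information

lemma shannonEntropy_mul_log_two {X : Type*} [Fintype X] (p : X → ℝ) :
    shannonEntropy p * Real.log 2 = ∑ x, -(p x * Real.log (p x)) := by
  have h2 : Real.log 2 ≠ 0 := (Real.log_pos one_lt_two).ne'
  unfold shannonEntropy Real.logb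
  rw [Finset.sum_mul]
  refine Finset.sum_congr rfl fun x _ => ?_
  field_simp

/-- The log-sum inequality, in the form needed to compare a mixture with its components. -/
lemma mul_log_mixture_le {ι : Type*} [Fintype ι] (a q : ι → ℝ) (ha : ∀ i, 0 ≤ a i)
    (hq : ∀ i, 0 ≤ q i) {s p r : ℝ} (hp : p = ∑ i, a i * q i) (hs : s = ∑ i, a i) (hr : 0 ≤ r)
    (hqr : r = 0 → ∀ i, q i = 0) :
    p * (Real.log p - Real.log s - Real.log r) ≤ ∑ i, a i * (q i * Real.log (q i / r)) := by
  have hp0 : 0 ≤ p := by rw [hp]; exact Finset.sum_nonneg fun i _ => mul_nonneg (ha i) (hq i)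
  have hs0 : 0 ≤ s := by rw [hs]; exact Finset.sum_nonneg fun i _ => ha i
  rcases hp0.eq_or_lt with h0 | h0
  · have hz : ∀ i, a i * q i = 0 := by
      intro i
      refine (Finset.sum_eq_zero_iff_of_nonneg fun i _ => mul_nonneg (ha i) (hq i)).mp
        (hp.symm.trans h0.symm) i (Finset.mem_univ i)
    rw [← h0, zero_mul]
    refine (Finset.sum_eq_zero fun i _ => ?_).ge
    rw [← mul_assoc, hz, zero_mul]
  · have hs1 : 0 < s := by
      refine hs0.lt_of_ne fun h => h0.ne' ?_
      have hz : ∀ i, a i = 0 := fun i => (Finset.sum_eq_zero_iff_of_nonneg fun i _ => ha i).mp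
        (hs.symm.trans h.symm) i (Finset.mem_univ i)
      simp [hp, hz]
    have hr1 : 0 < r := by
      refine hr.lt_of_ne fun h => h0.ne' ?_
      simp [hp, hqr h.symm]
    -- This is `1 - 1/x ≤ log x` at `x = q i * s / p`; the corrections `a i * q i - a i * (p / s)`
    -- sum to zero.
    have hterm : ∀ i, a i * q i * (Real.log p - Real.log s - Real.log r) + (a i * q i - a i * (p / s))
        ≤ a i * (q i * Real.log (q i / r)) := by
      intro i
      rcases (hq i).eq_or_lt with hi | hi
      · rw [← hi]
        have : 0 ≤ a i * (p / s) := mul_nonneg (ha i) (by positivity)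
        simp only [mul_zero, zero_mul, zero_sub]
        linarith
      · have h1 := Real.one_sub_inv_le_log_of_pos (x := q i * s / p) (by positivity)
        rw [Real.log_div (by positivity) h0.ne', Real.log_mul hi.ne' hs1.ne'] at h1
        rw [Real.log_div hi.ne' hr1.ne']
        have h2 : q i * (1 - (q i * s / p)⁻¹) = q i - p / s := by field_simp
        have h3 := mul_le_mul_of_nonneg_left h1 hi.le
        rw [h2] at h3
        have h4 := mul_le_mul_of_nonneg_left h3 (ha i)
        linarith
    have hsum := Finset.sum_le_sum fun i (_ : i ∈ Finset.univ) => hterm i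
    rw [Finset.sum_add_distrib, ← Finset.sum_mul, Finset.sum_sub_distrib, ← Finset.sum_mul, ← hp,
      ← hs, mul_div_cancel₀ _ hs1.ne', sub_self, add_zero] at hsum
    exact hsum

/-- Processing of a uniform message does not increase the mutual information. -/
lemma mutualInfo_mixture_le {d : ℕ} (hd : 1 ≤ d) {X Y : Type*} [Fintype X] [Fintype Y]
    (a : X → Fin d → ℝ) (q : Fin d → Y → ℝ) (ha : ∀ x m, 0 ≤ a x m) (hq : ∀ m y, 0 ≤ q m y)
    (ha1 : ∀ m, ∑ x, a x m = 1) (hq1 : ∀ m, ∑ y, q m y = 1) :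
    mutualInfo (fun z : X × Y => 1 / d * ∑ m, a z.1 m * q m z.2) * Real.log 2
      ≤ 1 / d * ∑ y, ∑ m, q m y * Real.log (q m y / (1 / d * ∑ m, q m y)) := by
  have hd' : (0 : ℝ) < d := by exact_mod_cast (by omega : 0 < d)
  set p : X × Y → ℝ := fun z => 1 / d * ∑ m, a z.1 m * q m z.2 with hp
  set s : X → ℝ := fun x => 1 / d * ∑ m, a x m with hs
  set r : Y → ℝ := fun y => 1 / d * ∑ m, q m y with hr
  have hsx : ∀ x, ∑ y, p (x, y) = s x := by
    intro x
    simp only [hp, hs, ← Finset.mul_sum]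
    rw [Finset.sum_comm]
    simp only [← Finset.mul_sum, hq1, mul_one]
  have hry : ∀ y, ∑ x, p (x, y) = r y := by
    intro y
    simp only [hp, hr, ← Finset.mul_sum]
    rw [Finset.sum_comm]
    simp only [← Finset.sum_mul, ha1, one_mul]
  have hI : mutualInfo p * Real.log 2
      = ∑ y, ∑ x, p (x, y) * (Real.log (p (x, y)) - Real.log (s x) - Real.log (r y)) := by
    unfold mutualInfo
    rw [sub_mul, add_mul, shannonEntropy_mul_log_two, shannonEntropy_mul_log_two,
      shannonEntropy_mul_log_two, Fintype.sum_prod_type_right]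
    have e1 : ∑ x, -((∑ y, p (x, y)) * Real.log (∑ y, p (x, y)))
        = ∑ y, ∑ x, -(p (x, y) * Real.log (s x)) := by
      rw [Finset.sum_comm]
      refine Finset.sum_congr rfl fun x _ => ?_
      rw [Finset.sum_neg_distrib, ← Finset.sum_mul, hsx]
    have e2 : ∑ y, -((∑ x, p (x, y)) * Real.log (∑ x, p (x, y)))
        = ∑ y, ∑ x, -(p (x, y) * Real.log (r y)) := by
      refine Finset.sum_congr rfl fun y _ => ?_
      rw [Finset.sum_neg_distrib, ← Finset.sum_mul, hry]
    rw [e1, e2, ← Finset.sum_add_distrib, ← Finset.sum_sub_distrib]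
    refine Finset.sum_congr rfl fun y _ => ?_
    rw [← Finset.sum_add_distrib, ← Finset.sum_sub_distrib]
    refine Finset.sum_congr rfl fun x _ => ?_
    ring
  rw [hI, Finset.mul_sum]
  refine Finset.sum_le_sum fun y _ => ?_
  have hr0 : 0 ≤ r y := mul_nonneg (by positivity) (Finset.sum_nonneg fun m _ => hq m y)
  have hqr : r y = 0 → ∀ m, q m y = 0 := by
    intro h m
    have h1 : ∑ m, q m y = 0 := by
      rcases mul_eq_zero.mp h with h | h
      · exact absurd h (by positivity)
      · exact h
    exact (Finset.sum_eq_zero_iff_of_nonneg fun m _ => hq m y).mp h1 m (Finset.mem_univ m)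
  calc ∑ x, p (x, y) * (Real.log (p (x, y)) - Real.log (s x) - Real.log (r y))
      ≤ ∑ x, ∑ m, (1 / d * a x m) * (q m y * Real.log (q m y / r y)) := by
        refine Finset.sum_le_sum fun x _ => ?_
        refine mul_log_mixture_le (fun m => 1 / d * a x m) (fun m => q m y)
          (fun m => mul_nonneg (by positivity) (ha x m)) (fun m => hq m y) ?_ ?_ hr0 hqr
        · simp only [hp, Finset.mul_sum, mul_assoc]
        · simp only [hs, Finset.mul_sum]
    _ = 1 / d * ∑ m, q m y * Real.log (q m y / r y) := by
        rw [Finset.sum_comm, Finset.mul_sum]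
        refine Finset.sum_congr rfl fun m _ => ?_
        rw [← Finset.sum_mul, ← Finset.mul_sum, ha1, mul_one]

/-- A distribution which puts little weight on small sets has small relative entropy with respect
to the uniform distribution. -/
lemma sum_mul_log_le {d : ℕ} (hd : 1 ≤ d) {t β τ : ℝ} (ht : 0 < t) (htd : t ≤ d) (q : Fin d → ℝ)
    (hq : ∀ m, 0 ≤ q m) (hτ : ∑ m, q m = τ)
    (hβ : ∀ T : Finset (Fin d), (T.card : ℝ) ≤ t → ∑ m ∈ T, q m ≤ β) :
    ∑ m, q m * Real.log (q m / (1 / d * τ)) ≤ β * Real.log d + τ * Real.log (d / t) := by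
  have hd' : (0 : ℝ) < d := by exact_mod_cast (by omega : 0 < d)
  have hlogd : 0 ≤ Real.log d := Real.log_nonneg (by exact_mod_cast hd)
  have hlogt : 0 ≤ Real.log (d / t) := Real.log_nonneg (by rwa [one_le_div ht])
  have hτ0 : 0 ≤ τ := by rw [← hτ]; exact Finset.sum_nonneg fun m _ => hq m
  have hβ0 : 0 ≤ β := by simpa using hβ ∅ (by simpa using ht.le)
  rcases hτ0.eq_or_lt with h0 | h0
  · have hz : ∀ m, q m = 0 := fun m => (Finset.sum_eq_zero_iff_of_nonneg fun m _ => hq m).mp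
      (hτ.trans h0.symm) m (Finset.mem_univ m)
    simp only [hz, zero_mul, Finset.sum_const_zero]
    positivity
  -- By Markov at most `t` messages are this heavy. The ratio inside the logarithm is at most `d` on
  -- them and at most `d / t` elsewhere.
  set T := Finset.univ.filter fun m => τ / t < q m with hT
  have hTt : (T.card : ℝ) ≤ t := by
    have h1 : T.card • (τ / t) ≤ ∑ m ∈ T, q m :=
      Finset.card_nsmul_le_sum _ _ _ fun m hm => (Finset.mem_filter.mp hm).2.le
    have h2 : ∑ m ∈ T, q m ≤ τ := by
      rw [← hτ]
      exact Finset.sum_le_sum_of_subset_of_nonneg (Finset.subset_univ _) fun m _ _ => hq m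
    have h3 := h1.trans h2
    rw [nsmul_eq_mul, mul_div_assoc', div_le_iff₀ ht] at h3
    nlinarith
  have hterm : ∀ m, q m * Real.log (q m / (1 / d * τ))
      ≤ (if m ∈ T then q m else 0) * Real.log d + q m * Real.log (d / t) := by
    intro m
    rcases (hq m).eq_or_lt with hm | hm
    · simp [← hm]
    · have hpos : 0 < q m / (1 / d * τ) := by positivity
      split_ifs with hmT
      · have h1 : q m / (1 / d * τ) ≤ d := by
          have : q m ≤ τ := by
            rw [← hτ]
            exact Finset.single_le_sum (f := q) (fun m _ => hq m) (Finset.mem_univ m)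
          rw [div_le_iff₀ (by positivity)]
          calc q m ≤ τ := this
            _ = _ := by field_simp
        have h2 := mul_le_mul_of_nonneg_left (Real.log_le_log hpos h1) hm.le
        have h3 : 0 ≤ q m * Real.log (d / t) := by positivity
        linarith
      · have h0 : q m ≤ τ / t := by simpa [hT] using hmT
        have h1 : q m / (1 / d * τ) ≤ d / t := by
          rw [div_le_iff₀ (by positivity)]
          calc q m ≤ τ / t := h0
            _ = _ := by field_simp
        have h2 := mul_le_mul_of_nonneg_left (Real.log_le_log hpos h1) hm.le
        linarith
  refine (Finset.sum_le_sum fun m _ => hterm m).trans ?_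
  rw [Finset.sum_add_distrib, ← Finset.sum_mul, ← Finset.sum_mul, hτ, Finset.sum_ite_mem,
    Finset.univ_inter]
  gcongr
  exact hβ T hTt

end Information


/-! ### From Eve's measurement to captured energy. -/

section Eavesdropping

lemma POVM.exists_factor {n ι : Type*} [Fintype n] [DecidableEq n] [Fintype ι] (N : POVM n ι) :
    ∃ Z : ι → Matrix n n ℂ, ∀ i, N.effect i = (Z i)ᴴ * Z i := by
  have h : ∀ i, ∃ Z : Matrix n n ℂ, N.effect i = Zᴴ * Z := by
    open scoped MatrixOrder Matrix.Norms.L2Operator in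
    intro i
    exact CStarAlgebra.nonneg_iff_eq_star_mul_self.mp (N.posSemidef i).nonneg
  choose Z hZ using h
  exact ⟨Z, hZ⟩

lemma POVM.sum_norm_sq_mulVec {n ι : Type*} [Fintype n] [DecidableEq n] [Fintype ι]
    (N : POVM n ι) {Z : ι → Matrix n n ℂ} (hZ : ∀ i, N.effect i = (Z i)ᴴ * Z i) (v : n → ℂ) :
    ∑ i, ∑ j, ‖(Z i *ᵥ v) j‖ ^ 2 = ∑ w, ‖v w‖ ^ 2 := by
  have h : ((∑ i, ∑ j, ‖(Z i *ᵥ v) j‖ ^ 2 : ℝ) : ℂ) = ((∑ w, ‖v w‖ ^ 2 : ℝ) : ℂ) := by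
    rw [Complex.ofReal_sum]
    simp only [← trace_ketbra_mul_conjTranspose_mul, ← hZ]
    rw [← Matrix.trace_sum, ← Finset.mul_sum, N.sum_effect, mul_one, ofReal_sum_norm_sq, ketbra,
      Matrix.trace_vecMulVec, dotProduct_comm]
  exact_mod_cast h

lemma POVM.sum_norm_sq_column {n ι : Type*} [Fintype n] [DecidableEq n] [Fintype ι]
    (N : POVM n ι) {Z : ι → Matrix n n ℂ} (hZ : ∀ i, N.effect i = (Z i)ᴴ * Z i) (w : n) :
    ∑ i, ∑ j, ‖Z i j w‖ ^ 2 = 1 := by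
  have h := N.sum_norm_sq_mulVec hZ (Pi.single w 1)
  simp only [Matrix.mulVec_single_one, Matrix.col_apply] at h
  rw [h, Finset.sum_eq_single w]
  · simp
  · intro b _ hb; simp [hb]
  · simp

variable {d K : ℕ}

lemma mulVec_codeword (θ : Fin K → Fin d → ℝ) (Z : Matrix (Fin d) (Fin d) ℂ) (k : Fin K)
    (m j : Fin d) :
    (Z *ᵥ codeword (θ k) m) j = amp (fourierVec d) (fun w k => θ k w) (Z j) k m := by
  simp only [Matrix.mulVec, dotProduct, codeword_apply, amp, mul_assoc]

lemma jointProb_rhoAE {X Y : Type*} [Fintype X] [Fintype Y] (θ : Fin K → Fin d → ℝ)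
    (M : POVM (Fin d) X) (N : POVM (Fin d) Y) {A : X → Matrix (Fin d) (Fin d) ℂ}
    {Z : Y → Matrix (Fin d) (Fin d) ℂ} (hA : ∀ x, M.effect x = (A x)ᴴ * A x)
    (hZ : ∀ y, N.effect y = (Z y)ᴴ * Z y) :
    jointProb (rhoAE θ) M N = fun z => 1 / d * ∑ m, (∑ j, ‖A z.1 j m‖ ^ 2) *
      (1 / K * ∑ k, ∑ j, ‖amp (fourierVec d) (fun w k => θ k w) (Z z.2 j) k m‖ ^ 2) := by
  ext z
  unfold jointProb rhoAE
  have h1 : ∀ m, Matrix.trace (ketbra (Pi.single m (1 : ℂ)) * ((A z.1)ᴴ * A z.1))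
      = ((∑ j, ‖A z.1 j m‖ ^ 2 : ℝ) : ℂ) := by
    intro m
    rw [trace_ketbra_mul_conjTranspose_mul]
    simp only [Matrix.mulVec_single_one, Matrix.col_apply]
  have h2 : ∀ k m, Matrix.trace (ketbra (codeword (θ k) m) * ((Z z.2)ᴴ * Z z.2))
      = ((∑ j, ‖amp (fourierVec d) (fun w k => θ k w) (Z z.2 j) k m‖ ^ 2 : ℝ) : ℂ) := by
    intro k m
    rw [trace_ketbra_mul_conjTranspose_mul]
    simp only [mulVec_codeword]
  have h3 : ∀ m, Matrix.trace (((1 / (K : ℂ)) • ∑ k, ketbra (codeword (θ k) m)) *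
      ((Z z.2)ᴴ * Z z.2)) = ((1 / K * ∑ k, ∑ j,
        ‖amp (fourierVec d) (fun w k => θ k w) (Z z.2 j) k m‖ ^ 2 : ℝ) : ℂ) := by
    intro m
    rw [Matrix.smul_mul, Matrix.trace_smul, Finset.sum_mul, Matrix.trace_sum]
    simp only [h2, smul_eq_mul]
    push_cast
    rfl
  rw [hA, hZ, Matrix.smul_mul, Matrix.trace_smul, Finset.sum_mul, Matrix.trace_sum]
  simp only [← Matrix.mul_kronecker_mul, Matrix.trace_kronecker, h1, h3, smul_eq_mul]
  simp only [← Complex.ofReal_mul, ← Complex.ofReal_sum, ← Complex.ofReal_natCast,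
    ← Complex.ofReal_one, ← Complex.ofReal_div, Complex.ofReal_re]

/-- Split `φ` into its parts on and off `B`: tameness handles the second, the trivial bound `K ‖φ‖²`
the first. -/
lemma sum_norm_sq_amp_filter_le (hK : 0 < K) {F : Fin d → Fin d → ℂ} (hF : IsFlatUnitary F)
    {θ : Fin d → Fin K → ℝ} {t b : ℝ} {B : Finset (Fin d)} (h : Tame F t b Bᶜ θ)
    {T : Finset (Fin d)} (hT : (T.card : ℝ) ≤ t) (φ : Fin d → ℂ) (hb : 0 ≤ b) :
    1 / K * captured F θ T φ ≤ 2 * ∑ w ∈ B, ‖φ w‖ ^ 2 + 2 * (b / K) * ∑ w, ‖φ w‖ ^ 2 := by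
  classical
  have hK' : (0 : ℝ) < K := by exact_mod_cast hK
  have hφ : φ = fun w => (if w ∈ B then φ w else 0) + (if w ∈ B then 0 else φ w) := by
    ext w
    split_ifs <;> simp
  have h1 := captured_le hF θ T (fun w => if w ∈ B then φ w else 0)
  have h2 := h T hT (fun w => if w ∈ B then 0 else φ w) (fun w hw => by
    simp only [Finset.mem_compl, not_not] at hw
    simp [hw])
  have e1 : ∑ w, ‖if w ∈ B then φ w else 0‖ ^ 2 = ∑ w ∈ B, ‖φ w‖ ^ 2 := by
    rw [← Finset.univ_inter B, ← Finset.sum_ite_mem]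
    refine Finset.sum_congr rfl fun w _ => ?_
    simp only [Finset.univ_inter]
    split_ifs <;> simp
  have e2 : ∑ w, ‖if w ∈ B then 0 else φ w‖ ^ 2 ≤ ∑ w, ‖φ w‖ ^ 2 := by
    refine Finset.sum_le_sum fun w _ => ?_
    split_ifs
    · simp
    · exact le_rfl
  have h3 := captured_add_le (F := F) θ T (fun w => if w ∈ B then φ w else 0)
    (fun w => if w ∈ B then 0 else φ w)
  rw [← hφ] at h3
  rw [e1] at h1
  have h4 := h2.trans (mul_le_mul_of_nonneg_left e2 hb)
  calc 1 / K * captured F θ T φ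
      ≤ 1 / K * (2 * (K * ∑ w ∈ B, ‖φ w‖ ^ 2) + 2 * (b * ∑ w, ‖φ w‖ ^ 2)) := by
        gcongr
        linarith
    _ = _ := by field_simp

/-- Tameness outside a small set of positions bounds the information in every pair of local
measurements. -/
lemma mutualInfo_jointProb_le (hd : 1 ≤ d) (hK : 0 < K) (θ : Fin K → Fin d → ℝ) {t b : ℝ}
    (ht : 0 < t) (htd : t ≤ d) (hb : 0 ≤ b) {B : Finset (Fin d)}
    (h : Tame (fourierVec d) t b Bᶜ fun w k => θ k w) {X Y : Type*} [Fintype X] [Fintype Y]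
    (M : POVM (Fin d) X) (N : POVM (Fin d) Y) :
    mutualInfo (jointProb (rhoAE θ) M N) * Real.log 2
      ≤ (2 * (B.card / d) + 2 * (b / K)) * Real.log d + Real.log (d / t) := by
  have hd' : (0 : ℝ) < d := by exact_mod_cast (by omega : 0 < d)
  have hK' : (0 : ℝ) < K := by exact_mod_cast hK
  have hF := isFlatUnitary_fourierVec d
  obtain ⟨A, hA⟩ := M.exists_factor
  obtain ⟨Z, hZ⟩ := N.exists_factor
  set q : Fin d → Y → ℝ := fun m y =>
    1 / K * ∑ k, ∑ j, ‖amp (fourierVec d) (fun w k => θ k w) (Z y j) k m‖ ^ 2 with hq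
  set τ : Y → ℝ := fun y => ∑ j, ∑ w, ‖Z y j w‖ ^ 2 with hτ
  have hqT : ∀ (T : Finset (Fin d)) y, ∑ m ∈ T, q m y
      = ∑ j, 1 / K * captured (fourierVec d) (fun w k => θ k w) T (Z y j) := by
    intro T y
    simp only [hq, captured, ← Finset.mul_sum]
    congr 1
    rw [Finset.sum_comm, Finset.sum_comm (s := Finset.univ (α := Fin d))]
    refine Finset.sum_congr rfl fun k _ => ?_
    rw [Finset.sum_comm]
  have hqτ : ∀ y, ∑ m, q m y = τ y := by
    intro y
    rw [hqT, hτ]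
    refine Finset.sum_congr rfl fun j _ => ?_
    simp only [captured, sum_norm_sq_amp hF, Finset.sum_const, Finset.card_univ, Fintype.card_fin,
      nsmul_eq_mul]
    field_simp
  have hq0 : ∀ m y, 0 ≤ q m y := fun m y => by simp only [hq]; positivity
  have hq1 : ∀ m, ∑ y, q m y = 1 := by
    intro m
    simp only [hq, ← Finset.mul_sum]
    rw [Finset.sum_comm]
    simp only [← mulVec_codeword, N.sum_norm_sq_mulVec hZ, sum_norm_sq_codeword, Finset.sum_const,
      Finset.card_univ, Fintype.card_fin, nsmul_eq_mul]
    field_simp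
  have hmix := mutualInfo_mixture_le hd (fun x m => ∑ j, ‖A x j m‖ ^ 2) q
    (fun x m => by positivity) hq0 (fun m => M.sum_norm_sq_column hA m) hq1
  rw [jointProb_rhoAE θ M N hA hZ]
  refine hmix.trans ?_
  have hy : ∀ y, ∑ m, q m y * Real.log (q m y / (1 / d * ∑ m, q m y))
      ≤ (2 * ∑ w ∈ B, ∑ j, ‖Z y j w‖ ^ 2 + 2 * (b / K) * τ y) * Real.log d
        + τ y * Real.log (d / t) := by
    intro y
    rw [hqτ]
    refine sum_mul_log_le hd ht htd (fun m => q m y) (fun m => hq0 m y) (hqτ y) fun T hT => ?_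
    rw [hqT]
    refine (Finset.sum_le_sum fun j _ => sum_norm_sq_amp_filter_le hK hF h hT (Z y j) hb).trans
      (le_of_eq ?_)
    rw [Finset.sum_add_distrib, ← Finset.mul_sum, ← Finset.mul_sum, Finset.sum_comm]
  have hτd : ∑ y, τ y = d := by
    simp only [hτ]
    simp_rw [Finset.sum_comm (γ := Fin d) (s := Finset.univ) (t := Finset.univ)
      (f := fun j w => ‖Z _ j w‖ ^ 2)]
    rw [Finset.sum_comm]
    simp only [N.sum_norm_sq_column hZ, Finset.sum_const, Finset.card_univ, Fintype.card_fin,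
      nsmul_eq_mul, mul_one]
  -- Completeness of the measurement normalises each column, so over all outcomes the trivial bound
  -- on `B` is paid only `B.card` times; the prefactor `1 / d` makes this a small fraction.
  have hBc : ∑ y, ∑ w ∈ B, ∑ j, ‖Z y j w‖ ^ 2 = B.card := by
    rw [Finset.sum_comm]
    simp only [N.sum_norm_sq_column hZ, Finset.sum_const, nsmul_eq_mul, mul_one]
  calc 1 / d * ∑ y, ∑ m, q m y * Real.log (q m y / (1 / d * ∑ m, q m y))
      ≤ 1 / d * ∑ y, ((2 * ∑ w ∈ B, ∑ j, ‖Z y j w‖ ^ 2 + 2 * (b / K) * τ y) * Real.log d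
        + τ y * Real.log (d / t)) := by
        gcongr with y
        exact hy y
    _ = 1 / d * ((2 * B.card + 2 * (b / K) * d) * Real.log d + d * Real.log (d / t)) := by
        rw [Finset.sum_add_distrib, ← Finset.sum_mul, ← Finset.sum_mul, Finset.sum_add_distrib,
          ← Finset.mul_sum, ← Finset.mul_sum, hτd, hBc]
    _ = _ := by field_simp

lemma accessibleInfo_rhoAE_le (hd : 1 ≤ d) (hK : 0 < K) (θ : Fin K → Fin d → ℝ) {t b c : ℝ}
    (ht : 0 < t) (htd : t ≤ d) (hb : 0 ≤ b) {B : Finset (Fin d)}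
    (h : Tame (fourierVec d) t b Bᶜ fun w k => θ k w)
    (hc : (2 * (B.card / d) + 2 * (b / K)) * Real.log d + Real.log (d / t) ≤ c * Real.log d) :
    accessibleInfo (rhoAE θ) ≤ ((c * Real.logb 2 d : ℝ) : EReal) := by
  refine iSup_le fun r => iSup_le fun s => iSup_le fun M => iSup_le fun N => ?_
  rw [EReal.coe_le_coe_iff, Real.logb, ← mul_div_assoc, le_div_iff₀ (Real.log_pos one_lt_two)]
  exact (mutualInfo_jointProb_le hd hK θ ht htd hb h M N).trans hc

/-- Removing all positions makes tameness vacuous and leaves a deterministic bound, which settles `δ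
> 1`. -/
lemma accessibleInfo_rhoAE_le_two_mul (hd : 1 ≤ d) (hK : 0 < K) (θ : Fin K → Fin d → ℝ) {c : ℝ}
    (hc : 2 ≤ c) : accessibleInfo (rhoAE θ) ≤ ((c * Real.logb 2 d : ℝ) : EReal) := by
  have hd' : (0 : ℝ) < d := by exact_mod_cast (by omega : 0 < d)
  have hlog : 0 ≤ Real.log d := Real.log_nonneg (by exact_mod_cast hd)
  refine accessibleInfo_rhoAE_le hd hK θ (t := d) (b := 0) (B := Finset.univ) hd' le_rfl le_rfl
    (by rw [Finset.compl_univ]; exact tame_empty _ _ _) ?_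
  simp only [Finset.card_univ, Fintype.card_fin, div_self hd'.ne', Real.log_one, zero_div,
    mul_zero, add_zero, mul_one]
  gcongr

end Eavesdropping

/-! ### Transfer to the given random variables. -/

section Law

variable {d K : ℕ}

/-- The law of the phases, as a product measure over the positions. -/
lemma map_phases_eq_phaseLaw {Ω : Type*} [MeasurableSpace Ω] (μ : Measure Ω)
    [IsProbabilityMeasure μ] (θ : Fin K → Fin d → Ω → ℝ) (hθ : ∀ k w, Measurable (θ k w))
    (hind : iIndepFun (fun p : Fin K × Fin d => θ p.1 p.2) μ) :
    μ.map (fun x w k => θ k w x) = phaseLaw fun w k => μ.map (θ k w) := by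
  have hprob : ∀ k w, IsProbabilityMeasure (μ.map (θ k w)) := fun k w =>
    Measure.isProbabilityMeasure_map (hθ k w).aemeasurable
  have hmeas : Measurable fun x w k => θ k w x :=
    measurable_pi_lambda _ fun w => measurable_pi_lambda _ fun k => hθ k w
  unfold phaseLaw
  symm
  -- Each block carries a product σ-algebra itself, so it suffices to test on rectangles inside the
  -- blocks, where independence factorises the measure.
  refine Measure.pi_eq_generateFrom (C := fun _ => Set.pi Set.univ ''
    Set.pi Set.univ fun _ : Fin K => {s : Set ℝ | MeasurableSet s}) (fun _ => generateFrom_pi)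
    (fun _ => isPiSystem_pi) (fun w => ?_) ?_
  · refine ⟨fun _ => Set.univ, fun _ => ⟨fun _ => Set.univ, by simp, by simp⟩, fun _ => ?_, ?_⟩
    · exact measure_lt_top _ _
    · exact Set.iUnion_const _
  · intro s hs
    choose u hu hus using hs
    have hum : ∀ w k, MeasurableSet (u w k) := fun w k => hu w k (Set.mem_univ k)
    have hsm : ∀ w, MeasurableSet (s w) := fun w => by
      rw [← hus w]; exact MeasurableSet.univ_pi (hum w)
    rw [Measure.map_apply hmeas (MeasurableSet.univ_pi hsm)]
    have h := hind.measure_inter_preimage_eq_mul (S := Finset.univ)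
      (sets := fun p => u p.2 p.1) (fun p _ => hum _ _)
    have hset : (fun x w k => θ k w x) ⁻¹' Set.pi Set.univ s
        = ⋂ p ∈ (Finset.univ : Finset (Fin K × Fin d)), θ p.1 p.2 ⁻¹' u p.2 p.1 := by
      ext x
      simp only [Set.mem_preimage, Set.mem_pi, Set.mem_univ, forall_true_left, Set.mem_iInter,
        Finset.mem_univ, ← hus, Prod.forall]
      exact forall_comm
    rw [hset, h, Fintype.prod_prod_type_right]
    refine Finset.prod_congr rfl fun w _ => ?_
    rw [← hus w, Measure.pi_pi]
    exact Finset.prod_congr rfl fun k _ => (Measure.map_apply (hθ k w) (hum w k)).symm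

/-- In large dimension, the accessible information is small with overwhelming probability. -/
lemma real_accessibleInfo_le {δ : ℝ} (hδ : 0 < δ) (hδ1 : δ ≤ 1) (hK0 : 0 < K)
    (hK : 4 * Real.log d ≤ δ ^ 2 * K) (h11 : 11 ≤ Real.log d) (hdδ : 10 / d ≤ δ)
    (hlogδ : Real.log (24 / δ ^ 3) ≤ δ * Real.log d)
    {Ω : Type*} [MeasurableSpace Ω] (μ : Measure Ω)
    [IsProbabilityMeasure μ] (θ : Fin K → Fin d → Ω → ℝ) (hθ : ∀ k w, Measurable (θ k w))
    (hind : iIndepFun (fun p : Fin K × Fin d => θ p.1 p.2) μ)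
    (hmean : ∀ k w, ∫ x, Complex.exp (Complex.I * (θ k w x : ℂ)) ∂μ = 0) :
    μ.real {x | ((12005 * δ * Real.logb 2 d : ℝ) : EReal) <
        accessibleInfo (rhoAE fun k w => θ k w x)}
      ≤ Real.exp (-(2 * δ ^ 2 * d)) := by
  have hprob : ∀ w k, IsProbabilityMeasure (μ.map (θ k w)) := fun w k =>
    Measure.isProbabilityMeasure_map (hθ k w).aemeasurable
  have hmeas : Measurable fun x w k => θ k w x :=
    measurable_pi_lambda _ fun w => measurable_pi_lambda _ fun k => hθ k w
  have hd : 2 ≤ d := by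
    by_contra hlt
    have : (d : ℝ) ≤ 1 := by exact_mod_cast (by omega : d ≤ 1)
    have := Real.log_nonpos (Nat.cast_nonneg d) this
    linarith
  have hd' : (0 : ℝ) < d := by exact_mod_cast (by omega : 0 < d)
  have hK' : (0 : ℝ) < K := by exact_mod_cast hK0
  have hν : ∀ w k, ∫ x, phase x ∂(μ.map (θ k w)) = 0 := by
    intro w k
    rw [integral_map (hθ k w).aemeasurable continuous_phase.aestronglyMeasurable]
    exact hmean k w
  -- The offset 6 gives more than `16 d ≤ 4^(J-1)`, and `log d ≥ 11` is what makes `log d / log 2 +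
  -- 6 ≤ 2 log d`.
  set J := Nat.log 2 d + 6 with hJdef
  have hJ : (J : ℝ) ≤ 2 * Real.log d := by
    have h1 : (2 : ℝ) ^ Nat.log 2 d ≤ d := by
      exact_mod_cast Nat.pow_log_le_self 2 (by omega : d ≠ 0)
    have h2 := Real.log_le_log (by positivity) h1
    rw [Real.log_pow] at h2
    have h3 := Real.log_two_gt_d9
    have h4 : (0 : ℝ) ≤ Nat.log 2 d := Nat.cast_nonneg _
    rw [hJdef]
    push_cast
    nlinarith
  have hJ' : 16 * (d : ℝ) ≤ 4 ^ (J - 1) := by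
    have h1 : (d : ℝ) ≤ 2 ^ (Nat.log 2 d + 1) := by
      exact_mod_cast (Nat.lt_pow_succ_log_self one_lt_two d).le
    have h2 : (2 : ℝ) ^ Nat.log 2 d ≤ 4 ^ Nat.log 2 d :=
      pow_le_pow_left₀ (by norm_num) (by norm_num) _
    rw [show J - 1 = Nat.log 2 d + 5 by omega, pow_add]
    rw [pow_succ] at h1
    have h3 : (0 : ℝ) < 4 ^ Nat.log 2 d := by positivity
    linarith
  have htail := defect_tail (ν := fun w k => μ.map (θ k w)) (isFlatUnitary_fourierVec d) hν hd hK0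
    hδ hδ1 hJ hJ' (by omega) hK hdδ
  rw [← map_phases_eq_phaseLaw μ θ hθ hind, map_measureReal_apply hmeas] at htail
  · refine (measureReal_mono ?_).trans htail
    intro x hx
    by_contra hcon
    simp only [Set.mem_preimage, Set.mem_ofPred_eq, not_le] at hcon
    obtain ⟨B, hB, hT⟩ := exists_defect_eq_card (fourierVec d) (δ ^ 3 * d / 24) (6000 * δ * K)
      (fun w k => θ k w x)
    rw [← hB] at hcon
    rw [Set.mem_ofPred_eq] at hx
    refine absurd hx (not_lt.mpr ?_)
    have hδ3 : δ ^ 3 ≤ 1 := pow_le_one₀ hδ.le hδ1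
    refine accessibleInfo_rhoAE_le (by omega) hK0 (fun k w => θ k w x) (by positivity) ?_
      (by positivity) hT ?_
    · nlinarith
    · have e1 : d / (δ ^ 3 * d / 24) = 24 / δ ^ 3 := by field_simp
      have e2 : 6000 * δ * K / K = 6000 * δ := by field_simp
      -- The constant is `12005 = 2 * 2 + 2 * 6000 + 1`: removed positions, captured energy, and
      -- `log (24/δ³) ≤ δ log d`.
      have e3 : (B.card : ℝ) / d ≤ 2 * δ := by
        rw [div_le_iff₀ hd']; exact hcon.le
      rw [e1, e2]
      have : (2 * (B.card / d) + 2 * (6000 * δ)) * Real.log d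
          ≤ (2 * (2 * δ) + 2 * (6000 * δ)) * Real.log d := by gcongr
      linarith
  · exact measurableSet_le measurable_const (measurable_from_nat.comp (measurable_defect _ _))

end Law

end DataLocking

/-! ### Assembly and choice of constants. -/

theorem theorem4 :
    -- the phase unitaries form an abelian group under composition
    (∀ d : ℕ, ∃ H : Subgroup (Matrix.unitaryGroup (Fin d) ℂ),
      (∀ U : Matrix (Fin d) (Fin d) ℂ,
        (∃ V ∈ H, (V : Matrix (Fin d) (Fin d) ℂ) = U) ↔
          ∃ t : Fin d → ℝ, U = DataLocking.phaseUnitary t) ∧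
      ∀ V ∈ H, ∀ W ∈ H, V * W = W * V) ∧
    -- for every choice of the unitaries and every key value, Bob decodes with success probability 1
    (∀ (d K : ℕ) (θ : Fin K → Fin d → ℝ), 1 ≤ d → ∀ k : Fin K,
      ∃ Λ : DataLocking.POVM (Fin d) (Fin d), DataLocking.successProb (θ k) Λ = 1) ∧
    -- bound on Eve's accessible information
    (∃ C : ℝ, 0 < C ∧ ∀ δ : ℝ, 0 < δ → ∃ A c : ℝ, 0 < A ∧ 0 < c ∧
      ∀ (d K : ℕ), 1 ≤ d → 1 ≤ K →
        (K : ℝ) > 4 / δ ^ 2 * (Real.log d + 2 / δ * Real.log (5 / δ)) →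
        ∀ (Ω : Type*) [MeasurableSpace Ω] (μ : Measure Ω) [IsProbabilityMeasure μ]
          (θ : Fin K → Fin d → Ω → ℝ),
          (∀ k w, Measurable (θ k w)) →
          iIndepFun (fun p : Fin K × Fin d => θ p.1 p.2) μ →
          (∀ k w k' w', IdentDistrib (θ k w) (θ k' w') μ μ) →
          (∀ k w, ∫ x, Complex.exp (Complex.I * (θ k w x : ℂ)) ∂μ = 0) →
          μ.real {x | ((C * δ * Real.logb 2 d : ℝ) : EReal) <
              DataLocking.accessibleInfo (DataLocking.rhoAE fun k w => θ k w x)}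
            ≤ A * Real.exp (-(c * d))) := by
  refine ⟨DataLocking.exists_phaseGroup, fun d K θ hd k => DataLocking.exists_perfect_decoder hd _,
    12005, by norm_num, fun δ hδ => ?_⟩
  rcases le_or_gt δ 1 with hδ1 | hδ1
  · obtain ⟨d₀, h11, h10, h24⟩ : ∃ d₀ : ℝ, Real.exp 11 ≤ d₀ ∧ 10 / δ ≤ d₀ ∧
        Real.exp (Real.log (24 / δ ^ 3) / δ) ≤ d₀ :=
      ⟨max (Real.exp 11) (max (10 / δ) (Real.exp (Real.log (24 / δ ^ 3) / δ))), le_max_left _ _,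
        (le_max_left _ _).trans (le_max_right _ _), (le_max_right _ _).trans (le_max_right _ _)⟩
    -- The prefactor makes the bound at least one for `d < d₀`, so only large dimensions need an
    -- argument.
    refine ⟨Real.exp (2 * δ ^ 2 * d₀), 2 * δ ^ 2, Real.exp_pos _, by positivity, ?_⟩
    intro d K hd hK hKlarge Ω _ μ _ θ hθ hind _ hmean
    have hd' : (0 : ℝ) < d := by exact_mod_cast (by omega : 0 < d)
    have hd₀ : 0 < d₀ := (Real.exp_pos _).trans_le h11
    rw [← Real.exp_add]
    rcases lt_or_ge (d : ℝ) d₀ with hlt | hge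
    · refine measureReal_le_one.trans (Real.one_le_exp ?_)
      have : 2 * δ ^ 2 * d ≤ 2 * δ ^ 2 * d₀ := by gcongr
      linarith
    · have hlog : ∀ x : ℝ, Real.exp x ≤ d₀ → x ≤ Real.log d := fun x hx =>
        (Real.le_log_iff_exp_le hd').mpr (hx.trans hge)
      have hK4 : 4 * Real.log d ≤ δ ^ 2 * K := by
        have h5 : 0 ≤ 2 / δ * Real.log (5 / δ) := by
          have : 1 ≤ 5 / δ := by rw [le_div_iff₀ hδ]; linarith
          have := Real.log_nonneg this
          positivity
        have h6 : 4 / δ ^ 2 * Real.log d ≤ K := by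
          refine le_trans ?_ hKlarge.le
          gcongr
          linarith
        rw [div_mul_eq_mul_div, div_le_iff₀ (by positivity)] at h6
        linarith
      refine (DataLocking.real_accessibleInfo_le hδ hδ1 (by omega) hK4 (hlog _ h11) ?_ ?_ μ θ hθ hind
        hmean).trans (Real.exp_le_exp.mpr ?_)
      · rw [div_le_iff₀ hd']
        rw [div_le_iff₀ hδ] at h10
        nlinarith
      · have := hlog _ h24
        rw [div_le_iff₀ hδ] at this
        linarith
      · have : 0 < 2 * δ ^ 2 * d₀ := by positivity
        linarith
  · refine ⟨1, 1, one_pos, one_pos, ?_⟩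
    intro d K hd hK _ Ω _ μ _ θ _ _ _ _
    have hempty : {x | ((12005 * δ * Real.logb 2 d : ℝ) : EReal) <
        DataLocking.accessibleInfo (DataLocking.rhoAE fun k w => θ k w x)} = ∅ := by
      refine Set.eq_empty_of_forall_notMem fun x hx => ?_
      rw [Set.mem_ofPred_eq] at hx
      exact absurd hx (not_lt.mpr (DataLocking.accessibleInfo_rhoAE_le_two_mul hd (by omega)
        (fun k w => θ k w x) (by linarith)))
    rw [hempty, measureReal_empty]
    positivity
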